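/- **Theorem 1.3.** Let $\Gamma = PSL(2,\mathbb{Z})$. For $P\in\Gamma$ let $\mathrm{tr}(P)\ge 0$ denote the trace of a representing matrix, with the sign of the representative chosen so that the trace is nonnegative; $P$ is hyperbolic if $\mathrm{tr}(P)>2$, and then its norm is $NP=\lambda^2$, where $\lambda>1$ and $\lambda+\lambda^{-1}=\mathrm{tr}(P)$. A hyperbolic $P$ is primitive if it is not of the form $Q^j$ with $Q\in\Gamma$ and $j\ge 2$. For a hyperbolic conjugacy class $\{P\}$, which is the class of $P_0^j$ for some primitive hyperbolic $P_0$ and some $j\ge 1$, put $\Lambda(P)=\log NP_0$. For integers $m,n$ and $q\ge 1$ let $$S(m,n;q)=\sum_{\substack{x \bmod q\\ (x,q)=1}} e^{2\pi i (mx+n\overline{x})/q},\qquad x\overline{x}\equiv 1 \pmod q,$$ be the Kloosterman sum. Let $w:\mathbb{R}\to\mathbb{C}$ be a smooth, even, compactly supported function with $w(t)=0$ for $t\in[-2,2]$, and let $\widehat w(\xi)=\int_{-\infty}^{\infty} w(x)e^{-2\pi i x\xi}\,dx$. Then, with $\{P\}$ running over all hyperbolic conjugacy classes of $\Gamma$,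 $$\sum_{\{P\}} \Lambda(P)\,\frac{w(\mathrm{tr}(P))}{\sqrt{\mathrm{tr}(P)^2-4}} = \zeta(2)\sum_{q=1}^{\infty} q^{-2}\sum_{l\in\mathbb{Z}} S(l^2,1;q)\,\widehat{w}\Big(\frac lq\Big).$$ Here the sum over classes and, for each $q\ge 1$, the sum over $l$ converge absolutely, and the sum over $q$ converges as the limit of its partial sums $\sum_{q\le Q}$ as $Q\to\infty$. -/

import Mathlib

open Filter Topology
open scoped FourierTransform ContDiff

namespace PrimeGeodesic

/-- The modular group `Γ = PSL(2, ℤ) = SL(2, ℤ) / {±1}`. -/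
abbrev Modular : Type := Matrix.ProjectiveSpecialLinearGroup (Fin 2) ℤ

/-- Two matrices of `SL(2, ℤ)` with the same image in `Γ` agree up to sign. -/
theorem eq_or_eq_neg_of_mem_center (A B : Matrix.SpecialLinearGroup (Fin 2) ℤ)
    (h : A⁻¹ * B ∈ Subgroup.center (Matrix.SpecialLinearGroup (Fin 2) ℤ)) :
    B = A ∨ B = -A := by
  rw [Matrix.SpecialLinearGroup.mem_center_iff] at h
  obtain ⟨r, hr, hs⟩ := h
  have hr' : r = 1 ∨ r = -1 := by simpa using hr
  rcases hr' with rfl | rfl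
  · left
    have h1 : A⁻¹ * B = 1 := by
      ext i j
      rw [← hs]
      simp
    simpa using congrArg (A * ·) h1
  · right
    have h1 : A⁻¹ * B = -1 := by
      ext i j
      rw [← hs]
      fin_cases i <;> fin_cases j <;> simp
    simpa using congrArg (A * ·) h1

/-- The trace of an element `P` of `Γ`: the trace of a representing matrix, with the sign of the
representative chosen so that the trace is nonnegative. -/
def tr (P : Modular) : ℤ :=
  Quotient.liftOn P
    (fun A : Matrix.SpecialLinearGroup (Fin 2) ℤ => |(A : Matrix (Fin 2) (Fin 2) ℤ).trace|)
    (by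
      intro A B h
      rcases eq_or_eq_neg_of_mem_center A B (QuotientGroup.leftRel_apply.mp h) with rfl | rfl
      · rfl
      · simp only [Matrix.SpecialLinearGroup.coe_neg, Matrix.trace_neg, abs_neg])

theorem tr_mk (A : Matrix.SpecialLinearGroup (Fin 2) ℤ) :
    tr (QuotientGroup.mk A) = |(A : Matrix (Fin 2) (Fin 2) ℤ).trace| := rfl

theorem tr_conj (P Q : Modular) : tr (Q * P * Q⁻¹) = tr P := by
  induction P using QuotientGroup.induction_on with
  | H A =>
    induction Q using QuotientGroup.induction_on with
    | H B =>
      have h : Matrix.trace ((B * A * B⁻¹ : Matrix.SpecialLinearGroup (Fin 2) ℤ) :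
          Matrix (Fin 2) (Fin 2) ℤ) = Matrix.trace (A : Matrix (Fin 2) (Fin 2) ℤ) := by
        rw [Matrix.SpecialLinearGroup.coe_mul, Matrix.trace_mul_comm,
          ← Matrix.SpecialLinearGroup.coe_mul, ← mul_assoc, inv_mul_cancel, one_mul]
      rw [← QuotientGroup.mk_inv, ← QuotientGroup.mk_mul, ← QuotientGroup.mk_mul, tr_mk, tr_mk, h]

/-- An element of `Γ` is hyperbolic if its trace exceeds `2`; equivalently it is conjugate over
`SL(2, ℝ)`, up to sign, to `diag(λ, λ⁻¹)` with `λ > 1`. -/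
def IsHyperbolic (P : Modular) : Prop := 2 < tr P

/-- A hyperbolic element of `Γ` is primitive if it is not `Q ^ j` with `Q ∈ Γ` and `j ≥ 2`. -/
def IsPrimitive (P : Modular) : Prop :=
  IsHyperbolic P ∧ ∀ (Q : Modular) (j : ℕ), 2 ≤ j → P ≠ Q ^ j

/-- The norm `NP = λ²`, where `λ > 1` is the larger root of `λ + λ⁻¹ = tr P`. -/
noncomputable def hypNorm (P : Modular) : ℝ :=
  (((tr P : ℝ) + Real.sqrt ((tr P : ℝ) ^ 2 - 4)) / 2) ^ 2

/-- The trace of a conjugacy class of `Γ`. -/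
def classTr (C : ConjClasses Modular) : ℤ :=
  Quotient.liftOn C tr (by
    intro P P' h
    obtain ⟨Q, rfl⟩ := isConj_iff.mp h
    exact (tr_conj P Q).symm)

/-- The hyperbolic conjugacy classes of `Γ`. -/
abbrev HyperbolicClass : Type := {C : ConjClasses Modular // 2 < classTr C}

open Classical in
/-- `Λ(P) = log N(P₀)` if the class of `P` is the class of `P₀ ^ j` with `P₀` primitive hyperbolic
and `j ≥ 1`. -/
noncomputable def Lambda (C : ConjClasses Modular) : ℝ :=
  if h : ∃ P₀ : Modular, IsPrimitive P₀ ∧ ∃ j : ℕ, 1 ≤ j ∧ C = ConjClasses.mk (P₀ ^ j) then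
    Real.log (hypNorm h.choose)
  else 0

/-- The Kloosterman sum `S(m, n; q)`, the sum of `e((m x + n x⁻¹) / q)` over the residue classes
`x` modulo `q` coprime to `q`, where `x⁻¹` is the inverse of `x` modulo `q`. -/
noncomputable def kloosterman (m n : ℤ) (q : ℕ) : ℂ :=
  ∑ x ∈ (Finset.range q).filter (fun x => Nat.Coprime x q),
    Complex.exp (2 * Real.pi * Complex.I *
      (((m * x + n * (((x : ZMod q)⁻¹).val : ℤ) : ℤ) : ℂ) / (q : ℂ)))

end PrimeGeodesic

/-! The support of `w` leaves only finitely many traces t with |t| > 2, and evenness of `w` folds -t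
onto t. The identity then holds for each t > 2 separately.

Exponential sums: for fixed q the function l ↦ S(l², 1; q) has period q, so Poisson summation on
each residue class modulo q replaces the l-sum by a sum over n of w(n) times Σ_a S(a², 1; q)
e(na/q). Opening the Kloosterman sum and rescaling a by a unit turns the latter into a sum over b of
Ramanujan sums c_q(b² - nb + 1), up to the sign of n. This equals q (ρ_n * μ)(q), where ρ_n(d)
counts the roots of b² - nb + 1 modulo d (`ramanujanSum_eq`, `tsum_kloosterman_mul_fourier`). What
remains is a class number formula (`zeta_two_mul_eq_sum_Lambda`): ζ(2) Σ_q (ρ_t * μ)(q)/q is the sum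
of Λ(C) / (2√(t² - 4)) over the classes C of trace t.

Convergence of that q-series: t² - 4 is not a square, so its Jacobi symbol sums to zero over a
period and Σ (t² - 4 / n)/n converges by Dirichlet's test. The function ρ_t * μ is the convolution
of this symbol with a function whose Euler factors are 1 + O(p⁻²) at all but finitely many primes.
Mertens' theorem gives the limit, and Abel's theorem identifies it with the value of the Dirichlet
series as s → 1⁺.

Class number formula: a root b modulo n is a matrix of trace t with lower left entry n, taken up to
translation. Writing such a matrix as g P g⁻¹ with P a representative of its class, n is the value
of a binary quadratic form of discriminant t² - 4 at the bottom row of g, and g is determined up to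
translation and the centralizer of P. That centralizer is ± an infinite cyclic group, whose
generator has an eigenvalue ε > 1 with Λ = 2 log ε. Hence ρ_t(n) counts primitive vectors of value n
in a fundamental cone, summed over classes. Allowing imprimitive vectors multiplies the Dirichlet
series by ζ(2s). The cone contains about N log ε / √(t² - 4) lattice points of value at most N, and
comparing residues at s = 1 gives the formula. -/

/-! ### Convergence tools for Dirichlet series -/

open Finset in
/-- Mertens' theorem for Dirichlet convolutions: the convolution of a convergent series with an
absolutely convergent one converges to the product. -/
theorem tendsto_sum_Ioc_mul_of_summable {a b : ArithmeticFunction ℂ} {A : ℂ}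
    (ha : Tendsto (fun N : ℕ => ∑ n ∈ Ioc 0 N, a n) atTop (𝓝 A))
    (hb : Summable fun n => ‖b n‖) :
    Tendsto (fun N : ℕ => ∑ n ∈ Ioc 0 N, (b * a) n) atTop (𝓝 (∑' n, b n * A)) := by
  simp_rw [ArithmeticFunction.sum_Ioc_mul_eq_sum_sum]
  obtain ⟨K, hK⟩ := (ha.cauchySeq.isBounded_range).exists_norm_le
  have h1 : ∀ N : ℕ, ∑ n ∈ Ioc 0 N, b n * ∑ m ∈ Ioc 0 (N / n), a m =
      ∑' n, b n * ∑ m ∈ Ioc 0 (N / n), a m := by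
    intro N
    rw [tsum_eq_sum]
    intro n hn
    rcases Nat.eq_zero_or_pos n with rfl | h0
    · simp
    · have : N < n := by simpa [h0] using hn
      simp [Nat.div_eq_of_lt this]
  simp_rw [h1]
  refine tendsto_tsum_of_dominated_convergence (bound := fun n => ‖b n‖ * K)
    (hb.mul_right K) ?_ ?_
  · intro n
    rcases Nat.eq_zero_or_pos n with rfl | h0
    · simp
    · exact (ha.comp (Nat.tendsto_div_const_atTop h0.ne')).const_mul _
  · refine Eventually.of_forall fun N n => ?_
    rw [norm_mul]
    gcongr
    exact hK _ ⟨N / n, rfl⟩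

/-- Summation by parts, arranged so that partial sums enter only through their deviation from `A`.
-/
theorem sum_Ioc_mul_sub_eq (a : ℕ → ℂ) (w : ℕ → ℝ) (A : ℂ) (N : ℕ) :
    ∑ n ∈ Finset.Ioc 0 N, a n * w n - A * w 1 =
      (∑ n ∈ Finset.Ioc 0 N, a n - A) * w (N + 1) +
        ∑ n ∈ Finset.range N, (∑ k ∈ Finset.Ioc 0 (n + 1), a k - A) *
          (w (n + 1) - w (n + 2) : ℝ) := by
  induction N with
  | zero => simp
  | succ N ih =>
    have h1 : ∀ f : ℕ → ℂ, ∑ n ∈ Finset.Ioc 0 (N + 1), f n =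
        ∑ n ∈ Finset.Ioc 0 N, f n + f (N + 1) := fun f =>
      Finset.sum_Ioc_succ_top (Nat.zero_le _) _
    rw [Finset.sum_range_succ, h1, h1]
    push_cast at ih ⊢
    linear_combination ih

/-- Up to `M` the deviations are only bounded by `K`, but the weights drop by just `1 - w (M + 1)`.
Beyond `M` the deviations are at most `ε`, and the total drop of the weights is at most 1. -/
theorem norm_sum_Ioc_mul_sub_le {a : ℕ → ℂ} {w : ℕ → ℝ} {A : ℂ} {K ε : ℝ} {M N : ℕ}
    (hw : Antitone fun n => w (n + 1)) (hw1 : w 1 = 1) (hw0 : ∀ n, 0 ≤ w n) (hε : 0 ≤ ε)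
    (hK : ∀ n, ‖∑ k ∈ Finset.Ioc 0 n, a k - A‖ ≤ K)
    (hM : ∀ n, M ≤ n → ‖∑ k ∈ Finset.Ioc 0 n, a k - A‖ ≤ ε) (hMN : M ≤ N) :
    ‖∑ n ∈ Finset.Ioc 0 N, a n * w n - A‖ ≤ K * w (N + 1) + K * (1 - w (M + 1)) + ε := by
  have hd : ∀ n, 0 ≤ w (n + 1) - w (n + 2) := fun n => sub_nonneg.2 (hw (Nat.le_succ n))
  have h0 := sum_Ioc_mul_sub_eq a w A N
  rw [hw1, Complex.ofReal_one, mul_one] at h0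
  rw [h0]
  refine (norm_add_le _ _).trans ?_
  have h2 : ‖(∑ n ∈ Finset.Ioc 0 N, a n - A) * w (N + 1)‖ ≤ K * w (N + 1) := by
    rw [norm_mul, Complex.norm_real, Real.norm_of_nonneg (hw0 _)]
    exact mul_le_mul_of_nonneg_right (hK N) (hw0 _)
  have h3 : ∀ n, ‖(∑ k ∈ Finset.Ioc 0 (n + 1), a k - A) * (w (n + 1) - w (n + 2) : ℝ)‖ =
      ‖∑ k ∈ Finset.Ioc 0 (n + 1), a k - A‖ * (w (n + 1) - w (n + 2)) := fun n => by
    rw [norm_mul, Complex.norm_real, Real.norm_of_nonneg (hd n)]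
  have h4 : ∀ m, ∑ n ∈ Finset.range m, (w (n + 1) - w (n + 2)) = 1 - w (m + 1) := fun m => by
    rw [Finset.sum_range_sub' (fun n => w (n + 1)), zero_add, hw1]
  have h5 : ‖∑ n ∈ Finset.range N, (∑ k ∈ Finset.Ioc 0 (n + 1), a k - A) *
      (w (n + 1) - w (n + 2) : ℝ)‖ ≤ K * (1 - w (M + 1)) + ε := by
    refine (norm_sum_le _ _).trans ?_
    simp_rw [h3]
    rw [← Finset.sum_range_add_sum_Ico _ hMN]
    refine add_le_add ?_ ?_
    · rw [← h4, Finset.mul_sum]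
      exact Finset.sum_le_sum fun n _ => mul_le_mul_of_nonneg_right (hK _) (hd n)
    · calc ∑ n ∈ Finset.Ico M N, ‖∑ k ∈ Finset.Ioc 0 (n + 1), a k - A‖ * (w (n + 1) - w (n + 2))
          ≤ ∑ n ∈ Finset.Ico M N, ε * (w (n + 1) - w (n + 2)) := by
            refine Finset.sum_le_sum fun n hn => mul_le_mul_of_nonneg_right (hM _ ?_) (hd n)
            have := (Finset.mem_Ico.1 hn).1
            omega
        _ ≤ ∑ n ∈ Finset.range N, ε * (w (n + 1) - w (n + 2)) := by
            refine Finset.sum_le_sum_of_subset_of_nonneg ?_ fun n _ _ => mul_nonneg hε (hd n)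
            intro n hn
            simpa using (Finset.mem_Ico.1 hn).2
        _ ≤ ε := by
            rw [← Finset.mul_sum, h4]
            nlinarith [hw0 (N + 1)]
  linarith

/-- Abel's theorem for Dirichlet series at `s = 1`. -/
theorem tendsto_LSeries_nhdsGT_one {a : ℕ → ℂ} {A : ℂ}
    (hA : Tendsto (fun N : ℕ => ∑ n ∈ Finset.Ioc 0 N, a n / n) atTop (𝓝 A))
    (hs : ∀ s : ℝ, 1 < s → LSeriesSummable a s) :
    Tendsto (fun s : ℝ => LSeries a s) (𝓝[>] 1) (𝓝 A) := by
  have hA' : Tendsto (fun N : ℕ => ∑ n ∈ Finset.Ioc 0 N, a n / n - A) atTop (𝓝 0) := by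
    simpa using hA.sub_const A
  obtain ⟨K, hK⟩ := (hA'.cauchySeq.isBounded_range).exists_norm_le
  have hK0 : 0 ≤ K := (norm_nonneg _).trans (hK _ ⟨0, rfl⟩)
  rw [Metric.tendsto_nhds]
  intro ε hε
  obtain ⟨M, hM⟩ := (Metric.tendsto_atTop.1 hA') (ε / 3) (by positivity)
  -- With `M` fixed, the cost of the first `M` terms tends to 0 as s → 1⁺.
  have hcont : Tendsto (fun s : ℝ => K * (1 - ((M + 1 : ℕ) : ℝ) ^ (1 - s))) (𝓝[>] 1) (𝓝 0) := by
    have : ContinuousAt (fun s : ℝ => K * (1 - ((M + 1 : ℕ) : ℝ) ^ (1 - s))) 1 := by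
      refine ContinuousAt.mul continuousAt_const (continuousAt_const.sub ?_)
      exact ContinuousAt.rpow continuousAt_const (by fun_prop) (Or.inl (by positivity))
    have h := this.tendsto
    simp only [sub_self, Real.rpow_zero, mul_zero] at h
    exact h.mono_left nhdsWithin_le_nhds
  filter_upwards [hcont.eventually_lt_const (show 0 < ε / 3 by positivity),
    self_mem_nhdsWithin] with s hs1 hs2
  have hs2 : 1 < s := hs2
  set w : ℕ → ℝ := fun n => (n : ℝ) ^ (1 - s) with hw
  have hwlim : Tendsto (fun N : ℕ => w (N + 1)) atTop (𝓝 0) := by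
    have := (tendsto_rpow_neg_atTop (show 0 < s - 1 by linarith)).comp
      (tendsto_natCast_atTop_atTop (R := ℝ))
    rw [neg_sub] at this
    exact this.comp (tendsto_add_atTop_nat 1)
  have hterm : ∀ n, LSeries.term a s n = a n / n * w n := by
    intro n
    rcases Nat.eq_zero_or_pos n with rfl | h0
    · simp
    · have hn : (n : ℂ) ≠ 0 := by exact_mod_cast h0.ne'
      rw [LSeries.term_of_ne_zero h0.ne', hw]
      simp only
      rw [Complex.ofReal_cpow (Nat.cast_nonneg n)]
      push_cast
      rw [Complex.cpow_sub _ _ hn, Complex.cpow_one]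
      field_simp
  have hlim : Tendsto (fun N : ℕ => ∑ n ∈ Finset.Ioc 0 N, a n / n * w n) atTop
      (𝓝 (LSeries a s)) := by
    have h1 := ((hs s hs2).hasSum.tendsto_sum_nat).comp (tendsto_add_atTop_nat 1)
    refine h1.congr fun N => ?_
    simp only [Function.comp, hterm]
    rw [Finset.range_eq_Ico, Finset.sum_eq_sum_Ico_succ_bot (Nat.succ_pos N)]
    simp only [Nat.cast_zero, div_zero, zero_mul, zero_add]
    rfl
  have hbound : ‖LSeries a s - A‖ ≤ K * 0 + K * (1 - w (M + 1)) + ε / 3 := by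
    refine le_of_tendsto_of_tendsto (hlim.sub_const A).norm
      (((hwlim.const_mul K).add_const _).add_const _) ?_
    filter_upwards [eventually_ge_atTop M] with N hN
    refine norm_sum_Ioc_mul_sub_le ?_ (by simp [hw]) (fun n => by positivity) (by positivity)
      (fun n => hK _ ⟨n, rfl⟩) (fun n hn => ?_) hN
    · intro m n hmn
      simp only [hw]
      refine Real.rpow_le_rpow_of_nonpos (by positivity) ?_ (by linarith)
      exact_mod_cast Nat.succ_le_succ hmn
    · have := hM n hn
      rw [dist_zero_right] at this
      exact this.le
  rw [dist_eq_norm]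
  simp only [hw] at hbound
  linarith

/-- A multiplicative function is absolutely summable if its Euler factors are close to `1`. -/
theorem ArithmeticFunction.IsMultiplicative.summable_norm {f : ArithmeticFunction ℂ}
    (hf : f.IsMultiplicative) {e : ℕ → ℝ} (he : Summable e) (he0 : ∀ p, 0 ≤ e p)
    (hsum : ∀ p : ℕ, p.Prime → Summable fun k : ℕ => ‖f (p ^ k)‖)
    (hle : ∀ p : ℕ, p.Prime → ∑' k : ℕ, ‖f (p ^ k)‖ ≤ 1 + e p) :
    Summable fun n => ‖f n‖ := by
  refine summable_of_sum_range_le (c := Real.exp (∑' p, e p)) (fun n => norm_nonneg _) fun N => ?_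
  have h := EulerProduct.summable_and_hasSum_factoredNumbers_prod_filter_prime_tsum
    (f := fun n => ‖f n‖) (by simp [hf.1]) (fun {m n} hmn => by simp [hf.2 hmn])
    (fun {p} hp => by simpa using hsum p hp) (Finset.range N)
  -- A nonzero n < N has only prime factors below N, so a finite Euler product dominates the partial
  -- sum.
  have h1 : ∑ n ∈ Finset.range N, ‖f n‖ ≤
      ∑' m : Nat.factoredNumbers (Finset.range N), ‖f m‖ := by
    have hmem : ∀ n ∈ (Finset.range N).erase 0, n ∈ Nat.factoredNumbers (Finset.range N) := by
      intro n hn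
      rw [Finset.mem_erase, Finset.mem_range] at hn
      refine ⟨hn.1, fun p hp => Finset.mem_range.2 ?_⟩
      exact (Nat.le_of_mem_primeFactorsList hp).trans_lt hn.2
    have h2 : ∑ n ∈ Finset.range N, ‖f n‖ = ∑ n ∈ (Finset.range N).erase 0, ‖f n‖ := by
      refine (Finset.sum_subset (Finset.erase_subset _ _) fun n hn hn' => ?_).symm
      have : n = 0 := by
        by_contra h0
        exact hn' (Finset.mem_erase.2 ⟨h0, hn⟩)
      simp [this]
    rw [h2, ← Finset.sum_attach]
    have hinj : Function.Injective
        (fun x : {x // x ∈ (Finset.range N).erase 0} =>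
          (⟨x.1, hmem x.1 x.2⟩ : Nat.factoredNumbers (Finset.range N))) := by
      intro x y hxy
      exact Subtype.ext (by simpa using hxy)
    have h3 := (by simpa using h.1 :
      Summable fun m : Nat.factoredNumbers (Finset.range N) => ‖f m‖)
    calc ∑ x ∈ ((Finset.range N).erase 0).attach, ‖f x.1‖
        = ∑ m ∈ ((Finset.range N).erase 0).attach.map ⟨_, hinj⟩, ‖f m.1‖ := by
          rw [Finset.sum_map]; rfl
      _ ≤ _ := h3.sum_le_tsum _ fun _ _ => norm_nonneg _
  refine h1.trans ?_
  rw [h.2.tsum_eq]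
  calc ∏ p ∈ Finset.range N with p.Prime, ∑' k : ℕ, ‖f (p ^ k)‖
      ≤ ∏ p ∈ Finset.range N with p.Prime, (1 + e p) := by
        refine Finset.prod_le_prod (fun p _ => tsum_nonneg fun k => norm_nonneg _) fun p hp => ?_
        exact hle p (Finset.mem_filter.1 hp).2
    _ ≤ Real.exp (∑ p ∈ Finset.range N with p.Prime, e p) :=
        Real.prod_one_add_le_exp_sum _ he0
    _ ≤ _ := Real.exp_le_exp.2 (he.sum_le_tsum _ fun p _ => he0 p)

namespace PrimeGeodesic

/-! ### Roots of b² - tb + 1 modulo d -/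

/-- The number of residue classes `b` modulo `d` with `b² - t b + 1 ≡ 0`. -/
def rootCount (t : ℤ) (d : ℕ) : ℕ :=
  ((Finset.range d).filter fun b : ℕ => (d : ℤ) ∣ (b : ℤ) ^ 2 - t * b + 1).card

theorem rootCount_eq_card (t : ℤ) (d : ℕ) [NeZero d] :
    rootCount t d = Nat.card {x : ZMod d // x ^ 2 - t * x + 1 = 0} := by
  rw [Nat.card_eq_fintype_card, Fintype.card_subtype, rootCount]
  refine Finset.card_nbij' (fun b => (b : ZMod d)) ZMod.val ?_ ?_ ?_ ?_
  · intro b hb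
    simp only [Finset.coe_filter, Finset.mem_range, Set.mem_ofPred_eq] at hb
    simp only [Finset.coe_filter, Finset.mem_univ, true_and, Set.mem_ofPred_eq]
    have := (ZMod.intCast_zmod_eq_zero_iff_dvd _ d).2 hb.2
    push_cast at this
    exact this
  · intro x hx
    simp only [Finset.coe_filter, Finset.mem_univ, true_and, Set.mem_ofPred_eq] at hx
    simp only [Finset.coe_filter, Finset.mem_range, Set.mem_ofPred_eq]
    refine ⟨ZMod.val_lt x, (ZMod.intCast_zmod_eq_zero_iff_dvd _ d).1 ?_⟩
    push_cast
    rw [ZMod.natCast_zmod_val]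
    exact hx
  · intro b hb
    simp only [Finset.coe_filter, Finset.mem_range, Set.mem_ofPred_eq] at hb
    exact ZMod.val_cast_of_lt hb.1
  · intro x _
    exact ZMod.natCast_zmod_val x

theorem rootCount_zero (t : ℤ) : rootCount t 0 = 0 := by simp [rootCount]

theorem rootCount_one (t : ℤ) : rootCount t 1 = 1 := by simp [rootCount]

theorem rootCount_mul (t : ℤ) {m n : ℕ} (hmn : m.Coprime n) :
    rootCount t (m * n) = rootCount t m * rootCount t n := by
  rcases eq_or_ne m 0 with rfl | hm
  · simp [rootCount_zero]
  rcases eq_or_ne n 0 with rfl | hn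
  · simp [rootCount_zero]
  have : NeZero m := ⟨hm⟩
  have : NeZero n := ⟨hn⟩
  have : NeZero (m * n) := ⟨mul_ne_zero hm hn⟩
  rw [rootCount_eq_card, rootCount_eq_card, rootCount_eq_card, ← Nat.card_prod]
  let e := ZMod.chineseRemainder hmn
  have he : ∀ x : ZMod (m * n), e (x ^ 2 - t * x + 1) =
      ((e x).1 ^ 2 - t * (e x).1 + 1, (e x).2 ^ 2 - t * (e x).2 + 1) := by
    intro x
    rw [map_add, map_sub, map_mul, map_pow, map_intCast, map_one]
    rfl
  refine Nat.card_congr ((e.toEquiv.subtypeEquiv (q := fun y : ZMod m × ZMod n =>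
    y.1 ^ 2 - t * y.1 + 1 = 0 ∧ y.2 ^ 2 - t * y.2 + 1 = 0) ?_).trans
      (Equiv.subtypeProdEquivProd (p := fun y : ZMod m => y ^ 2 - t * y + 1 = 0)
        (q := fun y : ZMod n => y ^ 2 - t * y + 1 = 0)))
  intro x
  rw [← e.map_eq_zero_iff, he, Prod.mk_eq_zero]
  rfl

theorem rootCount_neg (t : ℤ) (d : ℕ) : rootCount (-t) d = rootCount t d := by
  rcases eq_or_ne d 0 with rfl | hd
  · simp [rootCount_zero]
  have : NeZero d := ⟨hd⟩
  rw [rootCount_eq_card, rootCount_eq_card]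
  refine Nat.card_congr ((Equiv.neg (ZMod d)).subtypeEquiv fun x => ?_)
  simp only [Equiv.neg_apply]
  push_cast
  ring_nf

theorem card_filter_dvd_sub_le {d m : ℕ} (hm : 0 < m) (hmd : m ∣ d) (c : ℤ) :
    ((Finset.range d).filter fun b : ℕ => (m : ℤ) ∣ b - c).card ≤ d / m := by
  obtain ⟨k, rfl⟩ := hmd
  rw [Nat.mul_div_cancel_left _ hm]
  calc _ ≤ (Finset.range k).card := by
        refine Finset.card_le_card_of_injOn (fun b => b / m) ?_ ?_
        · intro b hb
          simp only [Finset.coe_filter, Finset.mem_range, Set.mem_ofPred_eq] at hb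
          simpa using Nat.div_lt_of_lt_mul hb.1
        · intro b hb b' hb' hbb
          simp only [Finset.coe_filter, Finset.mem_range, Set.mem_ofPred_eq] at hb hb' hbb
          have h1 : (b : ℤ) ≡ b' [ZMOD m] := by
            refine (Int.modEq_iff_dvd.2 ?_)
            have := dvd_sub hb'.2 hb.2
            rwa [sub_sub_sub_cancel_right] at this
          have h2 : b % m = b' % m := (Int.natCast_modEq_iff.1 h1)
          rw [← Nat.div_add_mod b m, ← Nat.div_add_mod b' m, hbb, h2]
    _ = k := Finset.card_range k

/-- For a fixed root c, every root b satisfies p^k ∣ (b - c)(b - (t - c)). One factor is then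
divisible by p^⌈k/2⌉, which leaves two residue classes with p^⌊k/2⌋ members each. The bound also
covers p = 2 and the divisors of t² - 4. -/
theorem rootCount_prime_pow_le (t : ℤ) {p : ℕ} (hp : p.Prime) (k : ℕ) :
    rootCount t (p ^ k) ≤ 2 * p ^ (k / 2) := by
  rw [rootCount]
  rcases Finset.eq_empty_or_nonempty ((Finset.range (p ^ k)).filter
    fun b : ℕ => ((p ^ k : ℕ) : ℤ) ∣ (b : ℤ) ^ 2 - t * b + 1) with h | ⟨c, hc⟩
  · rw [h]; simp
  rw [Finset.mem_filter] at hc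
  set m := p ^ (k - k / 2) with hm
  have hm0 : 0 < m := pow_pos hp.pos _
  have hmd : m ∣ p ^ k := pow_dvd_pow _ (Nat.sub_le _ _)
  have hdiv : p ^ k / m = p ^ (k / 2) := by
    rw [hm, Nat.pow_div (Nat.sub_le _ _) hp.pos]
    congr 1
    omega
  have hsub : ((Finset.range (p ^ k)).filter
      fun b : ℕ => ((p ^ k : ℕ) : ℤ) ∣ (b : ℤ) ^ 2 - t * b + 1) ⊆
      ((Finset.range (p ^ k)).filter fun b : ℕ => (m : ℤ) ∣ b - (c : ℤ)) ∪
      ((Finset.range (p ^ k)).filter fun b : ℕ => (m : ℤ) ∣ b - (t - c)) := by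
    intro b hb
    rw [Finset.mem_filter] at hb
    rw [Finset.mem_union, Finset.mem_filter, Finset.mem_filter]
    have h1 : ((p : ℤ) ^ k) ∣ (b - c : ℤ) * (b - (t - c)) := by
      have := dvd_sub hb.2 hc.2
      push_cast at this
      exact this.trans (dvd_of_eq (by ring))
    have h2 : (m : ℤ) ∣ b - (c : ℤ) ∨ (m : ℤ) ∣ b - (t - c) := by
      by_contra! hcon
      have hpZ : Prime (p : ℤ) := Nat.prime_iff_prime_int.1 hp
      by_cases hz : ((b : ℤ) - c) * (b - (t - c)) = 0
      · rcases mul_eq_zero.1 hz with h | h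
        · exact hcon.1 (h ▸ dvd_zero _)
        · exact hcon.2 (h ▸ dvd_zero _)
      · have e1 : emultiplicity (p : ℤ) ((b : ℤ) - c) < ((k - k / 2 : ℕ) : ℕ∞) := by
          rw [emultiplicity_lt_iff_not_dvd]
          simpa [hm] using hcon.1
        have e2 : emultiplicity (p : ℤ) ((b : ℤ) - (t - c)) < ((k - k / 2 : ℕ) : ℕ∞) := by
          rw [emultiplicity_lt_iff_not_dvd]
          simpa [hm] using hcon.2
        have e3 := le_emultiplicity_of_pow_dvd h1
        rw [emultiplicity_mul hpZ] at e3
        lift emultiplicity (p : ℤ) ((b : ℤ) - c) to ℕ using e1.ne_top with x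
        lift emultiplicity (p : ℤ) ((b : ℤ) - (t - c)) to ℕ using e2.ne_top with y
        norm_cast at e1 e2 e3
        omega
    exact h2.imp (fun h => ⟨hb.1, h⟩) fun h => ⟨hb.1, h⟩
  refine (Finset.card_le_card hsub).trans ((Finset.card_union_le _ _).trans ?_)
  rw [two_mul, ← hdiv]
  exact add_le_add (card_filter_dvd_sub_le hm0 hmd _) (card_filter_dvd_sub_le hm0 hmd _)

/-- The identity (2b - t)² = 4(b² - tb + 1) + (t² - 4) makes the derivative a unit at every root. -/
theorem isCoprime_two_mul_sub {t : ℤ} {p : ℕ} (hp : p.Prime) (hD : ¬ (p : ℤ) ∣ t ^ 2 - 4)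
    {b : ℤ} (hb : (p : ℤ) ∣ b ^ 2 - t * b + 1) : IsCoprime (p : ℤ) (2 * b - t) := by
  have hpZ : Prime (p : ℤ) := Nat.prime_iff_prime_int.1 hp
  rw [hpZ.irreducible.coprime_iff_not_dvd]
  intro h
  refine hD ?_
  have := dvd_sub (h.mul_left (2 * b - t)) (hb.mul_left 4)
  exact this.trans (dvd_of_eq (by ring))

/-- Hensel lifting. Two roots satisfy p^(k+1) ∣ (b - a)(a + b - t), and if they agree modulo p^k the
second factor is congruent to 2a - t modulo p, hence prime to p. -/
theorem rootCount_prime_pow_succ {t : ℤ} {p : ℕ} (hp : p.Prime) (hD : ¬ (p : ℤ) ∣ t ^ 2 - 4)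
    {k : ℕ} (hk : k ≠ 0) : rootCount t (p ^ (k + 1)) = rootCount t (p ^ k) := by
  have : NeZero p := ⟨hp.ne_zero⟩
  rw [rootCount_eq_card, rootCount_eq_card]
  have hdvd : p ^ k ∣ p ^ (k + 1) := pow_dvd_pow _ (Nat.le_succ k)
  let φ := ZMod.castHom hdvd (ZMod (p ^ k))
  have hφ : ∀ x : ZMod (p ^ (k + 1)), x ^ 2 - t * x + 1 = 0 → φ x ^ 2 - t * φ x + 1 = 0 := by
    intro x hx
    have := congrArg φ hx
    rwa [map_add, map_sub, map_mul, map_pow, map_intCast, map_one, map_zero] at this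
  have hzero : ∀ (m : ℕ) (b : ℤ), (b : ZMod m) ^ 2 - t * b + 1 = 0 ↔
      (m : ℤ) ∣ b ^ 2 - t * b + 1 := by
    intro m b
    rw [← ZMod.intCast_zmod_eq_zero_iff_dvd]
    push_cast
    rfl
  have hpk : (p : ℤ) ∣ ((p ^ k : ℕ) : ℤ) := by
    exact_mod_cast dvd_pow_self p hk
  refine Nat.card_congr (Equiv.ofBijective
    (fun x => (⟨φ x.1, hφ x.1 x.2⟩ : {y : ZMod (p ^ k) // y ^ 2 - t * y + 1 = 0})) ⟨?_, ?_⟩)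
  · rintro ⟨x, hx⟩ ⟨y, hy⟩ hxy
    obtain ⟨a, rfl⟩ := ZMod.intCast_surjective x
    obtain ⟨b, rfl⟩ := ZMod.intCast_surjective y
    have hab : (((a : ℤ) : ZMod (p ^ k))) = b := by simpa [φ] using congrArg Subtype.val hxy
    rw [hzero] at hx hy
    refine Subtype.ext ?_
    rw [ZMod.intCast_eq_intCast_iff_dvd_sub] at hab ⊢
    have h1 : ((p ^ (k + 1) : ℕ) : ℤ) ∣ (b - a) * (a + b - t) := by
      have := dvd_sub hy hx
      exact this.trans (dvd_of_eq (by ring))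
    have h2 : IsCoprime (p : ℤ) (a + b - t) := by
      have hc := isCoprime_two_mul_sub hp hD
        (hpk.trans ((Int.natCast_dvd_natCast.2 hdvd).trans hx))
      obtain ⟨c, hcc⟩ := hpk.trans hab
      have : a + b - t = (2 * a - t) + p * c := by linarith
      rw [this]
      exact IsCoprime.add_mul_left_right hc c
    refine IsCoprime.dvd_of_dvd_mul_right ?_ h1
    push_cast
    exact h2.pow_left
  · rintro ⟨y, hy⟩
    obtain ⟨b, rfl⟩ := ZMod.intCast_surjective y
    rw [hzero] at hy
    have hc := isCoprime_two_mul_sub hp hD (hpk.trans hy)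
    obtain ⟨e, he⟩ := hy
    obtain ⟨u, v, huv⟩ := hc
    -- Newton step: f(b) = p^k e is divided by f'(b), whose inverse modulo p is `v`. The quadratic
    -- error has a factor p^(2k), which suffices because k ≥ 1.
    have hroot : ((p ^ (k + 1) : ℕ) : ℤ) ∣
        (b + p ^ k * (-e * v)) ^ 2 - t * (b + p ^ k * (-e * v)) + 1 := by
      obtain ⟨j, rfl⟩ := Nat.exists_eq_succ_of_ne_zero hk
      push_cast at he ⊢
      refine ⟨e * u + p ^ j * (e * v) ^ 2, ?_⟩
      simp only [Nat.succ_eq_add_one] at he ⊢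
      linear_combination he - (p : ℤ) ^ (j + 1) * e * huv
    refine ⟨⟨((b + p ^ k * (-e * v) : ℤ) : ZMod (p ^ (k + 1))), (hzero _ _).2 hroot⟩, ?_⟩
    refine Subtype.ext ?_
    simp only [φ]
    rw [map_intCast]
    push_cast
    have : ((p : ZMod (p ^ k))) ^ k = 0 := by
      rw [← Nat.cast_pow, ZMod.natCast_self]
    rw [this]
    simp

/-- Completing the square: x ↦ 2x - t carries the roots to the square roots of t² - 4. -/
theorem rootCount_prime {t : ℤ} {p : ℕ} (hp : p.Prime) (hp2 : p ≠ 2) :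
    (rootCount t p : ℤ) = jacobiSym (t ^ 2 - 4) p + 1 := by
  have : Fact p.Prime := ⟨hp⟩
  rw [← jacobiSym.legendreSym.to_jacobiSym, ← legendreSym.card_sqrts p hp2, rootCount_eq_card]
  congr 1
  rw [Set.toFinset_card, ← Nat.card_eq_fintype_card]
  have h2 : (2 : ZMod p) ≠ 0 := by
    intro h
    have : ((2 : ℕ) : ZMod p) = 0 := by exact_mod_cast h
    rw [ZMod.natCast_eq_zero_iff] at this
    exact hp2 ((Nat.prime_dvd_prime_iff_eq hp Nat.prime_two).1 this)
  refine Nat.card_congr (((Equiv.mulLeft₀ (2 : ZMod p) h2).trans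
    (Equiv.subRight (t : ZMod p))).subtypeEquiv fun x => ?_)
  have h4 : (4 : ZMod p) ≠ 0 := by
    have : (4 : ZMod p) = 2 * 2 := by norm_num
    rw [this]
    exact mul_ne_zero h2 h2
  simp only [Equiv.trans_apply, Equiv.subRight_apply, Equiv.mulLeft₀_apply, Set.mem_ofPred_eq]
  push_cast
  constructor
  · intro h
    linear_combination 4 * h
  · intro h
    refine (mul_eq_zero.1 (?_ : 4 * (x ^ 2 - t * x + 1) = 0)).resolve_left h4
    linear_combination h

/-! ### The Jacobi symbol of a positive non-square -/

/-- The Jacobi symbol `(D / n)`, set to `0` at even `n`. -/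
def oddJacobi (D : ℤ) (n : ℕ) : ℤ := if Odd n then jacobiSym D n else 0

theorem oddJacobi_zero (D : ℤ) : oddJacobi D 0 = 0 := by simp [oddJacobi]

theorem oddJacobi_one (D : ℤ) : oddJacobi D 1 = 1 := by simp [oddJacobi]

theorem oddJacobi_mul (D : ℤ) (m n : ℕ) :
    oddJacobi D (m * n) = oddJacobi D m * oddJacobi D n := by
  unfold oddJacobi
  by_cases hm : Odd m <;> by_cases hn : Odd n <;> simp only [Nat.odd_mul, hm, hn, and_self,
    and_false, false_and, if_true, if_false, mul_zero, zero_mul]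
  exact jacobiSym.mul_right' _ hm.pos.ne' hn.pos.ne'

theorem abs_oddJacobi_le (D : ℤ) (n : ℕ) : |oddJacobi D n| ≤ 1 := by
  unfold oddJacobi
  split_ifs
  · rcases jacobiSym.trichotomy D n with h | h | h <;> simp [h]
  · simp

theorem oddJacobi_periodic (D : ℤ) : Function.Periodic (oddJacobi D) (4 * D.natAbs) := by
  intro n
  have h : Odd (n + 4 * D.natAbs) ↔ Odd n := by
    rw [Nat.odd_add]
    have : Even (4 * D.natAbs) := ⟨2 * D.natAbs, by ring⟩
    simp [this]
  unfold oddJacobi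
  by_cases hn : Odd n
  · rw [if_pos hn, if_pos (h.2 hn), jacobiSym.mod_right D (h.2 hn), jacobiSym.mod_right D hn,
      Nat.add_mod_right]
  · rw [if_neg hn, if_neg (mt h.1 hn)]

/-- Reciprocity and the Chinese remainder theorem. For a = 2c take s ≡ 5 mod 16 and s ≡ 1 mod c, so
that only the factor (2/s) is -1. For a = pc odd take s ≡ 1 mod 8, s a nonresidue mod p and s ≡ 1
mod c. -/
theorem exists_jacobiSym_eq_neg_one_of_squarefree {a : ℕ} (ha : Squarefree a) (ha1 : a ≠ 1) :
    ∃ s : ℕ, s.Coprime (8 * a) ∧ ∀ n : ℕ, n ≡ s [MOD 8 * a] → jacobiSym a n = -1 := by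
  rcases Nat.even_or_odd a with he | ho
  · obtain ⟨c, rfl⟩ := he.two_dvd
    have hc : Nat.Coprime 2 c := Nat.coprime_of_squarefree_mul ha
    have hco : Odd c := Nat.coprime_two_left.1 hc
    have h16 : Nat.Coprime 16 c := Nat.Coprime.pow_left 4 hc
    let s := Nat.chineseRemainder h16 5 1
    have hmod : ∀ n : ℕ, n ≡ s [MOD 8 * (2 * c)] → n ≡ 5 [MOD 16] ∧ n ≡ 1 [MOD c] := fun n hn =>
      ⟨(hn.of_dvd ⟨c, by ring⟩).trans s.2.1, (hn.of_dvd ⟨16, by ring⟩).trans s.2.2⟩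
    refine ⟨s, ?_, fun n hn => ?_⟩
    · obtain ⟨h1, h2⟩ := hmod s rfl
      rw [show 8 * (2 * c) = 16 * c by ring]
      exact Nat.Coprime.mul_right (by rw [Nat.Coprime, h1.gcd_eq]; norm_num)
        (by rw [Nat.Coprime, h2.gcd_eq]; simp)
    · obtain ⟨h1, h2⟩ := hmod n hn
      have h8 : n % 8 = 5 := h1.of_dvd (by norm_num)
      have h4 : n % 4 = 1 := h1.of_dvd (by norm_num)
      have hodd : Odd n := Nat.odd_iff.2 (by omega)
      push_cast
      rw [jacobiSym.mul_left, jacobiSym.at_two hodd, ZMod.χ₈_nat_eq_if_mod_eight,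
        jacobiSym.quadratic_reciprocity_one_mod_four' hco h4]
      have : jacobiSym n c = jacobiSym (1 : ℕ) c :=
        jacobiSym.mod_left' (by exact_mod_cast h2)
      rw [this]
      simp [h8, show n % 2 = 1 by omega]
  · obtain ⟨c, hc⟩ := Nat.minFac_dvd a
    set p := a.minFac with hp
    have hpp : p.Prime := Nat.minFac_prime ha1
    have : Fact p.Prime := ⟨hpp⟩
    have hp2 : p ≠ 2 := by
      intro h
      rw [h] at hc
      exact (Nat.not_even_iff_odd.2 ho) ⟨c, by omega⟩
    have hpc : Nat.Coprime p c := Nat.coprime_of_squarefree_mul (hc ▸ ha)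
    obtain ⟨r, hr⟩ := FiniteField.exists_nonsquare (F := ZMod p)
      (by rwa [ZMod.ringChar_zmod_n])
    have h8a : Nat.Coprime 8 (p * c) := by
      rw [← hc]
      exact Nat.Coprime.pow_left 3 (Nat.coprime_two_left.2 ho)
    let s1 := Nat.chineseRemainder hpc r.val 1
    let s := Nat.chineseRemainder h8a 1 s1
    have hmod : ∀ n : ℕ, n ≡ s [MOD 8 * a] →
        n ≡ 1 [MOD 8] ∧ n ≡ r.val [MOD p] ∧ n ≡ 1 [MOD c] := by
      intro n hn
      rw [hc] at hn
      have h2 : n ≡ s1 [MOD p * c] := (hn.of_dvd ⟨8, by ring⟩).trans s.2.2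
      exact ⟨(hn.of_dvd ⟨p * c, rfl⟩).trans s.2.1, (h2.of_dvd ⟨c, rfl⟩).trans s1.2.1,
        (h2.of_dvd ⟨p, by ring⟩).trans s1.2.2⟩
    have hr0 : r ≠ 0 := fun h => hr (h ▸ IsSquare.zero)
    refine ⟨s, ?_, fun n hn => ?_⟩
    · obtain ⟨h1, h2, h3⟩ := hmod s rfl
      rw [hc]
      refine Nat.Coprime.mul_right (by rw [Nat.Coprime, h1.gcd_eq]; norm_num)
        (Nat.Coprime.mul_right ?_ (by rw [Nat.Coprime, h3.gcd_eq]; simp))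
      rw [Nat.Coprime, h2.gcd_eq]
      refine Nat.Coprime.symm ((Nat.Prime.coprime_iff_not_dvd hpp).2 fun h => hr0 ?_)
      rw [← ZMod.natCast_eq_zero_iff, ZMod.natCast_zmod_val] at h
      exact h
    · obtain ⟨h1, h2, h3⟩ := hmod n hn
      have h4 : n % 4 = 1 := h1.of_dvd (by norm_num)
      rw [jacobiSym.quadratic_reciprocity_one_mod_four' ho h4, hc]
      have hc0 : c ≠ 0 := by
        rintro rfl
        simp at hc
        exact ha.ne_zero hc
      rw [jacobiSym.mul_right' _ hpp.ne_zero hc0]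
      have e1 : jacobiSym n c = jacobiSym (1 : ℕ) c :=
        jacobiSym.mod_left' (by exact_mod_cast h3)
      have e2 : jacobiSym n p = -1 := by
        rw [← jacobiSym.legendreSym.to_jacobiSym, legendreSym.eq_neg_one_iff]
        have : (n : ZMod p) = r := by
          rw [← ZMod.natCast_zmod_val r]
          exact (ZMod.natCast_eq_natCast_iff _ _ _).2 h2
        simpa [this] using hr
      rw [e1, e2]
      simp

theorem exists_oddJacobi_eq_neg_one {D : ℤ} (hD0 : 0 < D) (hD : ¬ IsSquare D) :
    ∃ n : ℕ, oddJacobi D n = -1 := by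
  lift D to ℕ using hD0.le
  have hD0 : 0 < D := by exact_mod_cast hD0
  obtain ⟨a, b, ha0, hb0, hab, ha⟩ := Nat.sq_mul_squarefree_of_pos hD0
  have ha1 : a ≠ 1 := by
    rintro rfl
    refine hD ⟨b, ?_⟩
    rw [← hab]
    push_cast
    ring
  obtain ⟨s, hs, h⟩ := exists_jacobiSym_eq_neg_one_of_squarefree ha ha1
  have : NeZero (8 * a) := ⟨by positivity⟩
  -- Dirichlet's theorem: a prime above 2b + 2 in the class of `s` is odd and prime to b, so the
  -- square part of D does not affect the symbol.
  obtain ⟨n, hn, hnp, hns⟩ := Nat.forall_exists_prime_gt_and_eq_mod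
    ((ZMod.isUnit_iff_coprime s (8 * a)).2 hs) (2 * b + 2)
  have hn2 : Odd n := hnp.odd_of_ne_two (by omega)
  refine ⟨n, ?_⟩
  rw [oddJacobi, if_pos hn2, ← hab]
  push_cast
  have hbn : Int.gcd (b : ℤ) n = 1 := by
    rw [Int.gcd_natCast_natCast]
    refine Nat.Coprime.symm ((Nat.Prime.coprime_iff_not_dvd hnp).2 fun hd => ?_)
    have := Nat.le_of_dvd hb0 hd
    omega
  rw [jacobiSym.mul_left, jacobiSym.sq_one' hbn, one_mul]
  exact h n ((ZMod.natCast_eq_natCast_iff _ _ _).1 hns)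

theorem sum_range_oddJacobi_eq_zero {D : ℤ} (hD0 : 0 < D) (hD : ¬ IsSquare D) :
    ∑ n ∈ Finset.range (4 * D.natAbs), oddJacobi D n = 0 := by
  obtain ⟨n, hn⟩ := exists_oddJacobi_eq_neg_one hD0 hD
  set N := 4 * D.natAbs with hN
  have hN0 : N ≠ 0 := by
    have : D.natAbs ≠ 0 := by simpa using hD0.ne'
    omega
  have : NeZero N := ⟨hN0⟩
  have hper : Function.Periodic (oddJacobi D) N := oddJacobi_periodic D
  have hunit : IsUnit (n : ZMod N) := by
    rw [ZMod.isUnit_iff_coprime]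
    have hodd : Odd n := by
      by_contra h
      rw [oddJacobi, if_neg h] at hn
      norm_num at hn
    rw [oddJacobi, if_pos hodd] at hn
    have h1 : Int.gcd D n = 1 := by
      by_contra h
      rw [jacobiSym.eq_zero_iff.2 ⟨hodd.pos.ne', h⟩] at hn
      norm_num at hn
    refine Nat.Coprime.mul_right (Nat.Coprime.pow_right 2 (Nat.coprime_two_right.2 hodd)) ?_
    rw [Nat.coprime_comm, Nat.Coprime, ← h1, Int.gcd, Int.natAbs_natCast]
  have hsum : ∑ m ∈ Finset.range N, oddJacobi D m = ∑ x : ZMod N, oddJacobi D x.val := by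
    refine Finset.sum_nbij' (fun m => (m : ZMod N)) ZMod.val (by simp) ?_ ?_ ?_ ?_
    · intro x _
      simpa using ZMod.val_lt x
    · intro m hm
      exact ZMod.val_cast_of_lt (by simpa using hm)
    · intro x _
      exact ZMod.natCast_zmod_val x
    · intro m hm
      rw [ZMod.val_cast_of_lt (by simpa using hm)]
  -- Multiplication by a unit of symbol -1 permutes the residues and negates the sum.
  have hmul : ∑ x : ZMod N, oddJacobi D x.val = -∑ x : ZMod N, oddJacobi D x.val := by
    obtain ⟨u, hu⟩ := hunit
    conv_lhs => rw [← Equiv.sum_comp (Units.mulLeft u)]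
    rw [← Finset.sum_neg_distrib]
    refine Finset.sum_congr rfl fun x _ => ?_
    rw [Units.mulLeft_apply, hu]
    have : ((n : ZMod N) * x).val = (n * x.val) % N := by
      rw [ZMod.val_mul, ZMod.val_natCast, Nat.mod_mul_mod]
    rw [this, hper.map_mod_nat, oddJacobi_mul, hn]
    ring
  rw [hsum]
  linarith

theorem abs_sum_range_oddJacobi_le {D : ℤ} (hD0 : 0 < D) (hD : ¬ IsSquare D) (M : ℕ) :
    |∑ n ∈ Finset.range M, oddJacobi D n| ≤ 4 * D.natAbs := by
  set N := 4 * D.natAbs with hN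
  have hper : Function.Periodic (fun M => ∑ n ∈ Finset.range M, oddJacobi D n) N := by
    intro M
    induction M with
    | zero => simpa using sum_range_oddJacobi_eq_zero hD0 hD
    | succ M ih =>
      simp only at ih ⊢
      rw [show M + 1 + N = M + N + 1 by ring, Finset.sum_range_succ, Finset.sum_range_succ, ih,
        oddJacobi_periodic D]
  have hN0 : 0 < N := by
    have : D.natAbs ≠ 0 := by simpa using hD0.ne'
    omega
  have := hper.map_mod_nat M
  rw [← this]
  refine (Finset.abs_sum_le_sum_abs _ _).trans
    ((Finset.sum_le_sum fun n _ => abs_oddJacobi_le D n).trans ?_)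
  have h1 := (Nat.mod_lt M hN0).le
  simp only [Finset.sum_const, Finset.card_range, nsmul_eq_mul, mul_one]
  exact_mod_cast h1

/-- Dirichlet's test: bounded partial sums against the decreasing weights 1/n. -/
theorem exists_tendsto_sum_oddJacobi_div {D : ℤ} (hD0 : 0 < D) (hD : ¬ IsSquare D) :
    ∃ A : ℂ, Tendsto (fun N : ℕ => ∑ n ∈ Finset.Ioc 0 N, (oddJacobi D n : ℂ) / n) atTop (𝓝 A) := by
  have hanti : Antitone fun n : ℕ => 1 / ((n : ℝ) + 1) := fun m n hmn => by
    have : (m : ℝ) ≤ n := by exact_mod_cast hmn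
    simp only
    gcongr
  have hb : ∀ N, ‖∑ n ∈ Finset.range N, (oddJacobi D (n + 1) : ℂ)‖ ≤ 4 * D.natAbs := by
    intro N
    have h := abs_sum_range_oddJacobi_le hD0 hD (N + 1)
    rw [Finset.sum_range_succ', oddJacobi_zero, add_zero] at h
    have h' := (Int.cast_le (R := ℝ)).2 h
    rw [← Int.cast_sum, Complex.norm_intCast]
    push_cast [Nat.cast_natAbs] at h' ⊢
    exact h'
  have hc := hanti.cauchySeq_series_mul_of_tendsto_zero_of_bounded
    tendsto_one_div_add_atTop_nhds_zero_nat hb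
  obtain ⟨A, hA⟩ := cauchySeq_tendsto_of_complete hc
  refine ⟨A, hA.congr fun N => ?_⟩
  induction N with
  | zero => simp
  | succ N ih =>
    rw [Finset.sum_range_succ, Finset.sum_Ioc_succ_top (Nat.zero_le _), ih]
    congr 1
    rw [Complex.real_smul]
    push_cast
    ring

/-! ### Factoring the Möbius transform of the root count through the Jacobi symbol -/

-- Since μ vanishes at p², p³, …, only two terms survive. Taking c = ζ gives the ordinary Möbius
-- transform.
open ArithmeticFunction in
theorem mul_pmul_moebius_apply_prime_pow_succ (f c : ArithmeticFunction ℂ) {p : ℕ} (hp : p.Prime)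
    (k : ℕ) : (f * ((moebius : ArithmeticFunction ℂ).pmul c)) (p ^ (k + 1)) =
      f (p ^ (k + 1)) * c 1 - c p * f (p ^ k) := by
  rw [mul_apply, Nat.sum_divisorsAntidiagonal'
    (f := fun x y => f x * ((moebius : ArithmeticFunction ℂ).pmul c) y),
    Nat.sum_divisors_prime_pow hp, Finset.sum_range_succ', Finset.sum_range_succ']
  have h0 : ∑ i ∈ Finset.range k, f (p ^ (k + 1) / p ^ (i + 1 + 1)) *
      ((moebius : ArithmeticFunction ℂ).pmul c) (p ^ (i + 1 + 1)) = 0 := by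
    refine Finset.sum_eq_zero fun i _ => ?_
    rw [pmul_apply, intCoe_apply, moebius_apply_prime_pow hp (by omega), if_neg (by omega)]
    simp
  rw [h0, pmul_apply, pmul_apply, intCoe_apply, intCoe_apply, zero_add, pow_one, pow_zero,
    moebius_apply_prime hp, moebius_apply_one, Nat.div_one, pow_succ,
    Nat.mul_div_cancel _ hp.pos]
  push_cast
  ring

open ArithmeticFunction in
/-- Multiplication by a completely multiplicative function inverts Möbius inversion. -/
theorem pmul_moebius_mul_self {c : ArithmeticFunction ℂ} (h1 : c 1 = 1)
    (hc : ∀ m n, c (m * n) = c m * c n) : ((moebius : ArithmeticFunction ℂ).pmul c) * c = 1 := by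
  ext n
  have h : (((moebius : ArithmeticFunction ℂ).pmul c) * c) n =
      c n * ((moebius : ArithmeticFunction ℂ) * (zeta : ArithmeticFunction ℂ)) n := by
    rw [mul_apply, mul_apply, Finset.mul_sum]
    refine Finset.sum_congr rfl fun x hx => ?_
    obtain ⟨hx1, hx0⟩ := Nat.mem_divisorsAntidiagonal.1 hx
    have h2 : x.2 ≠ 0 := fun h => hx0 (by rw [← hx1, h, mul_zero])
    rw [pmul_apply, ← hx1, hc, natCoe_apply, zeta_apply_ne h2]
    push_cast
    ring
  rw [h, coe_moebius_mul_coe_zeta]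
  rcases eq_or_ne n 1 with rfl | hn
  · simp [h1]
  · simp [one_apply_ne hn]

/-- The arithmetic function `n ↦ f n / n`. -/
noncomputable def divId (f : ArithmeticFunction ℂ) : ArithmeticFunction ℂ :=
  ⟨fun n => f n / n, by simp⟩

theorem divId_apply (f : ArithmeticFunction ℂ) (n : ℕ) : divId f n = f n / n := rfl

theorem divId_mul (f g : ArithmeticFunction ℂ) : divId (f * g) = divId f * divId g := by
  ext n
  rw [divId_apply, ArithmeticFunction.mul_apply, ArithmeticFunction.mul_apply, Finset.sum_div]
  refine Finset.sum_congr rfl fun x hx => ?_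
  rw [← (Nat.mem_divisorsAntidiagonal.1 hx).1, divId_apply, divId_apply]
  push_cast
  rw [div_mul_div_comm]

theorem isMultiplicative_divId {f : ArithmeticFunction ℂ} (hf : f.IsMultiplicative) :
    (divId f).IsMultiplicative := by
  refine ⟨by simp [divId_apply, hf.1], fun {m n} hmn => ?_⟩
  rw [divId_apply, divId_apply, divId_apply, hf.2 hmn]
  push_cast
  rw [div_mul_div_comm]

/-- `rootCount` as an arithmetic function. -/
noncomputable def rootFun (t : ℤ) : ArithmeticFunction ℂ :=
  ⟨fun d => rootCount t d, by simp [rootCount_zero]⟩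

theorem rootFun_apply (t : ℤ) (d : ℕ) : rootFun t d = rootCount t d := rfl

theorem isMultiplicative_rootFun (t : ℤ) : (rootFun t).IsMultiplicative := by
  refine ⟨by simp [rootFun_apply, rootCount_one], fun {m n} hmn => ?_⟩
  simp only [rootFun_apply, rootCount_mul t hmn, Nat.cast_mul]

/-- The Möbius transform of `rootCount`. -/
noncomputable def rootMoebius (t : ℤ) : ArithmeticFunction ℂ :=
  rootFun t * (ArithmeticFunction.moebius : ArithmeticFunction ℂ)

theorem isMultiplicative_rootMoebius (t : ℤ) : (rootMoebius t).IsMultiplicative :=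
  (isMultiplicative_rootFun t).mul ArithmeticFunction.isMultiplicative_moebius.intCast

theorem rootMoebius_prime_pow_succ (t : ℤ) {p : ℕ} (hp : p.Prime) (k : ℕ) :
    rootMoebius t (p ^ (k + 1)) = rootCount t (p ^ (k + 1)) - rootCount t (p ^ k) := by
  have h := mul_pmul_moebius_apply_prime_pow_succ (rootFun t)
    (ArithmeticFunction.zeta : ArithmeticFunction ℂ) hp k
  rw [ArithmeticFunction.pmul_zeta, ArithmeticFunction.natCoe_apply,
    ArithmeticFunction.natCoe_apply, ArithmeticFunction.zeta_apply_ne one_ne_zero,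
    ArithmeticFunction.zeta_apply_ne hp.ne_zero] at h
  rw [rootMoebius, h]
  simp [rootFun_apply]

theorem norm_rootMoebius_prime_pow_le (t : ℤ) {p : ℕ} (hp : p.Prime) (k : ℕ) :
    ‖rootMoebius t (p ^ k)‖ ≤ 4 * (p : ℝ) ^ (k / 2) := by
  have hp1 : (1 : ℝ) ≤ p := by exact_mod_cast hp.one_le
  rcases k with _ | k
  · simp [(isMultiplicative_rootMoebius t).1]
  · rw [rootMoebius_prime_pow_succ t hp]
    have h1 : ((rootCount t (p ^ (k + 1)) : ℕ) : ℝ) ≤ 2 * (p : ℝ) ^ ((k + 1) / 2) := by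
      exact_mod_cast rootCount_prime_pow_le t hp (k + 1)
    have h2 : ((rootCount t (p ^ k) : ℕ) : ℝ) ≤ 2 * (p : ℝ) ^ (k / 2) := by
      exact_mod_cast rootCount_prime_pow_le t hp k
    have h3 : (p : ℝ) ^ (k / 2) ≤ (p : ℝ) ^ ((k + 1) / 2) := pow_le_pow_right₀ hp1 (by omega)
    refine (norm_sub_le _ _).trans ?_
    rw [Complex.norm_natCast, Complex.norm_natCast]
    linarith

/-- `oddJacobi` as an arithmetic function. -/
noncomputable def oddJacobiFun (D : ℤ) : ArithmeticFunction ℂ :=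
  ⟨fun n => oddJacobi D n, by simp [oddJacobi_zero]⟩

theorem oddJacobiFun_apply (D : ℤ) (n : ℕ) : oddJacobiFun D n = oddJacobi D n := rfl

theorem oddJacobiFun_one (D : ℤ) : oddJacobiFun D 1 = 1 := by
  simp [oddJacobiFun_apply, oddJacobi_one]

theorem oddJacobiFun_mul (D : ℤ) (m n : ℕ) :
    oddJacobiFun D (m * n) = oddJacobiFun D m * oddJacobiFun D n := by
  simp [oddJacobiFun_apply, oddJacobi_mul]

theorem norm_oddJacobiFun_le (D : ℤ) (n : ℕ) : ‖oddJacobiFun D n‖ ≤ 1 := by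
  rw [oddJacobiFun_apply, Complex.norm_intCast]
  exact_mod_cast abs_oddJacobi_le D n

/-- The quotient of `rootMoebius t` by the Jacobi symbol of `t² - 4`. -/
noncomputable def rootQuotient (t : ℤ) : ArithmeticFunction ℂ :=
  rootMoebius t * (ArithmeticFunction.moebius : ArithmeticFunction ℂ).pmul
    (oddJacobiFun (t ^ 2 - 4))

theorem isMultiplicative_rootQuotient (t : ℤ) : (rootQuotient t).IsMultiplicative :=
  (isMultiplicative_rootMoebius t).mul (ArithmeticFunction.isMultiplicative_moebius.intCast.pmul
    ⟨oddJacobiFun_one _, fun _ => oddJacobiFun_mul _ _ _⟩)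

theorem rootQuotient_mul_oddJacobiFun (t : ℤ) :
    rootQuotient t * oddJacobiFun (t ^ 2 - 4) = rootMoebius t := by
  rw [rootQuotient, mul_assoc, pmul_moebius_mul_self (oddJacobiFun_one _) (oddJacobiFun_mul _),
    mul_one]

theorem rootQuotient_prime_pow_succ (t : ℤ) {p : ℕ} (hp : p.Prime) (k : ℕ) :
    rootQuotient t (p ^ (k + 1)) = rootMoebius t (p ^ (k + 1)) -
      oddJacobiFun (t ^ 2 - 4) p * rootMoebius t (p ^ k) := by
  rw [rootQuotient, mul_pmul_moebius_apply_prime_pow_succ _ _ hp, oddJacobiFun_one, mul_one]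

theorem norm_rootQuotient_prime_pow_le (t : ℤ) {p : ℕ} (hp : p.Prime) (k : ℕ) :
    ‖rootQuotient t (p ^ k)‖ ≤ 8 * (p : ℝ) ^ (k / 2) := by
  have hp1 : (1 : ℝ) ≤ p := by exact_mod_cast hp.one_le
  rcases k with _ | k
  · simp [(isMultiplicative_rootQuotient t).1]
  · rw [rootQuotient_prime_pow_succ t hp]
    have h1 := norm_rootMoebius_prime_pow_le t hp (k + 1)
    have h2 := norm_rootMoebius_prime_pow_le t hp k
    have h3 : (p : ℝ) ^ (k / 2) ≤ (p : ℝ) ^ ((k + 1) / 2) := pow_le_pow_right₀ hp1 (by omega)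
    have h4 := norm_oddJacobiFun_le (t ^ 2 - 4) p
    refine (norm_sub_le _ _).trans ?_
    rw [norm_mul]
    have := mul_le_mul h4 h2 (norm_nonneg _) zero_le_one
    linarith

/-- At such p the root count is 1 + χ(p) at every positive power, so its Möbius transform has Euler
factor 1 + χ(p)X. Multiplying by 1 - χ(p)X leaves 1 - χ(p)²X². -/
theorem rootQuotient_prime_pow_of_not_dvd {t : ℤ} {p : ℕ} (hp : p.Prime) (hp2 : p ≠ 2)
    (hD : ¬ (p : ℤ) ∣ t ^ 2 - 4) :
    rootQuotient t p = 0 ∧ ‖rootQuotient t (p ^ 2)‖ ≤ 1 ∧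
      ∀ k, rootQuotient t (p ^ (k + 3)) = 0 := by
  have hodd : Odd p := hp.odd_of_ne_two hp2
  have g1 : rootMoebius t p = oddJacobiFun (t ^ 2 - 4) p := by
    have h := rootMoebius_prime_pow_succ t hp 0
    rw [zero_add, pow_one, pow_zero, rootCount_one] at h
    have h2 := rootCount_prime (t := t) hp hp2
    rw [h, oddJacobiFun_apply, oddJacobi, if_pos hodd]
    have h3 : ((rootCount t p : ℕ) : ℂ) = ((jacobiSym (t ^ 2 - 4) p + 1 : ℤ) : ℂ) := by
      rw [← h2]
      simp
    rw [h3]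
    push_cast
    ring
  have g2 : ∀ k, rootMoebius t (p ^ (k + 2)) = 0 := by
    intro k
    rw [rootMoebius_prime_pow_succ t hp, rootCount_prime_pow_succ hp hD (Nat.succ_ne_zero k),
      sub_self]
  refine ⟨?_, ?_, fun k => ?_⟩
  · have h := rootQuotient_prime_pow_succ t hp 0
    rw [zero_add, pow_one, pow_zero, (isMultiplicative_rootMoebius t).1, g1] at h
    rw [h]
    ring
  · have h := rootQuotient_prime_pow_succ t hp 1
    have h2 := g2 0
    rw [zero_add] at h2
    norm_num at h
    rw [h, h2, g1, zero_sub, norm_neg, norm_mul]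
    have h4 := norm_oddJacobiFun_le (t ^ 2 - 4) p
    exact mul_le_one₀ h4 (norm_nonneg _) h4
  · have h := rootQuotient_prime_pow_succ t hp (k + 2)
    rw [show k + 2 + 1 = k + 1 + 2 by ring, g2, g2, mul_zero, sub_zero] at h
    exact h

/-- The bound 8 p^⌊k/2⌋ divided by p^k is at most 8 p^(-k/2), a geometric series. -/
theorem summable_norm_rootQuotient_prime_pow_div (t : ℤ) {p : ℕ} (hp : p.Prime) :
    Summable fun k : ℕ => ‖divId (rootQuotient t) (p ^ k)‖ := by
  have hp0 : (0 : ℝ) < p := by exact_mod_cast hp.pos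
  have hs : (1 : ℝ) < √p := by
    rw [Real.lt_sqrt zero_le_one]
    simpa using hp.one_lt
  have hgeo : Summable fun k : ℕ => 8 * ((√(p : ℝ))⁻¹) ^ k :=
    (summable_geometric_of_lt_one (by positivity) (inv_lt_one_of_one_lt₀ hs)).mul_left 8
  refine Summable.of_nonneg_of_le (fun _ => norm_nonneg _) (fun k => ?_) hgeo
  rw [divId_apply, norm_div, Complex.norm_natCast]
  push_cast
  rw [div_le_iff₀ (by positivity)]
  refine (norm_rootQuotient_prime_pow_le t hp k).trans ?_
  rw [mul_assoc]
  gcongr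
  have h1 : (p : ℝ) ^ k = √(p : ℝ) ^ k * √(p : ℝ) ^ k := by
    rw [← mul_pow, Real.mul_self_sqrt hp0.le]
  rw [h1, inv_pow, inv_mul_cancel_left₀ (by positivity)]
  calc (p : ℝ) ^ (k / 2) = √(p : ℝ) ^ (2 * (k / 2)) := by
        rw [pow_mul, Real.sq_sqrt hp0.le]
    _ ≤ √(p : ℝ) ^ k := pow_le_pow_right₀ hs.le (Nat.mul_div_le k 2)

theorem summable_norm_rootQuotient_div {t : ℤ} (hD0 : t ^ 2 - 4 ≠ 0) :
    Summable fun n => ‖divId (rootQuotient t) n‖ := by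
  have hmul := isMultiplicative_divId (isMultiplicative_rootQuotient t)
  set T : ℕ → ℝ := fun p => ∑' k : ℕ, ‖divId (rootQuotient t) (p ^ k)‖ with hT
  have hT0 : ∀ p, 0 ≤ T p := fun p => tsum_nonneg fun _ => norm_nonneg _
  -- Outside `B` a prime is odd and does not divide t² - 4, so its Euler factor is at most 1 + p⁻².
  -- The finitely many primes in `B` only need convergent local sums.
  set B : Finset ℕ := Finset.range (2 * (t ^ 2 - 4).natAbs + 1) with hB
  refine hmul.summable_norm (e := fun p => 1 / (p : ℝ) ^ 2 + if p ∈ B then T p else 0)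
    ?_ (fun p => ?_) (fun p hp => summable_norm_rootQuotient_prime_pow_div t hp) fun p hp => ?_
  · refine (Real.summable_one_div_nat_pow.2 one_lt_two).add ?_
    exact summable_of_ne_finset_zero (s := B) fun p hp => if_neg hp
  · have := hT0 p
    split_ifs <;> positivity
  · by_cases hpB : p ∈ B
    · rw [if_pos hpB]
      have : 0 ≤ 1 / (p : ℝ) ^ 2 := by positivity
      simp only [hT]
      linarith
    · rw [if_neg hpB, add_zero]
      have hlt : 2 * (t ^ 2 - 4).natAbs < p := by
        by_contra h
        exact hpB (Finset.mem_range.2 (by omega))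
      have hpos : 0 < (t ^ 2 - 4).natAbs := Int.natAbs_pos.2 hD0
      have hnd : ¬ (p : ℤ) ∣ t ^ 2 - 4 := fun h => by
        have := Nat.le_of_dvd hpos (Int.natCast_dvd.1 h)
        omega
      obtain ⟨h1, h2, h3⟩ := rootQuotient_prime_pow_of_not_dvd hp (by omega) hnd
      rw [tsum_eq_sum (s := Finset.range 3)]
      · simp only [Finset.sum_range_succ, Finset.range_zero, Finset.sum_empty, zero_add, pow_zero,
          pow_one, (isMultiplicative_rootQuotient t).1, norm_one, Nat.cast_one, div_one, divId_apply, h1, zero_div, norm_zero, add_zero, norm_div,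
          Complex.norm_natCast]
        push_cast
        gcongr
      · intro k hk
        obtain ⟨j, rfl⟩ := Nat.exists_eq_add_of_le (show 3 ≤ k by simpa using hk)
        rw [add_comm, divId_apply, h3, zero_div, norm_zero]

/-- The Dirichlet series of `rootMoebius t` converges at `s = 1`. -/
theorem exists_tendsto_sum_rootMoebius_div {t : ℤ} (hD0 : 0 < t ^ 2 - 4)
    (hD : ¬ IsSquare (t ^ 2 - 4)) :
    ∃ G : ℂ, Tendsto (fun N : ℕ => ∑ n ∈ Finset.Ioc 0 N, rootMoebius t n / n) atTop (𝓝 G) := by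
  obtain ⟨A, hA⟩ := exists_tendsto_sum_oddJacobi_div hD0 hD
  have h := tendsto_sum_Ioc_mul_of_summable (a := divId (oddJacobiFun (t ^ 2 - 4))) hA
    (summable_norm_rootQuotient_div hD0.ne')
  rw [← divId_mul, rootQuotient_mul_oddJacobiFun] at h
  exact ⟨_, h⟩

/-! ### Kloosterman sums and Ramanujan sums -/

/-- The additive character `e(j / q)`. -/
noncomputable def addChar (q : ℕ) (j : ℤ) : ℂ :=
  Complex.exp (2 * Real.pi * Complex.I * ((j : ℂ) / (q : ℂ)))

theorem addChar_eq_stdAddChar (q : ℕ) [NeZero q] (j : ℤ) :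
    addChar q j = ZMod.stdAddChar (j : ZMod q) := by
  rw [ZMod.stdAddChar_coe, addChar, mul_div_assoc]

theorem norm_addChar (q : ℕ) (j : ℤ) : ‖addChar q j‖ = 1 := by
  have : 2 * Real.pi * Complex.I * ((j : ℂ) / (q : ℂ)) =
      ((2 * Real.pi * (j / q) : ℝ) : ℂ) * Complex.I := by
    push_cast
    ring
  rw [addChar, this, Complex.norm_exp_ofReal_mul_I]

theorem addChar_mul_mul {k q : ℕ} (hk : k ≠ 0) (j : ℤ) :
    addChar (k * q) (k * j) = addChar q j := by
  unfold addChar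
  have : (k : ℂ) ≠ 0 := by exact_mod_cast hk
  push_cast
  rw [mul_div_mul_left _ _ this]

theorem sum_range_zmod {q : ℕ} [NeZero q] {M : Type*} [AddCommMonoid M] (f : ZMod q → M) :
    ∑ n ∈ Finset.range q, f n = ∑ x : ZMod q, f x := by
  refine Finset.sum_nbij' (fun m => (m : ZMod q)) ZMod.val (by simp) ?_ ?_ ?_ ?_
  · intro x _
    simpa using ZMod.val_lt x
  · intro m hm
    exact ZMod.val_cast_of_lt (by simpa using hm)
  · intro x _
    exact ZMod.natCast_zmod_val x
  · intro m hm
    rfl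

theorem sum_range_coprime_zmod {q : ℕ} [NeZero q] {M : Type*} [AddCommMonoid M]
    (f : ZMod q → M) :
    ∑ n ∈ (Finset.range q).filter (fun x => Nat.Coprime x q), f n =
      ∑ u : (ZMod q)ˣ, f u := by
  refine Finset.sum_bij' (fun n hn => ZMod.unitOfCoprime n (Finset.mem_filter.1 hn).2)
    (fun u _ => (u : ZMod q).val) (by simp) ?_ ?_ ?_ ?_
  · intro u _
    simpa [ZMod.val_lt] using ZMod.val_coe_unit_coprime u
  · intro n hn
    exact ZMod.val_cast_of_lt (Finset.mem_range.1 (Finset.mem_filter.1 hn).1)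
  · intro u _
    ext
    simp
  · intro n hn
    rw [ZMod.coe_unitOfCoprime]

theorem kloosterman_eq_sum_units (m n : ℤ) (q : ℕ) [NeZero q] :
    kloosterman m n q = ∑ u : (ZMod q)ˣ, ZMod.stdAddChar (m * u + n * (u⁻¹ : (ZMod q)ˣ) : ZMod q) := by
  have h : ∀ x : ℕ, Complex.exp (2 * Real.pi * Complex.I *
      (((m * x + n * (((x : ZMod q)⁻¹).val : ℤ) : ℤ) : ℂ) / (q : ℂ))) =
      ZMod.stdAddChar (m * x + n * (x : ZMod q)⁻¹ : ZMod q) := by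
    intro x
    rw [← addChar, addChar_eq_stdAddChar]
    push_cast
    rw [ZMod.natCast_zmod_val]
  rw [kloosterman, Finset.sum_congr rfl fun x _ => h x,
    sum_range_coprime_zmod fun x : ZMod q => ZMod.stdAddChar (m * x + n * x⁻¹ : ZMod q)]
  refine Finset.sum_congr rfl fun u _ => ?_
  rw [ZMod.inv_coe_unit]

theorem norm_kloosterman_le (m n : ℤ) (q : ℕ) : ‖kloosterman m n q‖ ≤ q := by
  refine (norm_sum_le _ _).trans ?_
  calc _ ≤ ∑ x ∈ (Finset.range q).filter (fun x => Nat.Coprime x q), (1 : ℝ) :=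
        Finset.sum_le_sum fun x _ => (norm_addChar _ _).le
    _ ≤ q := by
        rw [Finset.sum_const, nsmul_eq_mul, mul_one]
        exact_mod_cast (Finset.card_filter_le _ _).trans (Finset.card_range q).le

theorem kloosterman_sq_add_mul (a k n : ℤ) (q : ℕ) [NeZero q] :
    kloosterman ((k * q + a) ^ 2) n q = kloosterman (a ^ 2) n q := by
  rw [kloosterman_eq_sum_units, kloosterman_eq_sum_units]
  simp

/-- The sum over residues `b` of the Ramanujan sums `c_q(b² - t b + 1)`. -/
noncomputable def ramanujanSum (t : ℤ) (q : ℕ) : ℂ :=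
  ∑ x ∈ (Finset.range q).filter (fun x => Nat.Coprime x q), ∑ b ∈ Finset.range q,
    addChar q (x * ((b : ℤ) ^ 2 - t * b + 1))

/-- Replacing u by u⁻¹ and then a by ub turns the phase a²u + u⁻¹ - ta into u(b² - tb + 1). -/
theorem sum_kloosterman_mul_addChar (t : ℤ) (q : ℕ) [NeZero q] :
    ∑ a ∈ Finset.range q, kloosterman ((a : ℤ) ^ 2) 1 q * addChar q (-t * a) =
      ramanujanSum t q := by
  have h1 : ∀ a : ℕ, kloosterman ((a : ℤ) ^ 2) 1 q * addChar q (-t * a) =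
      ∑ u : (ZMod q)ˣ, ZMod.stdAddChar
        ((a : ZMod q) ^ 2 * u + (u⁻¹ : (ZMod q)ˣ) - t * a : ZMod q) := by
    intro a
    rw [kloosterman_eq_sum_units, addChar_eq_stdAddChar, Finset.sum_mul]
    refine Finset.sum_congr rfl fun u _ => ?_
    rw [← AddChar.map_add_eq_mul]
    push_cast
    congr 1
    ring
  have h2 : ∀ x : ℕ, ∑ b ∈ Finset.range q, addChar q (x * ((b : ℤ) ^ 2 - t * b + 1)) =
      ∑ b : ZMod q, ZMod.stdAddChar ((x : ZMod q) * (b ^ 2 - (t : ZMod q) * b + 1)) := by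
    intro x
    rw [← sum_range_zmod fun b : ZMod q => ZMod.stdAddChar ((x : ZMod q) * (b ^ 2 - (t : ZMod q) * b + 1))]
    refine Finset.sum_congr rfl fun b _ => ?_
    rw [addChar_eq_stdAddChar]
    push_cast
    rfl
  rw [ramanujanSum, Finset.sum_congr rfl fun a _ => h1 a, Finset.sum_congr rfl fun x _ => h2 x,
    sum_range_zmod fun a : ZMod q => ∑ u : (ZMod q)ˣ, ZMod.stdAddChar
        (a ^ 2 * u + (u⁻¹ : (ZMod q)ˣ) - t * a : ZMod q),
    sum_range_coprime_zmod fun x : ZMod q =>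
      ∑ b : ZMod q, ZMod.stdAddChar (x * (b ^ 2 - (t : ZMod q) * b + 1)), Finset.sum_comm,
    ← Equiv.sum_comp (Equiv.inv (ZMod q)ˣ)]
  refine Finset.sum_congr rfl fun u _ => ?_
  rw [← Equiv.sum_comp (Units.mulLeft u)]
  refine Finset.sum_congr rfl fun b _ => ?_
  simp only [Units.mulLeft_apply, Equiv.inv_apply, inv_inv]
  congr 1
  have h : (u : ZMod q) * ((u⁻¹ : (ZMod q)ˣ) : ZMod q) = 1 := Units.mul_inv u
  linear_combination (u : ZMod q) * b ^ 2 * h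

theorem sum_range_mul_of_periodic {f : ℕ → ℂ} {d : ℕ} (hf : Function.Periodic f d) (k : ℕ) :
    ∑ b ∈ Finset.range (k * d), f b = k * ∑ b ∈ Finset.range d, f b := by
  induction k with
  | zero => simp
  | succ k ih =>
    rw [Nat.succ_mul, Finset.sum_range_add, ih]
    have : ∀ x, f (k * d + x) = f x := fun x => by
      rw [add_comm]
      exact hf.nat_mul k x
    simp_rw [this]
    push_cast
    ring

/-- Writing x as k times a residue prime to d lowers the modulus from kd to d, and b then runs
through k full periods. -/
theorem sum_filter_gcd_addChar (t : ℤ) {k d : ℕ} (hk : k ≠ 0) (hd : d ≠ 0) :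
    ∑ x ∈ (Finset.range (k * d)).filter (fun x => Nat.gcd (k * d) x = k),
      ∑ b ∈ Finset.range (k * d), addChar (k * d) (x * ((b : ℤ) ^ 2 - t * b + 1)) =
      k * ramanujanSum t d := by
  have : NeZero d := ⟨hd⟩
  rw [ramanujanSum, Finset.mul_sum]
  symm
  refine Finset.sum_bij (fun x _ => k * x) ?_ ?_ ?_ ?_
  · intro x hx
    rw [Finset.mem_filter, Finset.mem_range] at hx ⊢
    refine ⟨Nat.mul_lt_mul_of_pos_left hx.1 (Nat.pos_of_ne_zero hk), ?_⟩
    rw [Nat.gcd_mul_left, Nat.gcd_comm, hx.2, mul_one]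
  · intro x _ y _ hxy
    exact Nat.eq_of_mul_eq_mul_left (Nat.pos_of_ne_zero hk) hxy
  · intro y hy
    rw [Finset.mem_filter, Finset.mem_range] at hy
    obtain ⟨x, rfl⟩ : k ∣ y := hy.2 ▸ Nat.gcd_dvd_right _ _
    refine ⟨x, ?_, rfl⟩
    rw [Finset.mem_filter, Finset.mem_range]
    refine ⟨lt_of_mul_lt_mul_left hy.1 (Nat.zero_le k), ?_⟩
    have := hy.2
    rw [Nat.gcd_mul_left] at this
    rw [Nat.coprime_comm]
    exact Nat.eq_of_mul_eq_mul_left (Nat.pos_of_ne_zero hk) (by rw [this, mul_one])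
  · intro x hx
    have h : ∀ b : ℕ, addChar (k * d) (((k * x : ℕ) : ℤ) * ((b : ℤ) ^ 2 - t * b + 1)) =
        addChar d (x * ((b : ℤ) ^ 2 - t * b + 1)) := by
      intro b
      rw [Nat.cast_mul, mul_assoc, addChar_mul_mul hk]
    simp_rw [h]
    refine (sum_range_mul_of_periodic (fun b => ?_) k).symm
    rw [addChar_eq_stdAddChar, addChar_eq_stdAddChar]
    push_cast
    rw [ZMod.natCast_self, add_zero]

/-- Orthogonality: summing over all x modulo q, not only the units, detects q ∣ b² - tb + 1.
Grouping x by its gcd with q gives the divisor sum, which Möbius inversion then undoes. -/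
theorem sum_divisors_ramanujanSum (t : ℤ) {q : ℕ} (hq : q ≠ 0) :
    ∑ d ∈ q.divisors, ramanujanSum t d / d = rootCount t q := by
  have : NeZero q := ⟨hq⟩
  have hq0 : (q : ℂ) ≠ 0 := by exact_mod_cast hq
  have h1 : ∑ x ∈ Finset.range q, ∑ b ∈ Finset.range q,
      addChar q (x * ((b : ℤ) ^ 2 - t * b + 1)) = q * rootCount t q := by
    rw [Finset.sum_comm]
    have h2 : ∀ b : ℕ, ∑ x ∈ Finset.range q, addChar q (x * ((b : ℤ) ^ 2 - t * b + 1)) =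
        if (q : ℤ) ∣ (b : ℤ) ^ 2 - t * b + 1 then (q : ℂ) else 0 := by
      intro b
      have h3 := AddChar.sum_mulShift (((b : ℤ) ^ 2 - t * b + 1 : ℤ) : ZMod q)
        (ZMod.isPrimitive_stdAddChar q)
      rw [← sum_range_zmod fun x : ZMod q => ZMod.stdAddChar
        (x * (((b : ℤ) ^ 2 - t * b + 1 : ℤ) : ZMod q)), ZMod.card] at h3
      simp only [ZMod.intCast_zmod_eq_zero_iff_dvd] at h3
      push_cast at h3 ⊢
      rw [← h3]
      refine Finset.sum_congr rfl fun x _ => ?_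
      rw [addChar_eq_stdAddChar]
      push_cast
      rfl
    rw [Finset.sum_congr rfl fun b _ => h2 b, ← Finset.sum_filter, Finset.sum_const, rootCount,
      nsmul_eq_mul, mul_comm]
  have h2 : ∑ x ∈ Finset.range q, ∑ b ∈ Finset.range q,
      addChar q (x * ((b : ℤ) ^ 2 - t * b + 1)) =
      ∑ k ∈ q.divisors, (k : ℂ) * ramanujanSum t (q / k) := by
    rw [← Finset.sum_fiberwise_of_maps_to (s := Finset.range q) (t := q.divisors)
      (g := fun x => Nat.gcd q x) (fun x _ => Nat.mem_divisors.2 ⟨Nat.gcd_dvd_left _ _, hq⟩)]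
    refine Finset.sum_congr rfl fun k hk => ?_
    obtain ⟨d, rfl⟩ := Nat.dvd_of_mem_divisors hk
    have hk0 := left_ne_zero_of_mul hq
    rw [sum_filter_gcd_addChar t hk0 (right_ne_zero_of_mul hq),
      Nat.mul_div_cancel_left _ (Nat.pos_of_ne_zero hk0)]
  rw [← mul_right_inj' hq0, ← h1, h2, Finset.mul_sum,
    ← Nat.sum_div_divisors q fun d => (q : ℂ) * (ramanujanSum t d / d)]
  refine Finset.sum_congr rfl fun k hk => ?_
  obtain ⟨d, rfl⟩ := Nat.dvd_of_mem_divisors hk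
  rw [Nat.mul_div_cancel_left _ (Nat.pos_of_ne_zero (left_ne_zero_of_mul hq))]
  push_cast at hq0 ⊢
  have := right_ne_zero_of_mul hq0
  field_simp

open ArithmeticFunction in
theorem ramanujanSum_eq (t : ℤ) {q : ℕ} (hq : q ≠ 0) :
    ramanujanSum t q = q * rootMoebius t q := by
  let F : ArithmeticFunction ℂ := ⟨fun d => ramanujanSum t d / d, by simp⟩
  have hF : F * (zeta : ArithmeticFunction ℂ) = rootFun t := by
    ext n
    rcases eq_or_ne n 0 with rfl | hn
    · simp
    · rw [coe_mul_zeta_apply]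
      exact sum_divisors_ramanujanSum t hn
  have : rootMoebius t = F := by
    rw [rootMoebius, ← hF, mul_assoc, coe_zeta_mul_coe_moebius, mul_one]
  rw [this]
  have hq0 : (q : ℂ) ≠ 0 := by exact_mod_cast hq
  exact (mul_div_cancel₀ _ hq0).symm

theorem rootMoebius_neg (t : ℤ) : rootMoebius (-t) = rootMoebius t := by
  have : rootFun (-t) = rootFun t := by
    ext d
    rw [rootFun_apply, rootFun_apply, rootCount_neg]
  rw [rootMoebius, this, rootMoebius]

theorem sum_kloosterman_mul_addChar_eq (n : ℤ) {q : ℕ} (hq : q ≠ 0) :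
    ∑ a ∈ Finset.range q, kloosterman ((a : ℤ) ^ 2) 1 q * addChar q (n * a) =
      q * rootMoebius n q := by
  have : NeZero q := ⟨hq⟩
  have h := sum_kloosterman_mul_addChar (-n) q
  rwa [ramanujanSum_eq _ hq, rootMoebius_neg, neg_neg] at h

/-! ### Poisson summation with periodic coefficients -/

section Poisson

open scoped SchwartzMap

theorem summable_schwartz_div (f : 𝓢(ℝ, ℂ)) {q : ℕ} (hq : q ≠ 0) :
    Summable fun l : ℤ => ‖f ((l : ℝ) / q)‖ := by
  have hq0 : (0 : ℝ) < q := by exact_mod_cast Nat.pos_of_ne_zero hq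
  obtain ⟨C, hC⟩ := f.decay 2 0
  refine Summable.of_norm_bounded_eventually (g := fun l : ℤ => C * (q : ℝ) ^ 2 * (1 / (l : ℝ) ^ 2))
    ((Real.summable_one_div_int_pow.2 one_lt_two).mul_left _) ?_
  filter_upwards [(Set.finite_singleton (0 : ℤ)).compl_mem_cofinite] with l hl
  have hl0 : (l : ℝ) ≠ 0 := by exact_mod_cast hl
  have h := hC.2 ((l : ℝ) / q)
  rw [norm_iteratedFDeriv_zero, Real.norm_eq_abs, sq_abs, div_pow, div_mul_eq_mul_div,
    div_le_iff₀ (by positivity)] at h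
  rw [norm_norm, mul_one_div, le_div_iff₀ (by positivity), mul_comm]
  exact h

/-- The integers split as l = kq + a. For each a the coefficient is constant, and Poisson summation
applies to the translate by a/q of `𝓕 f`, whose own transform is f(-n). -/
theorem tsum_mul_fourier_div (f : 𝓢(ℝ, ℂ)) {q : ℕ} (hq : q ≠ 0) {c : ℤ → ℂ}
    (hc : ∀ k a : ℤ, c (k * q + a) = c a) (hcb : ∃ K, ∀ l, ‖c l‖ ≤ K) :
    Summable (fun l : ℤ => c l * 𝓕 f ((l : ℝ) / q)) ∧
    ∑' l : ℤ, c l * 𝓕 f ((l : ℝ) / q) =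
      ∑ a ∈ Finset.range q, c a * ∑' n : ℤ, f (-n) * addChar q (n * a) := by
  have : NeZero q := ⟨hq⟩
  have hq0 : (q : ℝ) ≠ 0 := by exact_mod_cast hq
  obtain ⟨K, hK⟩ := hcb
  have hsum : Summable fun l : ℤ => c l * 𝓕 f ((l : ℝ) / q) := by
    refine Summable.of_norm_bounded ((summable_schwartz_div (𝓕 f) hq).mul_left K) fun l => ?_
    rw [norm_mul]
    exact mul_le_mul_of_nonneg_right (hK l) (norm_nonneg _)
  refine ⟨hsum, ?_⟩
  have h1 : ∀ a : ℕ, ∑' k : ℤ, 𝓕 f ((a : ℝ) / q + k) = ∑' n : ℤ, f (-n) * addChar q (n * a) := by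
    intro a
    rw [SchwartzMap.tsum_eq_tsum_fourier (𝓕 f)]
    refine tsum_congr fun n => ?_
    have h2 : 𝓕 (𝓕 f) (n : ℝ) = f (-n) := by
      have h3 : 𝓕⁻ (𝓕 f) (-(n : ℝ)) = f (-n) := by
        rw [FourierTransform.fourierInv_fourier_eq]
      rw [← h3, SchwartzMap.fourierInv_coe, SchwartzMap.fourier_coe (𝓕 f),
        Real.fourierInv_eq_fourier_neg, neg_neg]
    rw [h2, fourier_coe_apply, addChar]
    congr 2
    push_cast
    ring
  rw [← (Int.divModEquiv q).symm.tsum_eq]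
  have hsum' := (Int.divModEquiv q).symm.summable_iff.2 hsum
  have h2 : ∀ p : ℤ × Fin q, ((Int.divModEquiv q).symm p : ℤ) = p.1 * q + (p.2 : ℕ) :=
    fun p => rfl
  have h3 : ∀ p : ℤ × Fin q, c ((Int.divModEquiv q).symm p) *
      𝓕 f ((((Int.divModEquiv q).symm p : ℤ) : ℝ) / q) =
      c ((p.2 : ℕ) : ℤ) * 𝓕 f (((p.2 : ℕ) : ℝ) / q + p.1) := by
    intro p
    rw [h2, hc]
    congr 2
    push_cast
    field_simp
    ring
  rw [← (Equiv.prodComm (Fin q) ℤ).tsum_eq]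
  have hsum'' := (Equiv.prodComm (Fin q) ℤ).summable_iff.2 hsum'
  simp only [Function.comp_def, h3, Equiv.prodComm_apply, Prod.fst_swap, Prod.snd_swap]
    at hsum'' ⊢
  rw [hsum''.tsum_prod, tsum_fintype, Finset.sum_range]
  refine Finset.sum_congr rfl fun a _ => ?_
  dsimp only
  rw [tsum_mul_left, h1]

end Poisson

/-! ### Matrices, their quadratic forms and eigenvalues -/

/-- `SL(2, ℤ)`. -/
abbrev SL2Z : Type := Matrix.SpecialLinearGroup (Fin 2) ℤ

theorem SL2Z.det_eq (A : SL2Z) : A 0 0 * A 1 1 - A 0 1 * A 1 0 = 1 := by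
  have := A.det_coe
  rwa [Matrix.det_fin_two] at this

theorem SL2Z.mul_apply (A B : SL2Z) (i j : Fin 2) :
    (A * B) i j = A i 0 * B 0 j + A i 1 * B 1 j := by
  rw [Matrix.SpecialLinearGroup.coe_mul, Matrix.mul_apply, Fin.sum_univ_two]

theorem SL2Z.inv_apply (A : SL2Z) : A⁻¹ 0 0 = A 1 1 ∧ A⁻¹ 0 1 = -A 0 1 ∧ A⁻¹ 1 0 = -A 1 0 ∧
    A⁻¹ 1 1 = A 0 0 := by
  rw [Matrix.SpecialLinearGroup.SL2_inv_expl]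
  simp

theorem SL2Z.ext_iff' {A B : SL2Z} : A = B ↔
    A 0 0 = B 0 0 ∧ A 0 1 = B 0 1 ∧ A 1 0 = B 1 0 ∧ A 1 1 = B 1 1 := by
  constructor
  · rintro rfl
    simp
  · rintro ⟨h1, h2, h3, h4⟩
    ext i j
    fin_cases i <;> fin_cases j <;> assumption

/-- The trace of a matrix in `SL(2, ℤ)`. -/
def trSL (A : SL2Z) : ℤ := A 0 0 + A 1 1

theorem trSL_conj (g A : SL2Z) : trSL (g * A * g⁻¹) = trSL A := by
  obtain ⟨h1, h2, h3, h4⟩ := SL2Z.inv_apply g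
  have hd := SL2Z.det_eq g
  simp only [trSL, SL2Z.mul_apply, h1, h2, h3, h4]
  linear_combination (A 0 0 + A 1 1) * hd

theorem trSL_inv (A : SL2Z) : trSL A⁻¹ = trSL A := by
  obtain ⟨h1, h2, h3, h4⟩ := SL2Z.inv_apply A
  rw [trSL, trSL, h1, h4, add_comm]

theorem trSL_neg (A : SL2Z) : trSL (-A) = -trSL A := by
  simp only [trSL, Matrix.SpecialLinearGroup.coe_neg, Matrix.neg_apply]
  ring

/-- A triangular integer matrix of determinant 1 has trace ±2. -/
theorem lowerLeft_ne_zero {A : SL2Z} (h : 2 < trSL A) : A 1 0 ≠ 0 := by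
  intro h0
  have hd := SL2Z.det_eq A
  rw [h0, mul_zero, sub_zero] at hd
  unfold trSL at h
  rcases Int.eq_one_or_neg_one_of_mul_eq_one' hd with ⟨h1, h2⟩ | ⟨h1, h2⟩ <;> omega

/-- The lower left entry of `g A g⁻¹` as a quadratic form in the bottom row of `g`. -/
def rowForm (A : SL2Z) (x y : ℤ) : ℤ :=
  -A 0 1 * x ^ 2 + (A 0 0 - A 1 1) * x * y + A 1 0 * y ^ 2

theorem conj_lowerLeft (g A : SL2Z) : (g * A * g⁻¹) 1 0 = rowForm A (g 1 0) (g 1 1) := by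
  obtain ⟨h1, h2, h3, h4⟩ := SL2Z.inv_apply g
  simp only [rowForm, SL2Z.mul_apply, h1, h3]
  ring

/-- The larger root of `λ + λ⁻¹ = t`. -/
noncomputable def eigval (t : ℤ) : ℝ := ((t : ℝ) + √((t : ℝ) ^ 2 - 4)) / 2

theorem disc_pos {t : ℤ} (ht : 2 < t) : (0 : ℝ) < (t : ℝ) ^ 2 - 4 := by
  have : (2 : ℝ) < t := by exact_mod_cast ht
  nlinarith

theorem one_lt_eigval {t : ℤ} (ht : 2 < t) : 1 < eigval t := by
  have h1 : (2 : ℝ) < t := by exact_mod_cast ht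
  have h2 := Real.sqrt_nonneg ((t : ℝ) ^ 2 - 4)
  unfold eigval
  linarith

theorem eigval_inv {t : ℤ} (ht : 2 < t) : (eigval t)⁻¹ = ((t : ℝ) - √((t : ℝ) ^ 2 - 4)) / 2 := by
  have h1 := one_lt_eigval ht
  have h2 := Real.sq_sqrt (disc_pos ht).le
  refine inv_eq_of_mul_eq_one_right ?_
  rw [eigval]
  linarith

theorem eq_eigval_of_add_inv {t : ℤ} (ht : 2 < t) {e : ℝ} (he : 1 < e) (h : e + e⁻¹ = t) :
    e = eigval t := by
  have h1 := one_lt_eigval ht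
  have h2 : eigval t + (eigval t)⁻¹ = t := by
    rw [eigval_inv ht, eigval]
    ring
  have h3 : (e - eigval t) * (1 - e⁻¹ * (eigval t)⁻¹) = 0 := by
    have he0 : e ≠ 0 := by positivity
    have hE0 : eigval t ≠ 0 := by positivity
    have : e + e⁻¹ - (eigval t + (eigval t)⁻¹) = 0 := by rw [h, h2, sub_self]
    rw [← this]
    field_simp
    ring
  have h4 : e⁻¹ * (eigval t)⁻¹ < 1 :=
    mul_lt_one_of_nonneg_of_lt_one_left (by positivity) (inv_lt_one_of_one_lt₀ he)
      (inv_lt_one_of_one_lt₀ h1).le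
  rcases mul_eq_zero.1 h3 with h | h <;> linarith

/-! ### Linear factors of the form and the centralizer -/

/-- The attracting root of the form `rowForm P`. -/
noncomputable def root (P : SL2Z) : ℝ := (eigval (trSL P) - P 1 1) / P 1 0

/-- The repelling root of the form `rowForm P`. -/
noncomputable def root' (P : SL2Z) : ℝ := ((eigval (trSL P))⁻¹ - P 1 1) / P 1 0

/-- The first linear factor of `rowForm P`. -/
noncomputable def formU (P : SL2Z) (x y : ℝ) : ℝ := x * root P + y

/-- The second linear factor of `rowForm P`. -/
noncomputable def formV (P : SL2Z) (x y : ℝ) : ℝ := P 1 0 * (x * root' P + y)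

section Hyperbolic

variable {P : SL2Z}

theorem roots_add (hP : 2 < trSL P) :
    (P 1 0 : ℝ) * (root P + root' P) = P 0 0 - P 1 1 := by
  have hc : (P 1 0 : ℝ) ≠ 0 := by exact_mod_cast lowerLeft_ne_zero hP
  rw [root, root', eigval_inv hP, eigval]
  field_simp
  unfold trSL
  push_cast
  ring

/-- This is the determinant of (x, y) ↦ (U, V), hence the covolume in the lattice point count. -/
theorem roots_sub (hP : 2 < trSL P) :
    (P 1 0 : ℝ) * (root P - root' P) = √((trSL P : ℝ) ^ 2 - 4) := by
  have hc : (P 1 0 : ℝ) ≠ 0 := by exact_mod_cast lowerLeft_ne_zero hP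
  rw [root, root', eigval_inv hP, eigval]
  field_simp
  ring

theorem roots_mul (hP : 2 < trSL P) : (P 1 0 : ℝ) * (root P * root' P) = -P 0 1 := by
  have hc : (P 1 0 : ℝ) ≠ 0 := by exact_mod_cast lowerLeft_ne_zero hP
  have h1 := roots_add hP
  have h2 := roots_sub hP
  have h3 := Real.sq_sqrt (disc_pos hP).le
  rw [← h2] at h3
  have hd : (P 0 0 : ℝ) * P 1 1 - P 0 1 * P 1 0 = 1 := by exact_mod_cast SL2Z.det_eq P
  have h4 : (trSL P : ℝ) = P 0 0 + P 1 1 := by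
    unfold trSL
    push_cast
    ring
  rw [h4] at h3
  have h5 : (P 1 0 : ℝ) * (4 * (P 1 0 * (root P * root' P))) = P 1 0 * (4 * (-P 0 1)) := by
    linear_combination (P 1 0 * (root P + root' P) + (P 0 0 - P 1 1)) * h1 - h3 - 4 * hd
  have := mul_left_cancel₀ hc h5
  linarith

theorem formU_mul_formV (hP : 2 < trSL P) (x y : ℤ) :
    formU P x y * formV P x y = rowForm P x y := by
  have h1 := roots_add hP
  have h2 := roots_mul hP
  unfold formU formV rowForm
  push_cast
  linear_combination (x : ℝ) ^ 2 * h2 + x * y * h1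

theorem commute_entries {z : SL2Z} (hz : Commute z P) :
    z 0 1 * P 1 0 = P 0 1 * z 1 0 ∧ P 1 0 * (z 0 0 - z 1 1) = z 1 0 * (P 0 0 - P 1 1) := by
  have h := SL2Z.ext_iff'.1 hz.eq
  simp only [SL2Z.mul_apply] at h
  obtain ⟨h1, -, h3, -⟩ := h
  constructor
  · linarith
  · linarith

/-- The column (`root P`, 1) is an eigenvector of every `z` commuting with `P`, and `formU` pairs a
bottom row with it. -/
theorem formU_row_mul (hP : 2 < trSL P) {z : SL2Z} (hz : Commute z P) (g : SL2Z) :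
    formU P ((g * z) 1 0) ((g * z) 1 1) = formU P (z 1 0) (z 1 1) * formU P (g 1 0) (g 1 1) := by
  have hc : (P 1 0 : ℝ) ≠ 0 := by exact_mod_cast lowerLeft_ne_zero hP
  have h1 := roots_add hP
  have h2 := roots_mul hP
  obtain ⟨h3, h4⟩ := commute_entries hz
  have h3' : (z 0 1 : ℝ) * P 1 0 = P 0 1 * z 1 0 := by exact_mod_cast h3
  have h4' : (P 1 0 : ℝ) * (z 0 0 - z 1 1) = z 1 0 * (P 0 0 - P 1 1) := by exact_mod_cast h4
  simp only [formU, SL2Z.mul_apply]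
  push_cast
  refine mul_left_cancel₀ hc ?_
  linear_combination (g 1 0 : ℝ) * root P * h4' + (g 1 0 : ℝ) * h3'
    - (g 1 0 : ℝ) * z 1 0 * root P * h1 + (g 1 0 : ℝ) * z 1 0 * h2

theorem formV_row_mul (hP : 2 < trSL P) {z : SL2Z} (hz : Commute z P) (g : SL2Z) :
    P 1 0 * formV P ((g * z) 1 0) ((g * z) 1 1) =
      formV P (z 1 0) (z 1 1) * formV P (g 1 0) (g 1 1) := by
  have h1 := roots_add hP
  have h2 := roots_mul hP
  obtain ⟨h3, h4⟩ := commute_entries hz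
  have h3' : (z 0 1 : ℝ) * P 1 0 = P 0 1 * z 1 0 := by exact_mod_cast h3
  have h4' : (P 1 0 : ℝ) * (z 0 0 - z 1 1) = z 1 0 * (P 0 0 - P 1 1) := by exact_mod_cast h4
  simp only [formV, SL2Z.mul_apply]
  push_cast
  linear_combination (P 1 0 : ℝ) * ((g 1 0 : ℝ) * root' P * h4' + (g 1 0 : ℝ) * h3'
    - (g 1 0 : ℝ) * z 1 0 * root' P * h1 + (g 1 0 : ℝ) * z 1 0 * h2)

/-- The eigenvalue of an element of the centralizer of `P`. -/
noncomputable def eps (P z : SL2Z) : ℝ := formU P (z 1 0) (z 1 1)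

theorem eps_mul (hP : 2 < trSL P) {z : SL2Z} (hz : Commute z P) (g : SL2Z) :
    eps P (g * z) = eps P g * eps P z := by
  rw [eps, formU_row_mul hP hz, mul_comm]
  rfl

theorem eps_one (P : SL2Z) : eps P 1 = 1 := by
  simp [eps, formU]

theorem eps_neg (P z : SL2Z) : eps P (-z) = -eps P z := by
  simp only [eps, formU, Matrix.SpecialLinearGroup.coe_neg, Matrix.neg_apply]
  push_cast
  ring

theorem eps_self (hP : 2 < trSL P) : eps P P = eigval (trSL P) := by
  have hc : (P 1 0 : ℝ) ≠ 0 := by exact_mod_cast lowerLeft_ne_zero hP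
  rw [eps, formU, root]
  field_simp
  ring

/-- The product UV at the bottom row of `z` is the lower left entry of z P z⁻¹, which equals `P`. -/
theorem eps_mul_formV (hP : 2 < trSL P) {z : SL2Z} (hz : Commute z P) :
    eps P z * formV P (z 1 0) (z 1 1) = P 1 0 := by
  rw [eps, formU_mul_formV hP, ← conj_lowerLeft, hz.eq, mul_inv_cancel_right]

theorem eps_ne_zero (hP : 2 < trSL P) {z : SL2Z} (hz : Commute z P) : eps P z ≠ 0 := by
  intro h
  have := eps_mul_formV hP hz
  rw [h, zero_mul] at this
  exact lowerLeft_ne_zero hP (by exact_mod_cast this.symm)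

theorem formU_row_mul' (hP : 2 < trSL P) {z : SL2Z} (hz : Commute z P) (g : SL2Z) :
    formU P ((g * z) 1 0) ((g * z) 1 1) = eps P z * formU P (g 1 0) (g 1 1) :=
  formU_row_mul hP hz g

theorem formV_row_mul' (hP : 2 < trSL P) {z : SL2Z} (hz : Commute z P) (g : SL2Z) :
    formV P ((g * z) 1 0) ((g * z) 1 1) = (eps P z)⁻¹ * formV P (g 1 0) (g 1 1) := by
  have hc : (P 1 0 : ℝ) ≠ 0 := by exact_mod_cast lowerLeft_ne_zero hP
  have h1 := formV_row_mul hP hz g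
  have h2 := eps_mul_formV hP hz
  have h3 := eps_ne_zero hP hz
  rw [eq_inv_mul_iff_mul_eq₀ h3]
  refine mul_left_cancel₀ hc ?_
  linear_combination eps P z * h1 + formV P (g 1 0) (g 1 1) * h2

theorem eps_add_inv (hP : 2 < trSL P) {z : SL2Z} (hz : Commute z P) :
    eps P z + (eps P z)⁻¹ = trSL z := by
  have hc : (P 1 0 : ℝ) ≠ 0 := by exact_mod_cast lowerLeft_ne_zero hP
  have h0 := eps_ne_zero hP hz
  have h2 := eps_mul_formV hP hz
  have h1 := roots_add hP
  obtain ⟨-, h4⟩ := commute_entries hz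
  have h4' : (P 1 0 : ℝ) * (z 0 0 - z 1 1) = z 1 0 * (P 0 0 - P 1 1) := by exact_mod_cast h4
  have h3 : (eps P z)⁻¹ = formV P (z 1 0) (z 1 1) / P 1 0 := by
    rw [← h2]
    field_simp
    rw [div_self]
    intro h
    rw [h, mul_zero] at h2
    exact hc h2.symm
  rw [h3]
  have : formV P (z 1 0) (z 1 1) / P 1 0 = z 1 0 * root' P + z 1 1 := by
    rw [formV]
    field_simp
  rw [this, eps, formU, trSL]
  push_cast
  refine mul_left_cancel₀ hc ?_
  linear_combination (z 1 0 : ℝ) * h1 - h4'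

/-- Here U = 1 and V = c, the lower left entry of `P`. Then cU - V = 0 reads z₁₀ √(t² - 4) = 0, and
the commutation relations force the remaining entries. -/
theorem eq_one_of_eps_eq_one (hP : 2 < trSL P) {z : SL2Z} (hz : Commute z P) (h : eps P z = 1) :
    z = 1 := by
  have h1 := eps_mul_formV hP hz
  have hc : (P 1 0 : ℝ) ≠ 0 := by exact_mod_cast lowerLeft_ne_zero hP
  have h2 := roots_sub hP
  have h3 : (0 : ℝ) < √((trSL P : ℝ) ^ 2 - 4) := Real.sqrt_pos.2 (disc_pos hP)
  have h4 : (z 1 0 : ℝ) * √((trSL P : ℝ) ^ 2 - 4) = 0 := by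
    rw [h, one_mul, formV] at h1
    rw [eps, formU] at h
    linear_combination (P 1 0 : ℝ) * h - h1 - z 1 0 * h2
  have h5 : z 1 0 = 0 := by
    have := (mul_eq_zero.1 h4).resolve_right h3.ne'
    exact_mod_cast this
  have h6 : z 1 1 = 1 := by
    rw [eps, formU, h5] at h
    simpa using h
  obtain ⟨h7, h8⟩ := commute_entries hz
  have h9 : z 0 1 = 0 := by
    rw [h5, mul_zero] at h7
    exact (mul_eq_zero.1 h7).resolve_right (lowerLeft_ne_zero hP)
  have h10 : z 0 0 = 1 := by
    rw [h5, zero_mul, h6] at h8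
    have := (mul_eq_zero.1 h8).resolve_left (lowerLeft_ne_zero hP)
    omega
  rw [SL2Z.ext_iff', h5, h6, h9, h10]
  simp

theorem eps_inv (hP : 2 < trSL P) {z : SL2Z} (hz : Commute z P) :
    eps P z⁻¹ = (eps P z)⁻¹ := by
  refine eq_inv_of_mul_eq_one_left ?_
  rw [← eps_mul hP hz, inv_mul_cancel, eps_one]

theorem eps_zpow (hP : 2 < trSL P) {z : SL2Z} (hz : Commute z P) (k : ℤ) :
    eps P (z ^ k) = eps P z ^ k := by
  have hpow : ∀ n : ℕ, eps P (z ^ n) = eps P z ^ n := by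
    intro n
    induction n with
    | zero => simp [eps_one]
    | succ n ih => rw [pow_succ, pow_succ, eps_mul hP hz, ih]
  obtain ⟨n, rfl | rfl⟩ := k.eq_nat_or_neg
  · rw [zpow_natCast, zpow_natCast, hpow]
  · rw [zpow_neg, zpow_natCast, zpow_neg, zpow_natCast, eps_inv hP (hz.pow_left n), hpow]

theorem two_lt_trSL_of_one_lt_eps (hP : 2 < trSL P) {z : SL2Z} (hz : Commute z P)
    (h : 1 < eps P z) : 2 < trSL z := by
  have h1 := eps_add_inv hP hz
  have h2 : (2 : ℝ) < trSL z := by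
    rw [← h1]
    have h3 : 0 < eps P z := by linarith
    rw [← sub_pos]
    have : eps P z + (eps P z)⁻¹ - 2 = (eps P z - 1) ^ 2 / eps P z := by
      field_simp
      ring
    rw [this]
    have : 0 < eps P z - 1 := by linarith
    positivity
  exact_mod_cast h2

/-- The centralizer of a hyperbolic element is generated up to sign by a single element. -/
theorem exists_generator (hP : 2 < trSL P) : ∃ z₀ : SL2Z, Commute z₀ P ∧ 1 < eps P z₀ ∧
    ∀ z : SL2Z, Commute z P → 0 < eps P z → ∃ k : ℤ, z = z₀ ^ k := by
  classical
  -- Traces are integers and ε + ε⁻¹ increases for ε > 1, so minimizing the trace minimizes the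
  -- eigenvalue.
  have hex : ∃ n : ℕ, ∃ z : SL2Z, Commute z P ∧ 1 < eps P z ∧ trSL z = n := by
    refine ⟨(trSL P).toNat, P, Commute.refl P, ?_, ?_⟩
    · rw [eps_self hP]
      exact one_lt_eigval hP
    · rw [Int.toNat_of_nonneg (by omega)]
  obtain ⟨z₀, hz₀, h1, htr⟩ := Nat.find_spec hex
  refine ⟨z₀, hz₀, h1, fun z hz hz0 => ?_⟩
  -- Division with remainder: z z₀⁻ᵏ has eigenvalue in [1, ε(z₀)), and minimality leaves only 1.
  obtain ⟨k, hk1, hk2⟩ := exists_mem_Ico_zpow hz0 h1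
  refine ⟨k, ?_⟩
  have hzk : Commute (z₀ ^ k)⁻¹ P := (hz₀.zpow_left k).inv_left
  set y := z * (z₀ ^ k)⁻¹ with hy
  have hyP : Commute y P := hz.mul_left hzk
  have hpos : 0 < eps P z₀ ^ k := zpow_pos (by linarith) k
  have hey : eps P y = eps P z / eps P z₀ ^ k := by
    rw [hy, eps_mul hP hzk, eps_inv hP (hz₀.zpow_left k), eps_zpow hP hz₀, div_eq_mul_inv]
  have hy1 : 1 ≤ eps P y := by rwa [hey, one_le_div hpos]
  have hy2 : eps P y < eps P z₀ := by
    rw [hey, div_lt_iff₀ hpos, ← zpow_one_add₀ (by positivity), add_comm]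
    exact hk2
  rcases hy1.eq_or_lt with h | h
  · exact mul_inv_eq_one.1 (eq_one_of_eps_eq_one hP hyP h.symm)
  · exfalso
    have h2 := two_lt_trSL_of_one_lt_eps hP hyP h
    have h3 : trSL y < trSL z₀ := by
      have e1 := eps_add_inv hP hyP
      have e2 := eps_add_inv hP hz₀
      have : (trSL y : ℝ) < trSL z₀ := by
        rw [← e1, ← e2, ← sub_pos]
        have : eps P z₀ + (eps P z₀)⁻¹ - (eps P y + (eps P y)⁻¹) =
            (eps P z₀ - eps P y) * (eps P z₀ * eps P y - 1) / (eps P z₀ * eps P y) := by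
          field_simp
          ring
        rw [this]
        have h5 : 0 < eps P z₀ - eps P y := by linarith
        have h6 : 0 < eps P z₀ * eps P y - 1 := by nlinarith
        positivity
      exact_mod_cast this
    have h4 : (trSL y).toNat < Nat.find hex := by omega
    refine Nat.find_min hex h4 ⟨y, hyP, h, ?_⟩
    rw [Int.toNat_of_nonneg (by omega)]

end Hyperbolic

/-! ### Passage to PSL(2, ℤ) and the value of Λ -/

/-- The class of a matrix in the modular group. -/
def toModular (A : SL2Z) : Modular := QuotientGroup.mk A

theorem toModular_pow (A : SL2Z) (n : ℕ) : toModular (A ^ n) = toModular A ^ n := rfl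

theorem toModular_surjective : Function.Surjective toModular := QuotientGroup.mk_surjective

theorem toModular_neg (A : SL2Z) : toModular (-A) = toModular A := by
  refine QuotientGroup.eq.2 ?_
  rw [Matrix.SpecialLinearGroup.mem_center_iff]
  refine ⟨-1, by simp, ?_⟩
  have h : (-A)⁻¹ * A = -1 := by
    rw [inv_mul_eq_iff_eq_mul]
    simp
  rw [h]
  ext i j
  fin_cases i <;> fin_cases j <;> simp

theorem toModular_eq_iff {A B : SL2Z} : toModular A = toModular B ↔ A = B ∨ A = -B := by
  constructor
  · intro h
    rcases eq_or_eq_neg_of_mem_center A B (QuotientGroup.eq.1 h) with h | h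
    · exact Or.inl h.symm
    · exact Or.inr (by rw [h, neg_neg])
  · rintro (rfl | rfl)
    · rfl
    · exact toModular_neg B

theorem tr_toModular (A : SL2Z) : tr (toModular A) = |trSL A| := by
  rw [toModular, tr_mk, Matrix.trace_fin_two]
  rfl

theorem exists_lift_of_two_lt_tr {Q : Modular} (h : 2 < tr Q) :
    ∃ A : SL2Z, toModular A = Q ∧ trSL A = tr Q := by
  obtain ⟨A, rfl⟩ := toModular_surjective Q
  rw [tr_toModular] at h ⊢
  rcases le_total 0 (trSL A) with h0 | h0
  · exact ⟨A, rfl, (abs_of_nonneg h0).symm⟩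
  · exact ⟨-A, toModular_neg A, by rw [trSL_neg, abs_of_nonpos h0]⟩

/-- The conjugacy class in the modular group of a matrix. -/
def classOf (A : SL2Z) : ConjClasses Modular := ConjClasses.mk (toModular A)

theorem classTr_classOf (A : SL2Z) : classTr (classOf A) = |trSL A| := tr_toModular A

theorem exists_classOf_eq {C : ConjClasses Modular} (h : 2 < classTr C) :
    ∃ A : SL2Z, classOf A = C ∧ trSL A = classTr C := by
  obtain ⟨Q, rfl⟩ := ConjClasses.mk_surjective C
  obtain ⟨A, hA, htr⟩ := exists_lift_of_two_lt_tr (Q := Q) h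
  exact ⟨A, by rw [classOf, hA], htr⟩

theorem classOf_conj (g A : SL2Z) : classOf (g * A * g⁻¹) = classOf A := by
  rw [classOf, classOf, ConjClasses.mk_eq_mk_iff_isConj, isConj_comm, isConj_iff]
  exact ⟨toModular g, rfl⟩

theorem exists_conj_of_classOf_eq {A P : SL2Z} (h : classOf A = classOf P) :
    ∃ g : SL2Z, A = g * P * g⁻¹ ∨ A = -(g * P * g⁻¹) := by
  rw [classOf, classOf, ConjClasses.mk_eq_mk_iff_isConj, isConj_comm, isConj_iff] at h
  obtain ⟨G, hG⟩ := h
  obtain ⟨g, rfl⟩ := toModular_surjective G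
  exact ⟨g, toModular_eq_iff.1 hG.symm⟩

theorem classOf_eq_iff {A P : SL2Z} (hP : 2 < trSL P) (hA : trSL A = trSL P) :
    classOf A = classOf P ↔ ∃ g : SL2Z, A = g * P * g⁻¹ := by
  constructor
  · intro h
    obtain ⟨g, hg | hg⟩ := exists_conj_of_classOf_eq h
    · exact ⟨g, hg⟩
    · exfalso
      rw [hg, trSL_neg, trSL_conj] at hA
      omega
  · rintro ⟨g, rfl⟩
    exact classOf_conj g P

theorem hypNorm_toModular {A : SL2Z} (h : 2 < trSL A) :
    hypNorm (toModular A) = eigval (trSL A) ^ 2 := by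
  rw [hypNorm, tr_toModular, abs_of_pos (by omega), eigval]

variable {P : SL2Z}

theorem eigval_trSL_eq_eps (hP : 2 < trSL P) {z : SL2Z} (hz : Commute z P) (h : 1 < eps P z) :
    eigval (trSL z) = eps P z :=
  (eq_eigval_of_add_inv (two_lt_trSL_of_one_lt_eps hP hz h) h (eps_add_inv hP hz)).symm

theorem commute_neg_left {z : SL2Z} (hz : Commute z P) : Commute (-z) P := by
  rw [Commute, SemiconjBy, neg_mul, mul_neg, hz.eq]

theorem eps_pos_of_two_lt_trSL (hP : 2 < trSL P) {z : SL2Z} (hz : Commute z P)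
    (h : 2 < trSL z) : 0 < eps P z := by
  have h1 := eps_add_inv hP hz
  by_contra hneg
  have h2 : (eps P z)⁻¹ ≤ 0 := inv_nonpos.2 (not_lt.1 hneg)
  have h3 : (2 : ℝ) < trSL z := by exact_mod_cast h
  linarith

/-- A generator of the centralizer is primitive. -/
theorem isPrimitive_generator (hP : 2 < trSL P) {z₀ : SL2Z} (hz₀ : Commute z₀ P)
    (h1 : 1 < eps P z₀)
    (hgen : ∀ z : SL2Z, Commute z P → 0 < eps P z → ∃ k : ℤ, z = z₀ ^ k) :
    IsPrimitive (toModular z₀) := by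
  have htr := two_lt_trSL_of_one_lt_eps hP hz₀ h1
  have hpos : 0 < eps P z₀ := by linarith
  refine ⟨?_, fun Q j hj hQ => ?_⟩
  · rw [IsHyperbolic, tr_toModular]
    exact htr.trans_le (le_abs_self _)
  · obtain ⟨q, rfl⟩ := toModular_surjective Q
    obtain ⟨k, hk⟩ := hgen P (Commute.refl P) (by
      rw [eps_self hP]
      linarith [one_lt_eigval hP])
    -- Up to sign z₀ is a power of q, so q commutes with z₀ and hence with P, itself a power of z₀.
    have hqz : Commute q z₀ := by
      rw [← toModular_pow, toModular_eq_iff] at hQ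
      rcases hQ with h | h
      · rw [h]
        exact (Commute.refl q).pow_right j
      · rw [h]
        exact (commute_neg_left ((Commute.refl q).pow_left j)).symm
    have hqP : Commute q P := by
      rw [hk]
      exact hqz.zpow_right k
    have key : ∀ y : SL2Z, Commute y P → 0 < eps P y → toModular z₀ = toModular (y ^ j) →
        False := by
      intro y hy hy0 hzy
      obtain ⟨i, rfl⟩ := hgen y hy hy0
      rw [toModular_eq_iff] at hzy
      have e1 : eps P ((z₀ ^ i) ^ j) = eps P z₀ ^ (i * j) := by
        rw [← zpow_natCast, ← zpow_mul, eps_zpow hP hz₀]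
      rcases hzy with h | h
      · have h2 := congrArg (eps P) h
        rw [e1] at h2
        have h3 : (1 : ℤ) = i * j := zpow_right_injective₀ hpos h1.ne' (by simpa using h2)
        have h4 := Int.isUnit_iff.1 (IsUnit.of_mul_eq_one i (by rw [mul_comm]; exact h3.symm))
        omega
      · have h2 := congrArg (eps P) h
        rw [eps_neg, e1] at h2
        have : 0 < eps P z₀ ^ (i * j) := zpow_pos hpos _
        linarith
    rcases lt_or_gt_of_ne (eps_ne_zero hP hqP) with h | h
    · refine key (-q) (commute_neg_left hqP) (by rw [eps_neg]; linarith) ?_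
      rw [toModular_pow, toModular_neg, hQ]
    · exact key q hqP h hQ

/-- Makes the choice inside `Lambda` harmless. A conjugate of a lift of `P₀` is a j-th root of ±P,
so it commutes with P and is a power z₀^k. Primitivity excludes |k| ≥ 2, hyperbolicity excludes k =
0, and z₀ and z₀⁻¹ have the same trace. -/
theorem hypNorm_of_isPrimitive (hP : 2 < trSL P) {z₀ : SL2Z} (hz₀ : Commute z₀ P)
    (h1 : 1 < eps P z₀)
    (hgen : ∀ z : SL2Z, Commute z P → 0 < eps P z → ∃ k : ℤ, z = z₀ ^ k)
    {P₀ : Modular} (hP₀ : IsPrimitive P₀) {j : ℕ} (hj : classOf P = ConjClasses.mk (P₀ ^ j)) :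
    hypNorm P₀ = eps P z₀ ^ 2 := by
  obtain ⟨p, rfl, hp⟩ := exists_lift_of_two_lt_tr hP₀.1
  have hp2 : 2 < trSL p := hp ▸ hP₀.1
  obtain ⟨g, hg⟩ := exists_conj_of_classOf_eq (A := P) (P := p ^ j) hj
  set y := g * p * g⁻¹ with hy
  have hyj : g * p ^ j * g⁻¹ = y ^ j := by rw [hy, conj_pow]
  have hytr : trSL y = trSL p := trSL_conj g p
  rw [hyj] at hg
  have hyP : Commute y P := by
    rcases hg with h | h
    · rw [h]
      exact (Commute.refl y).pow_right j
    · rw [h]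
      exact (commute_neg_left ((Commute.refl y).pow_left j)).symm
  obtain ⟨k, hk⟩ := hgen y hyP (eps_pos_of_two_lt_trSL hP hyP (by omega))
  have hpk : p = g⁻¹ * z₀ ^ k * g := by
    rw [← hk, hy]
    group
  have hnat : ∀ (x : SL2Z) (n : ℕ), p = g⁻¹ * x ^ n * g → n < 2 := by
    intro x n hn
    by_contra h2
    refine hP₀.2 (toModular (g⁻¹ * x * g)) n (not_lt.1 h2) ?_
    rw [← toModular_pow, hn]
    congr 1
    have := conj_pow (i := n) (a := g⁻¹) (b := x)
    rw [inv_inv] at this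
    exact this.symm
  have htrk : trSL (z₀ ^ k) = trSL z₀ := by
    obtain ⟨n, rfl | rfl⟩ := k.eq_nat_or_neg
    · rw [zpow_natCast] at hpk hk ⊢
      have h2 := hnat z₀ n hpk
      interval_cases n
      · exfalso
        rw [pow_zero] at hk
        rw [hk] at hytr
        have : trSL 1 = 2 := by simp [trSL]
        omega
      · rw [pow_one]
    · rw [zpow_neg, zpow_natCast, ← inv_pow] at hpk hk ⊢
      have h2 := hnat z₀⁻¹ n hpk
      interval_cases n
      · exfalso
        rw [pow_zero] at hk
        rw [hk] at hytr
        have : trSL 1 = 2 := by simp [trSL]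
        omega
      · rw [pow_one, trSL_inv]
  rw [hypNorm_toModular hp2, ← hytr, hk, htrk, eigval_trSL_eq_eps hP hz₀ h1]

theorem Lambda_classOf (hP : 2 < trSL P) {z₀ : SL2Z} (hz₀ : Commute z₀ P) (h1 : 1 < eps P z₀)
    (hgen : ∀ z : SL2Z, Commute z P → 0 < eps P z → ∃ k : ℤ, z = z₀ ^ k) :
    Lambda (classOf P) = 2 * Real.log (eps P z₀) := by
  have hex : ∃ P₀ : Modular, IsPrimitive P₀ ∧
      ∃ j : ℕ, 1 ≤ j ∧ classOf P = ConjClasses.mk (P₀ ^ j) := by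
    refine ⟨toModular z₀, isPrimitive_generator hP hz₀ h1 hgen, ?_⟩
    have hE := one_lt_eigval hP
    rw [← eps_self hP] at hE
    obtain ⟨k, hk⟩ := hgen P (Commute.refl P) (by linarith)
    have hk0 : 0 < k := by
      have h2 := congrArg (eps P) hk
      rw [eps_zpow hP hz₀] at h2
      rw [h2] at hE
      exact (one_lt_zpow_iff_right₀ h1).1 hE
    refine ⟨k.toNat, by omega, ?_⟩
    rw [← toModular_pow, ← zpow_natCast, Int.toNat_of_nonneg hk0.le, ← hk]
    rfl
  rw [Lambda, dif_pos hex]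
  obtain ⟨hprim, j, -, hj⟩ := hex.choose_spec
  rw [hypNorm_of_isPrimitive hP hz₀ h1 hgen hprim hj, Real.log_pow]
  norm_num

/-! ### A fundamental domain for the centralizer -/

/-- The cone `0 < V ≤ U < E² V`, a fundamental domain for the centralizer of `P`. -/
def InCone (P : SL2Z) (E x y : ℝ) : Prop :=
  0 < formU P x y ∧ 0 < formV P x y ∧ formV P x y ≤ formU P x y ∧
    formU P x y < E ^ 2 * formV P x y

/-- `z` generates the centralizer of `P` up to sign. -/
def IsGenerator (P z₀ : SL2Z) : Prop :=
  Commute z₀ P ∧ 1 < eps P z₀ ∧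
    ∀ z : SL2Z, Commute z P → 0 < eps P z → ∃ k : ℤ, z = z₀ ^ k

section Cone

variable {P z₀ : SL2Z}

/-- A centralizing z multiplies U by ε and V by ε⁻¹, hence U/V by ε². A power of z₀ brings U/V into
[1, E²), and -1 handles the case where U and V are both negative. -/
theorem exists_mul_inCone (hP : 2 < trSL P) (hz₀ : IsGenerator P z₀) {g : SL2Z}
    (hg : 0 < rowForm P (g 1 0) (g 1 1)) :
    ∃ z : SL2Z, Commute z P ∧ InCone P (eps P z₀) ((g * z) 1 0) ((g * z) 1 1) := by
  have hpos : ∀ g : SL2Z, 0 < formU P (g 1 0) (g 1 1) → 0 < formV P (g 1 0) (g 1 1) →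
      ∃ z : SL2Z, Commute z P ∧ InCone P (eps P z₀) ((g * z) 1 0) ((g * z) 1 1) := by
    intro g hU hV
    have hE : 0 < eps P z₀ := by linarith [hz₀.2.1]
    have hE2 : 1 < eps P z₀ ^ 2 := one_lt_pow₀ hz₀.2.1 two_ne_zero
    obtain ⟨k, hk1, hk2⟩ := exists_mem_Ico_zpow (div_pos hU hV) hE2
    have hz : Commute (z₀ ^ k)⁻¹ P := (hz₀.1.zpow_left k).inv_left
    refine ⟨(z₀ ^ k)⁻¹, hz, ?_⟩
    have heps : eps P (z₀ ^ k)⁻¹ = (eps P z₀ ^ k)⁻¹ := by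
      rw [eps_inv hP (hz₀.1.zpow_left k), eps_zpow hP hz₀.1]
    rw [InCone, formU_row_mul' hP hz, formV_row_mul' hP hz, heps, inv_inv]
    set e := eps P z₀ ^ k with he
    have he0 : 0 < e := zpow_pos hE k
    have h1 : (eps P z₀ ^ 2) ^ k = e * e := by
      rw [he, ← mul_zpow, sq]
    rw [zpow_add_one₀ (by positivity), h1, div_lt_iff₀ hV] at hk2
    rw [h1, le_div_iff₀ hV] at hk1
    refine ⟨by positivity, by positivity, ?_, ?_⟩
    · rw [← div_eq_inv_mul, le_div_iff₀ he0]
      linarith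
    · rw [← div_eq_inv_mul, div_lt_iff₀ he0]
      linarith
  rw [← Int.cast_pos (R := ℝ), ← formU_mul_formV hP] at hg
  rcases pos_and_pos_or_neg_and_neg_of_mul_pos hg with ⟨h1, h2⟩ | ⟨h1, h2⟩
  · exact hpos g h1 h2
  · have hnU : formU P ((-g) 1 0) ((-g) 1 1) = -formU P (g 1 0) (g 1 1) := eps_neg P g
    have hnV : formV P ((-g) 1 0) ((-g) 1 1) = -formV P (g 1 0) (g 1 1) := by
      simp only [formV, Matrix.SpecialLinearGroup.coe_neg, Matrix.neg_apply]
      push_cast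
      ring
    obtain ⟨z, hz, h⟩ := hpos (-g) (by linarith) (by linarith)
    exact ⟨-z, commute_neg_left hz, by rwa [mul_neg, ← neg_mul]⟩

/-- If z = z₀^k keeps a point in the cone, then E⁻¹ < E^k < E, so k = 0. Positivity of U excludes
the sign -1. -/
theorem eq_one_of_inCone (hP : 2 < trSL P) (hz₀ : IsGenerator P z₀) {g z : SL2Z}
    (hz : Commute z P) (hg : InCone P (eps P z₀) (g 1 0) (g 1 1))
    (hgz : InCone P (eps P z₀) ((g * z) 1 0) ((g * z) 1 1)) : z = 1 := by
  rw [InCone, formU_row_mul' hP hz, formV_row_mul' hP hz] at hgz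
  obtain ⟨h1, h2, h3, h4⟩ := hg
  obtain ⟨k1, k2, k3, k4⟩ := hgz
  have hz0 : 0 < eps P z := pos_of_mul_pos_left k1 h1.le
  obtain ⟨k, rfl⟩ := hz₀.2.2 z hz hz0
  have hE : 0 < eps P z₀ := by linarith [hz₀.2.1]
  rw [eps_zpow hP hz₀.1] at hz0 k3 k4
  set e := eps P z₀ ^ k with he
  set U := formU P (g 1 0) (g 1 1)
  set V := formV P (g 1 0) (g 1 1)
  rw [← div_eq_inv_mul, div_le_iff₀ hz0] at k3
  rw [← div_eq_inv_mul, ← mul_div_assoc, lt_div_iff₀ hz0] at k4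
  have h5 : e ^ 2 < eps P z₀ ^ 2 := by
    have : e ^ 2 * V < eps P z₀ ^ 2 * V := by nlinarith
    exact lt_of_mul_lt_mul_right this h2.le
  have h6 : 1 < (e * eps P z₀) ^ 2 := by
    have : 1 * U < (e * eps P z₀) ^ 2 * U := by
      have h7 : U < eps P z₀ ^ 2 * (e * U * e) := h4.trans_le (by gcongr)
      linarith
    exact lt_of_mul_lt_mul_right this h1.le
  have h7 : e < eps P z₀ := lt_of_pow_lt_pow_left₀ 2 hE.le h5
  have h8 : 1 < e * eps P z₀ := by
    rw [← one_pow 2] at h6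
    exact lt_of_pow_lt_pow_left₀ 2 (by positivity) h6
  have h9 : k < 1 := by
    have : eps P z₀ ^ k < eps P z₀ ^ (1 : ℤ) := by rwa [zpow_one]
    exact (zpow_lt_zpow_iff_right₀ hz₀.2.1).1 this
  have h10 : 0 < k + 1 := by
    have : eps P z₀ ^ (0 : ℤ) < eps P z₀ ^ (k + 1) := by
      rwa [zpow_zero, zpow_add_one₀ hE.ne']
    exact (zpow_lt_zpow_iff_right₀ hz₀.2.1).1 this
  have : k = 0 := by omega
  rw [this, zpow_zero]

end Cone

/-! ### Roots modulo n as primitive vectors in the cone -/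

/-- Representatives modulo translations of the matrices with trace `t` and lower left entry `n`. -/
def normalized (t : ℤ) (n : ℕ) : Set SL2Z :=
  {A | trSL A = t ∧ A 1 0 = n ∧ 0 ≤ A 0 0 ∧ A 0 0 < n}

theorem normalized_injOn (t : ℤ) (n : ℕ) :
    Set.InjOn (fun A : SL2Z => (A 0 0).toNat) (normalized t n) := by
  rintro A ⟨hA1, hA2, hA3, hA4⟩ B ⟨hB1, hB2, hB3, hB4⟩ h
  simp only at h
  have h1 : A 0 0 = B 0 0 := by omega
  have h2 : A 1 1 = B 1 1 := by
    unfold trSL at hA1 hB1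
    omega
  have h3 : A 1 0 = B 1 0 := hA2.trans hB2.symm
  have hA := SL2Z.det_eq A
  have hB := SL2Z.det_eq B
  rw [SL2Z.ext_iff']
  refine ⟨h1, ?_, h3, h2⟩
  rw [h1, h2, h3] at hA
  have h4 : A 0 1 * B 1 0 = B 0 1 * B 1 0 := by linarith
  refine mul_right_cancel₀ ?_ h4
  rw [hB2]
  omega

theorem normalized_image (t : ℤ) (n : ℕ) :
    (fun A : SL2Z => (A 0 0).toNat) '' normalized t n =
      (((Finset.range n).filter fun b : ℕ => (n : ℤ) ∣ (b : ℤ) ^ 2 - t * b + 1 : Finset ℕ) :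
        Set ℕ) := by
  ext b
  simp only [Set.mem_image, Finset.coe_filter, Finset.mem_range, Set.mem_ofPred_eq]
  constructor
  · rintro ⟨A, ⟨hA1, hA2, hA3, hA4⟩, rfl⟩
    refine ⟨by omega, ?_⟩
    rw [Int.toNat_of_nonneg hA3]
    have hA := SL2Z.det_eq A
    refine ⟨-A 0 1, ?_⟩
    rw [← hA2, ← hA1, trSL]
    linarith
  · rintro ⟨hb, k, hk⟩
    refine ⟨⟨!![(b : ℤ), -k; (n : ℤ), t - b], ?_⟩, ⟨?_, ?_, ?_, ?_⟩, ?_⟩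
    · rw [Matrix.det_fin_two_of]
      linarith
    · simp [trSL]
    · simp
    · simp
    · simpa using hb
    · simp

theorem normalized_finite (t : ℤ) (n : ℕ) : (normalized t n).Finite := by
  refine Set.Finite.of_finite_image ?_ (normalized_injOn t n)
  rw [normalized_image]
  exact Finset.finite_toSet _

theorem ncard_normalized (t : ℤ) (n : ℕ) : (normalized t n).ncard = rootCount t n := by
  rw [← (normalized_injOn t n).ncard_image, normalized_image, Set.ncard_coe_finset]
  rfl

/-- The primitive vectors in the cone at which `rowForm P` takes the value `n`. -/
def primVectors (P : SL2Z) (E : ℝ) (n : ℕ) : Set (ℤ × ℤ) :=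
  {w | IsCoprime w.1 w.2 ∧ InCone P E w.1 w.2 ∧ rowForm P w.1 w.2 = n}

/-- The matrices with bottom row in the cone which conjugate `P` into `normalized`. -/
def conjugators (P : SL2Z) (E : ℝ) (n : ℕ) : Set SL2Z :=
  {g | InCone P E (g 1 0) (g 1 1) ∧ g * P * g⁻¹ ∈ normalized (trSL P) n}

/-- The unipotent matrix `[[1, k], [0, 1]]`. -/
def translation (k : ℤ) : SL2Z := ⟨!![1, k; 0, 1], by simp⟩

theorem translation_mul_row (k : ℤ) (g : SL2Z) :
    (translation k * g) 1 0 = g 1 0 ∧ (translation k * g) 1 1 = g 1 1 := by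
  simp only [SL2Z.mul_apply]
  simp [translation]

theorem translation_conj (k : ℤ) (A : SL2Z) :
    (translation k * A * (translation k)⁻¹) 1 0 = A 1 0 ∧
      (translation k * A * (translation k)⁻¹) 0 0 = A 0 0 + k * A 1 0 := by
  obtain ⟨h1, -, h3, -⟩ := SL2Z.inv_apply (translation k)
  simp only [SL2Z.mul_apply, h1, h3]
  simp [translation]

theorem eq_translation_mul {g h : SL2Z} (h0 : g 1 0 = h 1 0) (h1 : g 1 1 = h 1 1) :
    ∃ k : ℤ, g = translation k * h := by
  refine ⟨g 0 1 * h 0 0 - g 0 0 * h 0 1, ?_⟩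
  have hg := SL2Z.det_eq g
  have hh := SL2Z.det_eq h
  rw [h0, h1] at hg
  rw [SL2Z.ext_iff']
  simp only [SL2Z.mul_apply]
  simp only [translation, Matrix.of_apply, Matrix.cons_val', Matrix.cons_val_zero,
    Matrix.cons_val_one, Matrix.cons_val_fin_one]
  refine ⟨?_, ?_, by simp [h0], by simp [h1]⟩
  · linear_combination (h 0 0) * hg - (g 0 0) * hh
  · linear_combination (h 0 1) * hg - (g 0 1) * hh

/-- A primitive bottom row determines g up to a left translation by k, which shifts the upper left
entry of g P g⁻¹ by kn. Exactly one shift lands in [0, n). -/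
theorem image_row_conjugators {P : SL2Z} (E : ℝ) {n : ℕ} (hn : 0 < n) :
    (fun g : SL2Z => (g 1 0, g 1 1)) '' conjugators P E n = primVectors P E n ∧
      Set.InjOn (fun g : SL2Z => (g 1 0, g 1 1)) (conjugators P E n) := by
  have hn' : (0 : ℤ) < n := by exact_mod_cast hn
  constructor
  · ext ⟨x, y⟩
    simp only [Set.mem_image, primVectors, Set.mem_ofPred_eq, Prod.mk.injEq]
    constructor
    · rintro ⟨g, ⟨hg1, -, hg2, -, -⟩, rfl, rfl⟩
      refine ⟨⟨-g 0 1, g 0 0, ?_⟩, hg1, ?_⟩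
      · have := SL2Z.det_eq g
        linarith
      · rw [← conj_lowerLeft, hg2]
    · rintro ⟨⟨u, v, huv⟩, hc, hf⟩
      let g : SL2Z := ⟨!![v, -u; x, y], by rw [Matrix.det_fin_two_of]; linarith⟩
      have hgx : g 1 0 = x := rfl
      have hgy : g 1 1 = y := rfl
      set A := g * P * g⁻¹ with hA
      have hA10 : A 1 0 = n := by rw [hA, conj_lowerLeft, hgx, hgy, hf]
      let k := -(A 0 0 / n)
      obtain ⟨r1, r2⟩ := translation_mul_row k g
      refine ⟨translation k * g, ⟨?_, ?_⟩, by rw [r1, hgx], by rw [r2, hgy]⟩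
      · rwa [r1, r2, hgx, hgy]
      · have hconj : translation k * g * P * (translation k * g)⁻¹ =
            translation k * A * (translation k)⁻¹ := by
          rw [hA]
          group
        obtain ⟨t1, t2⟩ := translation_conj k A
        rw [hconj]
        refine ⟨by rw [trSL_conj, hA, trSL_conj], by rw [t1, hA10], ?_, ?_⟩
        · rw [t2, hA10]
          have := Int.emod_nonneg (A 0 0) hn'.ne'
          have h2 := Int.emod_add_mul_ediv (A 0 0) n
          simp only [k]
          linarith
        · rw [t2, hA10]
          have := Int.emod_lt_of_pos (A 0 0) hn'
          have h2 := Int.emod_add_mul_ediv (A 0 0) n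
          simp only [k]
          linarith
  · rintro g ⟨-, -, hg1, hg2, hg3⟩ h ⟨-, -, hh1, hh2, hh3⟩ hgh
    simp only [Prod.mk.injEq] at hgh
    obtain ⟨k, rfl⟩ := eq_translation_mul hgh.1 hgh.2
    have hconj : translation k * h * P * (translation k * h)⁻¹ =
        translation k * (h * P * h⁻¹) * (translation k)⁻¹ := by group
    rw [hconj] at hg2 hg3
    rw [(translation_conj k _).2, hh1] at hg2 hg3
    have hk : k = 0 := by
      have h1 : k < 1 := by
        by_contra hk
        have := mul_le_mul_of_nonneg_right (not_lt.1 hk) hn'.le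
        linarith
      have h2 : -1 < k := by
        by_contra hk
        have := mul_le_mul_of_nonneg_right (not_lt.1 hk) hn'.le
        linarith
      omega
    have : translation 0 = 1 := by
      rw [SL2Z.ext_iff']
      simp [translation]
    rw [hk, this, one_mul]

/-- The fibres of g ↦ g P g⁻¹ are cosets of the centralizer, and the cone meets the bottom rows of
each coset exactly once. -/
theorem image_conj_conjugators {P z₀ : SL2Z} (hP : 2 < trSL P)
    (hz₀ : IsGenerator P z₀) {n : ℕ} (hn : 0 < n) :
    (fun g : SL2Z => g * P * g⁻¹) '' conjugators P (eps P z₀) n =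
        {A ∈ normalized (trSL P) n | classOf A = classOf P} ∧
      Set.InjOn (fun g : SL2Z => g * P * g⁻¹) (conjugators P (eps P z₀) n) := by
  constructor
  · ext A
    simp only [Set.mem_image, Set.mem_ofPred_eq]
    constructor
    · rintro ⟨g, ⟨-, hg⟩, rfl⟩
      exact ⟨hg, classOf_conj g P⟩
    · rintro ⟨hA, hcl⟩
      obtain ⟨g, rfl⟩ := (classOf_eq_iff hP hA.1).1 hcl
      have hpos : 0 < rowForm P (g 1 0) (g 1 1) := by
        rw [← conj_lowerLeft, hA.2.1]
        exact_mod_cast hn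
      obtain ⟨z, hz, hcone⟩ := exists_mul_inCone hP hz₀ hpos
      have hconj : g * z * P * (g * z)⁻¹ = g * P * g⁻¹ := by
        rw [mul_assoc g z P, hz.eq]
        group
      exact ⟨g * z, ⟨hcone, by rwa [hconj]⟩, hconj⟩
  · rintro g ⟨hg, -⟩ h ⟨hh, -⟩ hgh
    simp only at hgh
    have hz : Commute (g⁻¹ * h) P := by
      rw [Commute, SemiconjBy]
      calc g⁻¹ * h * P = g⁻¹ * (h * P * h⁻¹) * h := by group
        _ = P * (g⁻¹ * h) := by rw [← hgh]; group
    have h1 := eq_one_of_inCone hP hz₀ hz hg (by rwa [mul_inv_cancel_left])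
    exact (inv_mul_eq_one.1 h1)

theorem ncard_primVectors {P z₀ : SL2Z} (hP : 2 < trSL P) (hz₀ : IsGenerator P z₀) {n : ℕ}
    (hn : 0 < n) : (primVectors P (eps P z₀) n).Finite ∧ (primVectors P (eps P z₀) n).ncard =
      {A ∈ normalized (trSL P) n | classOf A = classOf P}.ncard := by
  obtain ⟨h1, h2⟩ := image_row_conjugators (P := P) (eps P z₀) hn
  obtain ⟨h3, h4⟩ := image_conj_conjugators hP hz₀ hn
  constructor
  · rw [← h1]
    refine Set.Finite.image _ (Set.Finite.of_finite_image ?_ h4)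
    rw [h3]
    exact (normalized_finite _ _).subset fun A hA => hA.1
  · rw [← h1, ← h3, h2.ncard_image, h4.ncard_image]

/-! ### Reduction theory and finiteness of the classes of given trace -/

/-- Conjugation by a translation by k adds 2ck to the difference of the diagonal entries. -/
theorem exists_conj_abs_sub_le (A : SL2Z) (hA : A 1 0 ≠ 0) :
    ∃ g : SL2Z, (g * A * g⁻¹) 1 0 = A 1 0 ∧
      |(g * A * g⁻¹) 0 0 - (g * A * g⁻¹) 1 1| ≤ |A 1 0| := by
  set c := A 1 0 with hc
  set x := A 0 0 - A 1 1 with hx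
  let k := -((x + |c|) / (2 * c))
  obtain ⟨h1, h2⟩ := translation_conj k A
  refine ⟨translation k, h1, ?_⟩
  have htr : trSL (translation k * A * (translation k)⁻¹) = trSL A := trSL_conj _ _
  unfold trSL at htr
  have h3 : (translation k * A * (translation k)⁻¹) 0 0 -
      (translation k * A * (translation k)⁻¹) 1 1 = x + 2 * c * k := by
    rw [h2] at htr ⊢
    linarith
  rw [h3]
  have h4 := Int.emod_add_mul_ediv (x + |c|) (2 * c)
  have h5 := Int.emod_nonneg (x + |c|) (mul_ne_zero two_ne_zero hA)
  have h6 := Int.emod_lt_abs (x + |c|) (mul_ne_zero two_ne_zero hA)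
  have h7 : |2 * c| = 2 * |c| := by rw [abs_mul]; rfl
  have h8 : x + 2 * c * k = (x + |c|) % (2 * c) - |c| := by
    simp only [k]
    linarith
  rw [h8, abs_le]
  constructor <;> linarith

/-- Every hyperbolic class contains a matrix with small entries. -/
theorem exists_reduced {A : SL2Z} (hA : 2 < trSL A) :
    ∃ g : SL2Z, |(g * A * g⁻¹) 0 0 - (g * A * g⁻¹) 1 1| ≤ |(g * A * g⁻¹) 1 0| ∧
      ((g * A * g⁻¹) 1 0) ^ 2 ≤ trSL A ^ 2 - 4 := by
  classical
  have hex : ∃ m : ℕ, ∃ g : SL2Z, ((g * A * g⁻¹) 1 0).natAbs = m := ⟨_, 1, rfl⟩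
  obtain ⟨g, hg⟩ := Nat.find_spec hex
  have hmin : ∀ h : SL2Z, Nat.find hex ≤ ((h * A * h⁻¹) 1 0).natAbs := fun h =>
    Nat.find_min' hex ⟨h, rfl⟩
  have htr : ∀ h : SL2Z, 2 < trSL (h * A * h⁻¹) := fun h => by rwa [trSL_conj]
  obtain ⟨k, hk1, hk2⟩ := exists_conj_abs_sub_le _ (lowerLeft_ne_zero (htr g))
  have hmul : ∀ h g : SL2Z, h * (g * A * g⁻¹) * h⁻¹ = (h * g) * A * (h * g)⁻¹ := fun h g => by
    group
  rw [hmul] at hk1 hk2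
  refine ⟨k * g, by rwa [hk1], ?_⟩
  set B := k * g * A * (k * g)⁻¹ with hB
  have hBtr : trSL B = trSL A := trSL_conj _ _
  have hBmin : ∀ h : SL2Z, (B 1 0).natAbs ≤ ((h * B * h⁻¹) 1 0).natAbs := by
    intro h
    rw [hk1, hg, hB, hmul]
    exact hmin _
  rw [← hk1] at hk2
  have hdet := SL2Z.det_eq B
  let s : SL2Z := ⟨!![0, -1; 1, 0], by simp⟩
  have hs : rowForm B (s 1 0) (s 1 1) = -B 0 1 := by
    have h1 : s 1 0 = 1 := rfl
    have h2 : s 1 1 = 0 := rfl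
    rw [rowForm, h1, h2]
    ring
  have h1 := hBmin s
  -- Minimality against the inversion `s` gives |c| ≤ |b|. As t² - 4 = (a - d)² + 4bc with (a - d)²
  -- ≤ c² ≤ |bc|, a negative bc would make the discriminant negative, so bc ≥ 0 and c² ≤ t² - 4.
  rw [conj_lowerLeft s B, hs, Int.natAbs_neg, Int.natAbs_le_iff_sq_le] at h1
  have h2 : (B 0 0 - B 1 1) ^ 2 ≤ B 1 0 ^ 2 := sq_le_sq.2 hk2
  have h3 : trSL A ^ 2 - 4 = (B 0 0 - B 1 1) ^ 2 + 4 * (B 0 1 * B 1 0) := by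
    rw [← hBtr, trSL]
    linear_combination 4 * hdet
  have h4 : 0 < B 1 0 ^ 2 := by
    have := lowerLeft_ne_zero (hBtr ▸ hA : 2 < trSL B)
    positivity
  have h5 : (B 1 0 ^ 2) ^ 2 ≤ (B 0 1 * B 1 0) ^ 2 := by
    rw [mul_pow, sq (B 1 0 ^ 2)]
    gcongr
  have h6 : B 1 0 ^ 2 ≤ |B 0 1 * B 1 0| := by
    have := sq_le_sq.1 h5
    rwa [abs_of_pos h4] at this
  rcases abs_cases (B 0 1 * B 1 0) with ⟨h, -⟩ | ⟨h, -⟩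
  · rw [h] at h6
    nlinarith [sq_nonneg (B 0 0 - B 1 1)]
  · rw [h] at h6
    have : 0 < trSL A ^ 2 - 4 := by nlinarith
    linarith

theorem finite_setOf_classTr_eq {t : ℤ} (ht : 2 < t) :
    {C : ConjClasses Modular | classTr C = t}.Finite := by
  let S : Set SL2Z := {A | trSL A = t ∧ |A 0 0 - A 1 1| ≤ |A 1 0| ∧ A 1 0 ^ 2 ≤ t ^ 2 - 4}
  have hS : S.Finite := by
    refine Set.Finite.of_finite_image (f := fun A : SL2Z => (A 0 0, A 1 0)) ?_ ?_
    · refine (Set.finite_Icc ((-(2 * t), -t) : ℤ × ℤ) (2 * t, t)).subset ?_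
      rintro _ ⟨A, ⟨h1, h2, h3⟩, rfl⟩
      have h4 : |A 1 0| ≤ t := abs_le_of_sq_le_sq (by linarith) (by linarith)
      unfold trSL at h1
      have h5 := abs_le.1 (h2.trans h4)
      have h6 := abs_le.1 h4
      exact ⟨⟨by dsimp only; linarith, h6.1⟩, ⟨by dsimp only; linarith, h6.2⟩⟩
    · rintro A ⟨hA, -, -⟩ B ⟨hB, -, -⟩ hAB
      simp only [Prod.mk.injEq] at hAB
      have hdA := SL2Z.det_eq A
      have hdB := SL2Z.det_eq B
      have hc := lowerLeft_ne_zero (hB ▸ ht : 2 < trSL B)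
      unfold trSL at hA hB
      have h1 : A 1 1 = B 1 1 := by omega
      rw [SL2Z.ext_iff']
      refine ⟨hAB.1, ?_, hAB.2, h1⟩
      rw [hAB.1, hAB.2, h1] at hdA
      exact mul_right_cancel₀ hc (by linarith)
  refine (hS.image classOf).subset ?_
  intro C hC
  obtain ⟨A, rfl, hA⟩ := exists_classOf_eq (C := C) (by rw [hC]; exact ht)
  have hAt : trSL A = t := hA.trans hC
  obtain ⟨g, h1, h2⟩ := exists_reduced (hAt ▸ ht)
  exact ⟨g * A * g⁻¹, ⟨by rw [trSL_conj, hAt], h1, hAt ▸ h2⟩, classOf_conj g A⟩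

/-- A system of representatives of the hyperbolic classes, with generators of centralizers. -/
theorem exists_representatives : ∃ P z : ConjClasses Modular → SL2Z, ∀ C, 2 < classTr C →
    classOf (P C) = C ∧ trSL (P C) = classTr C ∧ IsGenerator (P C) (z C) := by
  have h : ∀ C : ConjClasses Modular, ∃ A z : SL2Z, 2 < classTr C →
      classOf A = C ∧ trSL A = classTr C ∧ IsGenerator A z := by
    intro C
    by_cases hC : 2 < classTr C
    · obtain ⟨A, hA, htr⟩ := exists_classOf_eq hC
      obtain ⟨z, hz⟩ := exists_generator (htr ▸ hC : 2 < trSL A)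
      exact ⟨A, z, fun _ => ⟨hA, htr, hz⟩⟩
    · exact ⟨1, 1, fun h => absurd h hC⟩
  choose P z hPz using h
  exact ⟨P, z, hPz⟩

/-- The normalized matrices of lower left entry n are sorted by conjugacy class, and each part is
counted by primitive vectors. -/
theorem rootCount_eq_sum_ncard {t : ℤ} (ht : 2 < t) {P z : ConjClasses Modular → SL2Z}
    (hPz : ∀ C, 2 < classTr C →
      classOf (P C) = C ∧ trSL (P C) = classTr C ∧ IsGenerator (P C) (z C)) {n : ℕ} (hn : 0 < n) :
    rootCount t n = ∑ C ∈ (finite_setOf_classTr_eq ht).toFinset,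
      (primVectors (P C) (eps (P C) (z C)) n).ncard := by
  classical
  rw [← ncard_normalized, Set.ncard_eq_toFinset_card _ (normalized_finite t n),
    Finset.card_eq_sum_card_fiberwise (f := classOf)
      (t := (finite_setOf_classTr_eq ht).toFinset)]
  · refine Finset.sum_congr rfl fun C hC => ?_
    have hCt : classTr C = t := by simpa using hC
    obtain ⟨h1, h2, h3⟩ := hPz C (by omega)
    rw [(ncard_primVectors (by omega) h3 hn).2, h1, h2, hCt, ← Set.ncard_coe_finset]
    congr 1
    ext A
    simp
  · intro A hA
    have hAt : trSL A = t := by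
      have : A ∈ normalized t n := by simpa using hA
      exact this.1
    simp only [Set.Finite.coe_toFinset, Set.mem_ofPred_eq]
    rw [classTr_classOf, hAt, abs_of_pos (by omega)]

/-! ### From primitive vectors to all vectors -/

/-- The vectors in the cone at which `rowForm P` takes the value `n`. -/
def allVectors (P : SL2Z) (E : ℝ) (n : ℕ) : Set (ℤ × ℤ) :=
  {w | InCone P E w.1 w.2 ∧ rowForm P w.1 w.2 = n}

theorem inCone_mul_iff {P : SL2Z} {E m x y : ℝ} (hm : 0 < m) :
    InCone P E (m * x) (m * y) ↔ InCone P E x y := by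
  have hU : formU P (m * x) (m * y) = m * formU P x y := by unfold formU; ring
  have hV : formV P (m * x) (m * y) = m * formV P x y := by unfold formV; ring
  rw [InCone, InCone, hU, hV, mul_pos_iff_of_pos_left hm, mul_pos_iff_of_pos_left hm,
    mul_le_mul_iff_right₀ hm, mul_left_comm, mul_lt_mul_iff_right₀ hm]

theorem rowForm_mul (P : SL2Z) (m x y : ℤ) :
    rowForm P (m * x) (m * y) = m ^ 2 * rowForm P x y := by
  unfold rowForm
  ring

theorem setOf_gcd_eq {P : SL2Z} {E : ℝ} {m b : ℕ} (hm : 0 < m) :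
    {w ∈ allVectors P E (m ^ 2 * b) | Int.gcd w.1 w.2 = m} =
      (fun w : ℤ × ℤ => ((m : ℤ) * w.1, (m : ℤ) * w.2)) '' primVectors P E b := by
  have hm' : (0 : ℝ) < m := by exact_mod_cast hm
  have hm0 : ((m : ℤ) ^ 2) ≠ 0 := by positivity
  ext ⟨x, y⟩
  simp only [Set.mem_image, Set.mem_ofPred_eq, allVectors, primVectors, Prod.mk.injEq]
  constructor
  · rintro ⟨⟨h1, h2⟩, h3⟩
    obtain ⟨u, hu⟩ : (m : ℤ) ∣ x := h3 ▸ Int.gcd_dvd_left x y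
    obtain ⟨v, hv⟩ : (m : ℤ) ∣ y := h3 ▸ Int.gcd_dvd_right x y
    refine ⟨(u, v), ⟨?_, ?_, ?_⟩, hu.symm, hv.symm⟩
    · rw [Int.isCoprime_iff_gcd_eq_one]
      rw [hu, hv, Int.gcd_mul_left, Int.natAbs_natCast] at h3
      exact Nat.eq_of_mul_eq_mul_left hm (by rw [h3, mul_one])
    · rw [hu, hv] at h1
      push_cast at h1
      exact (inCone_mul_iff hm').1 h1
    · rw [hu, hv, rowForm_mul] at h2
      push_cast at h2
      exact mul_left_cancel₀ hm0 h2
  · rintro ⟨⟨u, v⟩, ⟨h1, h2, h3⟩, rfl, rfl⟩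
    refine ⟨⟨?_, ?_⟩, ?_⟩
    · push_cast
      exact (inCone_mul_iff hm').2 h2
    · rw [rowForm_mul, h3]
      push_cast
      rfl
    · rw [Int.gcd_mul_left, Int.natAbs_natCast, Int.isCoprime_iff_gcd_eq_one.1 h1, mul_one]

theorem gcd_pos_of_mem_allVectors {P : SL2Z} {E : ℝ} {n : ℕ} (hn : 0 < n) {w : ℤ × ℤ}
    (hw : w ∈ allVectors P E n) : 0 < Int.gcd w.1 w.2 ∧ Int.gcd w.1 w.2 ^ 2 ∣ n := by
  obtain ⟨h1, h2⟩ := hw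
  constructor
  · rw [Int.gcd_pos_iff]
    by_contra! h
    rw [h.1, h.2] at h2
    simp only [rowForm, ne_eq, OfNat.ofNat_ne_zero, not_false_eq_true, zero_pow, mul_zero,
      add_zero] at h2
    omega
  · obtain ⟨u, hu⟩ := Int.gcd_dvd_left w.1 w.2
    obtain ⟨v, hv⟩ := Int.gcd_dvd_right w.1 w.2
    have h3 : rowForm P w.1 w.2 = (Int.gcd w.1 w.2 : ℤ) ^ 2 * rowForm P u v := by
      rw [← rowForm_mul, ← hu, ← hv]
    rw [h2] at h3
    have : ((Int.gcd w.1 w.2 ^ 2 : ℕ) : ℤ) ∣ n := ⟨_, by push_cast; exact h3⟩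
    exact_mod_cast this

/-- A vector of gcd m is m times a primitive one, and its value is divided by m². On Dirichlet
series this is the factor ζ(2s). -/
theorem ncard_allVectors {P : SL2Z} {E : ℝ} (hfin : ∀ b, 0 < b → (primVectors P E b).Finite)
    {n : ℕ} (hn : 0 < n) : (allVectors P E n).Finite ∧
      (allVectors P E n).ncard = ∑ x ∈ n.divisorsAntidiagonal,
        (if IsSquare x.1 then 1 else 0) * (primVectors P E x.2).ncard := by
  classical
  have hfib : ∀ x ∈ n.divisorsAntidiagonal, ∀ m : ℕ, x.1 = m ^ 2 →
      {w ∈ allVectors P E n | Int.gcd w.1 w.2 = m} =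
        (fun w : ℤ × ℤ => ((m : ℤ) * w.1, (m : ℤ) * w.2)) '' primVectors P E x.2 ∧
      0 < m ∧ 0 < x.2 := by
    rintro ⟨a, b⟩ hx m rfl
    have hx := Nat.mem_divisorsAntidiagonal.1 hx
    simp only at hx
    have hm : 0 < m := by
      rcases Nat.eq_zero_or_pos m with rfl | h
      · simp at hx
        omega
      · exact h
    have hb : 0 < b := by
      rcases Nat.eq_zero_or_pos b with rfl | h
      · simp at hx
        omega
      · exact h
    refine ⟨?_, hm, hb⟩
    rw [← hx.1]
    exact setOf_gcd_eq hm
  have hF : (allVectors P E n).Finite := by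
    have hsub : allVectors P E n ⊆ ⋃ m ∈ Finset.range (n + 1),
        {w ∈ allVectors P E n | Int.gcd w.1 w.2 = m} := by
      intro w hw
      obtain ⟨h1, h2⟩ := gcd_pos_of_mem_allVectors hn hw
      simp only [Set.mem_iUnion]
      refine ⟨_, Finset.mem_range.2 ?_, hw, rfl⟩
      have h3 := Nat.le_of_dvd hn h2
      nlinarith
    refine Set.Finite.subset (Set.Finite.biUnion (Finset.finite_toSet _) fun m _ => ?_) hsub
    rcases Set.eq_empty_or_nonempty {w ∈ allVectors P E n | Int.gcd w.1 w.2 = m} with h | ⟨w, hw⟩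
    · rw [h]
      exact Set.finite_empty
    · obtain ⟨h1, h2⟩ := gcd_pos_of_mem_allVectors hn hw.1
      rw [hw.2] at h1 h2
      obtain ⟨h3, -, h4⟩ := hfib (m ^ 2, n / m ^ 2)
        (Nat.mem_divisorsAntidiagonal.2 ⟨Nat.mul_div_cancel' h2, hn.ne'⟩) m rfl
      rw [h3]
      exact (hfin _ h4).image _
  refine ⟨hF, ?_⟩
  rw [Set.ncard_eq_toFinset_card _ hF, Finset.card_eq_sum_card_fiberwise
    (f := fun w : ℤ × ℤ => (Int.gcd w.1 w.2 ^ 2, n / Int.gcd w.1 w.2 ^ 2))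
    (t := n.divisorsAntidiagonal)]
  · refine Finset.sum_congr rfl fun x hx => ?_
    by_cases hsq : IsSquare x.1
    · obtain ⟨m, hm⟩ := hsq
      rw [← sq] at hm
      obtain ⟨h1, hm0, h2⟩ := hfib x hx m hm
      have hinj : Function.Injective (fun w : ℤ × ℤ => ((m : ℤ) * w.1, (m : ℤ) * w.2)) := by
        rintro ⟨a, b⟩ ⟨c, d⟩ h
        simpa [hm0.ne'] using h
      rw [if_pos ⟨m, by rw [hm, sq]⟩, one_mul, ← Set.ncard_image_of_injective _ hinj, ← h1,
        ← Set.ncard_coe_finset]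
      congr 1
      ext w
      have hx' := Nat.mem_divisorsAntidiagonal.1 hx
      simp only [Finset.coe_filter, Set.Finite.mem_toFinset, Set.mem_ofPred_eq,
        and_congr_right_iff]
      intro _
      constructor
      · intro h
        have := congrArg Prod.fst h
        simp only at this
        rw [hm] at this
        exact Nat.pow_left_injective two_ne_zero this
      · intro h
        rw [h, ← hm]
        ext
        · rfl
        · simp only
          rw [← hx'.1, Nat.mul_div_cancel_left _ (by rw [hm]; positivity)]
    · rw [if_neg hsq, zero_mul, Finset.card_eq_zero, Finset.filter_eq_empty_iff]
      intro w _ h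
      refine hsq ⟨Int.gcd w.1 w.2, ?_⟩
      rw [← h, sq]
  · intro w hw
    have hw : w ∈ allVectors P E n := by simpa using hw
    obtain ⟨h1, h2⟩ := gcd_pos_of_mem_allVectors hn hw
    exact Nat.mem_divisorsAntidiagonal.2 ⟨Nat.mul_div_cancel' h2, hn.ne'⟩

/-! ### Area and lattice points of the hyperbolic sector -/

open MeasureTheory

/-- The cone `0 < x₁ ≤ x₀ < E² x₁` in the plane. -/
def planeCone (E : ℝ) : Set (Fin 2 → ℝ) := {x | 0 < x 1 ∧ x 1 ≤ x 0 ∧ x 0 < E ^ 2 * x 1}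

/-- The part of the cone below the hyperbola `u v = 1`. -/
def hyperbolicSector (E : ℝ) : Set (ℝ × ℝ) :=
  {p | 0 < p.2 ∧ p.2 ≤ p.1 ∧ p.1 < E ^ 2 * p.2 ∧ p.1 * p.2 ≤ 1}

theorem measurableSet_hyperbolicSector (E : ℝ) : MeasurableSet (hyperbolicSector E) := by
  refine ((measurableSet_lt measurable_const measurable_snd).inter
    ((measurableSet_le measurable_snd measurable_fst).inter
      ((measurableSet_lt measurable_fst (measurable_snd.const_mul _)).inter
        (measurableSet_le (measurable_fst.mul measurable_snd) measurable_const))))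

theorem section_hyperbolicSector {E : ℝ} (hE : 1 < E) (u : ℝ) :
    Prod.mk u ⁻¹' hyperbolicSector E =
      if 0 < u then Set.Ioc (u / E ^ 2) (min u u⁻¹) else ∅ := by
  have hE2 : 0 < E ^ 2 := by positivity
  ext v
  simp only [hyperbolicSector, Set.mem_preimage, Set.mem_ofPred_eq]
  split_ifs with hu
  · rw [Set.mem_Ioc, le_min_iff, div_lt_iff₀ hE2, ← one_div, le_div_iff₀ hu, mul_comm v u,
      mul_comm v (E ^ 2)]
    constructor
    · rintro ⟨-, h2, h3, h4⟩
      exact ⟨h3, h2, h4⟩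
    · rintro ⟨h3, h2, h4⟩
      exact ⟨pos_of_mul_pos_right (hu.trans h3) hE2.le, h2, h3, h4⟩
  · simp only [Set.mem_empty_iff_false, iff_false]
    rintro ⟨h1, h2, -⟩
    exact hu (h1.trans_le h2)

theorem setLIntegral_Ioc_ofReal {a b : ℝ} (hab : a ≤ b) {f : ℝ → ℝ}
    (hf : ContinuousOn f (Set.uIcc a b)) (hf0 : ∀ x ∈ Set.Ioc a b, 0 ≤ f x) :
    ∫⁻ x in Set.Ioc a b, ENNReal.ofReal (f x) = ENNReal.ofReal (∫ x in a..b, f x) := by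
  rw [intervalIntegral.integral_of_le hab, ofReal_integral_eq_lintegral_ofReal]
  · exact (hf.intervalIntegrable).1
  · exact (ae_restrict_iff' measurableSet_Ioc).2 (Eventually.of_forall hf0)

theorem volume_hyperbolicSector {E : ℝ} (hE : 1 < E) :
    volume (hyperbolicSector E) = ENNReal.ofReal (Real.log E) := by
  have hE0 : 0 < E := by linarith
  have hE2 : 1 < E ^ 2 := one_lt_pow₀ hE two_ne_zero
  -- The vertical section is (u/E², min(u, 1/u)]. The upper end changes at u = 1, and the section is
  -- empty beyond u = E.
  have h1 : ∀ u : ℝ, volume (Prod.mk u ⁻¹' hyperbolicSector E) =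
      (Set.Ioc 0 1).indicator (fun u => ENNReal.ofReal (u - u / E ^ 2)) u +
        (Set.Ioc 1 E).indicator (fun u => ENNReal.ofReal (u⁻¹ - u / E ^ 2)) u := by
    intro u
    rw [section_hyperbolicSector hE]
    by_cases hu : 0 < u
    · rw [if_pos hu, Real.volume_Ioc]
      rcases le_or_gt u 1 with hu1 | hu1
      · rw [Set.indicator_of_mem (Set.mem_Ioc.2 ⟨hu, hu1⟩),
          Set.indicator_of_notMem (fun h => absurd h.1 (not_lt.2 hu1)), add_zero,
          min_eq_left (hu1.trans ((one_le_inv₀ hu).2 hu1))]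
      · rw [Set.indicator_of_notMem (fun h => absurd h.2 (not_le.2 hu1)), zero_add,
          min_eq_right ((inv_le_one_of_one_le₀ hu1.le).trans hu1.le)]
        by_cases huE : u ≤ E
        · rw [Set.indicator_of_mem (Set.mem_Ioc.2 ⟨hu1, huE⟩)]
        · rw [Set.indicator_of_notMem (fun h => huE h.2), ENNReal.ofReal_eq_zero, sub_nonpos,
            inv_le_iff_one_le_mul₀ hu, div_mul_eq_mul_div, one_le_div (by positivity)]
          nlinarith
    · rw [if_neg hu, measure_empty, Set.indicator_of_notMem (fun h => hu h.1),
        Set.indicator_of_notMem (fun h => hu (zero_lt_one.trans h.1)), add_zero]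
  rw [Measure.volume_eq_prod, Measure.prod_apply (measurableSet_hyperbolicSector E)]
  simp_rw [h1]
  have hm1 : Measurable fun u : ℝ => ENNReal.ofReal (u - u / E ^ 2) := by fun_prop
  rw [lintegral_add_left (hm1.indicator measurableSet_Ioc), lintegral_indicator measurableSet_Ioc,
    lintegral_indicator measurableSet_Ioc, setLIntegral_Ioc_ofReal zero_le_one,
    setLIntegral_Ioc_ofReal hE.le]
  · have e1 : ∫ u in (0 : ℝ)..1, (u - u / E ^ 2) = (1 - 1 / E ^ 2) / 2 := by
      rw [intervalIntegral.integral_sub (by simp) (by simp), intervalIntegral.integral_div,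
        integral_id]
      ring
    have e2 : ∫ u in (1 : ℝ)..E, (u⁻¹ - u / E ^ 2) = Real.log E - (1 - 1 / E ^ 2) / 2 := by
      rw [intervalIntegral.integral_sub, intervalIntegral.integral_div, integral_id,
        integral_inv_of_pos zero_lt_one hE0, div_one]
      · field_simp
      · refine ContinuousOn.intervalIntegrable (continuousOn_inv₀.mono ?_)
        intro x hx
        rw [Set.uIcc_of_le hE.le] at hx
        exact ne_of_gt (zero_lt_one.trans_le hx.1)
      · exact (Continuous.intervalIntegrable (by fun_prop) _ _)
    have h3 : 1 / E ^ 2 ≤ 1 := by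
      rw [div_le_one (by positivity)]
      exact hE2.le
    rw [e1, e2, ← ENNReal.ofReal_add (by linarith)]
    · congr 1
      ring
    · rw [← e2]
      refine intervalIntegral.integral_nonneg hE.le fun u hu => ?_
      have hu0 : 0 < u := zero_lt_one.trans_le hu.1
      rw [sub_nonneg, div_le_iff₀ (by positivity), ← div_eq_inv_mul, le_div_iff₀ hu0]
      nlinarith [hu.2, hu.1]
  · refine ContinuousOn.sub (continuousOn_inv₀.mono ?_) (by fun_prop)
    intro x hx
    rw [Set.uIcc_of_le hE.le] at hx
    exact ne_of_gt (zero_lt_one.trans_le hx.1)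
  · intro u hu
    have hu0 : 0 < u := zero_lt_one.trans hu.1
    rw [sub_nonneg, div_le_iff₀ (by positivity), ← div_eq_inv_mul, le_div_iff₀ hu0]
    nlinarith [hu.2, hu.1]
  · fun_prop
  · intro u hu
    rw [sub_nonneg, div_le_iff₀ (by positivity)]
    nlinarith [hu.1]

theorem setOf_planeCone_eq (E : ℝ) : {x ∈ planeCone E | x 0 * x 1 ≤ 1} =
    MeasurableEquiv.finTwoArrow ⁻¹' hyperbolicSector E := by
  ext x
  simp only [planeCone, hyperbolicSector, Set.mem_ofPred_eq, Set.mem_preimage,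
    MeasurableEquiv.finTwoArrow_apply, and_assoc]

/-- For the bounding curves of the sector, each of which meets a vertical line at most once. -/
theorem volume_null_of_sections {S : Set (ℝ × ℝ)} (hS : MeasurableSet S)
    (h : ∀ u, (Prod.mk u ⁻¹' S).Subsingleton) :
    volume (MeasurableEquiv.finTwoArrow ⁻¹' S : Set (Fin 2 → ℝ)) = 0 := by
  rw [(volume_preserving_finTwoArrow ℝ).measure_preimage hS.nullMeasurableSet,
    Measure.volume_eq_prod, Measure.measure_prod_null hS]
  exact Eventually.of_forall fun u => (h u).measure_zero _

theorem volume_frontier_planeCone {E : ℝ} (hE : 1 < E) :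
    volume (frontier {x | x ∈ planeCone E ∧ x 0 * x 1 ≤ 1}) = 0 := by
  have hsub : frontier {x : Fin 2 → ℝ | x ∈ planeCone E ∧ x 0 * x 1 ≤ 1} ⊆
      (MeasurableEquiv.finTwoArrow ⁻¹' {p : ℝ × ℝ | 0 = p.2}) ∪
      (MeasurableEquiv.finTwoArrow ⁻¹' {p : ℝ × ℝ | p.2 = p.1}) ∪
      (MeasurableEquiv.finTwoArrow ⁻¹' {p : ℝ × ℝ | p.1 = E ^ 2 * p.2}) ∪
      (MeasurableEquiv.finTwoArrow ⁻¹' {p : ℝ × ℝ | p.1 * p.2 = 1}) := by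
    have heq : {x : Fin 2 → ℝ | x ∈ planeCone E ∧ x 0 * x 1 ≤ 1} =
        (({x | 0 < x 1} ∩ {x | x 1 ≤ x 0}) ∩ {x | x 0 < E ^ 2 * x 1}) ∩ {x | x 0 * x 1 ≤ 1} := by
      ext x
      simp only [planeCone, Set.mem_ofPred_eq, Set.mem_inter_iff, and_assoc]
    rw [heq]
    have f1 : frontier {x : Fin 2 → ℝ | 0 < x 1} ⊆ {x | 0 = x 1} :=
      frontier_lt_subset_eq (by fun_prop) (by fun_prop)
    have f2 : frontier {x : Fin 2 → ℝ | x 1 ≤ x 0} ⊆ {x | x 1 = x 0} :=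
      frontier_le_subset_eq (by fun_prop) (by fun_prop)
    have f3 : frontier {x : Fin 2 → ℝ | x 0 < E ^ 2 * x 1} ⊆ {x | x 0 = E ^ 2 * x 1} :=
      frontier_lt_subset_eq (by fun_prop) (by fun_prop)
    have f4 : frontier {x : Fin 2 → ℝ | x 0 * x 1 ≤ 1} ⊆ {x | x 0 * x 1 = 1} :=
      frontier_le_subset_eq (by fun_prop) (by fun_prop)
    intro x hx
    rcases frontier_inter_subset _ _ hx with ⟨hx, -⟩ | ⟨-, hx⟩
    · rcases frontier_inter_subset _ _ hx with ⟨hx, -⟩ | ⟨-, hx⟩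
      · rcases frontier_inter_subset _ _ hx with ⟨hx, -⟩ | ⟨-, hx⟩
        · exact Or.inl (Or.inl (Or.inl (f1 hx)))
        · exact Or.inl (Or.inl (Or.inr (f2 hx)))
      · exact Or.inl (Or.inr (f3 hx))
    · exact Or.inr (f4 hx)
  have hE2 : E ^ 2 ≠ 0 := by positivity
  refine measure_mono_null hsub (measure_union_null (measure_union_null (measure_union_null ?_ ?_)
    ?_) ?_)
  · refine volume_null_of_sections (measurableSet_eq_fun measurable_const measurable_snd) ?_
    intro u v hv v' hv'
    have h1 : 0 = v := hv
    have h2 : 0 = v' := hv'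
    rw [← h1, ← h2]
  · refine volume_null_of_sections (measurableSet_eq_fun measurable_snd measurable_fst) ?_
    intro u v hv v' hv'
    have h1 : v = u := hv
    have h2 : v' = u := hv'
    rw [h1, h2]
  · refine volume_null_of_sections
      (measurableSet_eq_fun measurable_fst (measurable_snd.const_mul _)) ?_
    intro u v hv v' hv'
    have h1 : u = E ^ 2 * v := hv
    have h2 : u = E ^ 2 * v' := hv'
    exact mul_left_cancel₀ hE2 (h1.symm.trans h2)
  · refine volume_null_of_sections
      (measurableSet_eq_fun (measurable_fst.mul measurable_snd) measurable_const) ?_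
    intro u v hv v' hv'
    have h1 : u * v = 1 := hv
    have h2 : u * v' = 1 := hv'
    exact mul_left_cancel₀ (left_ne_zero_of_mul_eq_one h1) (h1.trans h2.symm)

/-- The number of lattice points in a hyperbolic sector. -/
theorem tendsto_card_planeCone {E : ℝ} (hE : 1 < E) (b : Module.Basis (Fin 2) ℝ (Fin 2 → ℝ)) :
    Tendsto (fun c : ℝ => Nat.card ({x ∈ planeCone E | x 0 * x 1 ≤ c} ∩
      (Submodule.span ℤ (Set.range b) : Set (Fin 2 → ℝ)) : Set (Fin 2 → ℝ)) / c) atTop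
      (𝓝 (Real.log E / |(Matrix.of b).det|)) := by
  have h := ZLattice.covolume.tendsto_card_le_div (Submodule.span ℤ (Set.range b))
    (X := planeCone E) (F := fun x => x 0 * x 1) ?_ ?_ ?_ ?_ (volume_frontier_planeCone hE)
  · have hcov : ZLattice.covolume (Submodule.span ℤ (Set.range b)) = |(Matrix.of b).det| := by
      rw [ZLattice.covolume_eq_det _ (b.restrictScalars ℤ)]
      congr 3
      ext i j
      simp
    have hvol : volume.real {x ∈ planeCone E | x 0 * x 1 ≤ 1} = Real.log E := by
      rw [setOf_planeCone_eq, measureReal_def,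
        (volume_preserving_finTwoArrow ℝ).measure_preimage
          (measurableSet_hyperbolicSector E).nullMeasurableSet, volume_hyperbolicSector hE,
        ENNReal.toReal_ofReal (Real.log_nonneg hE.le)]
    rwa [hcov, hvol] at h
  · rintro x r ⟨h1, h2, h3⟩ hr
    simp only [planeCone, Set.mem_ofPred_eq, Pi.smul_apply, smul_eq_mul]
    refine ⟨by positivity, by gcongr, ?_⟩
    rw [mul_left_comm]
    gcongr
  · intro x r _
    simp only [Pi.smul_apply, smul_eq_mul, Fintype.card_fin]
    ring
  · refine (Metric.isBounded_Icc (0 : Fin 2 → ℝ) (fun _ => E ^ 2)).subset ?_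
    rintro x ⟨⟨h1, h2, h3⟩, h4⟩
    have hE2 : 1 < E ^ 2 := one_lt_pow₀ hE two_ne_zero
    have h5 : x 1 ≤ 1 := by nlinarith
    have h6 : x 0 ≤ E ^ 2 := by nlinarith
    constructor
    · intro i
      fin_cases i
      · exact (h1.trans_le h2).le
      · exact h1.le
    · intro i
      fin_cases i
      · exact h6
      · exact h5.trans hE2.le
  · rw [setOf_planeCone_eq]
    exact MeasurableEquiv.finTwoArrow.measurable (measurableSet_hyperbolicSector E)

/-- The map (U, V) carries ℤ² to a lattice of covolume √(t² - 4) and the form to the product of the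
coordinates. The rows of `M` are the images of the standard basis vectors. -/
theorem tendsto_ncard_inCone {P : SL2Z} (hP : 2 < trSL P) {E : ℝ} (hE : 1 < E) :
    Tendsto (fun N : ℕ => ({w : ℤ × ℤ | InCone P E w.1 w.2 ∧ rowForm P w.1 w.2 ≤ N}.ncard : ℝ) / N)
      atTop (𝓝 (Real.log E / √((trSL P : ℝ) ^ 2 - 4))) := by
  have hD : 0 < √((trSL P : ℝ) ^ 2 - 4) := Real.sqrt_pos.2 (disc_pos hP)
  set M : Matrix (Fin 2) (Fin 2) ℝ := !![root P, P 1 0 * root' P; 1, P 1 0] with hM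
  have hdet : M.det = √((trSL P : ℝ) ^ 2 - 4) := by
    rw [hM, Matrix.det_fin_two_of, ← roots_sub hP]
    ring
  let b : Module.Basis (Fin 2) ℝ (Fin 2 → ℝ) := basisOfLinearIndependentOfCardEqFinrank
    (Matrix.linearIndependent_rows_of_det_ne_zero (A := M) (by rw [hdet]; exact hD.ne')) (by simp)
  have hb : (b : Fin 2 → Fin 2 → ℝ) = M := coe_basisOfLinearIndependentOfCardEqFinrank _ _
  have h := (tendsto_card_planeCone hE b).comp (tendsto_natCast_atTop_atTop (R := ℝ))
  have hb' : |(Matrix.of b).det| = √((trSL P : ℝ) ^ 2 - 4) := by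
    rw [hb]
    change |M.det| = _
    rw [hdet, abs_of_pos hD]
  rw [hb'] at h
  refine h.congr fun N => ?_
  simp only [Function.comp]
  congr 2
  let f : ℤ × ℤ → Fin 2 → ℝ := fun w => ![formU P w.1 w.2, formV P w.1 w.2]
  have hinj : Function.Injective f := by
    rintro ⟨x, y⟩ ⟨x', y'⟩ hxy
    have e0 : formU P x y = formU P x' y' := congrFun hxy 0
    have e1 : formV P x y = formV P x' y' := congrFun hxy 1
    have hc : (P 1 0 : ℝ) ≠ 0 := by exact_mod_cast lowerLeft_ne_zero hP
    unfold formU at e0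
    unfold formV at e1
    have e2 : ((x : ℝ) - x') * √((trSL P : ℝ) ^ 2 - 4) = 0 := by
      rw [← roots_sub hP]
      linear_combination (P 1 0 : ℝ) * e0 - e1
    have e3 : (x : ℝ) = x' := by
      have := (mul_eq_zero.1 e2).resolve_right hD.ne'
      linarith
    rw [e3] at e0
    have e4 : (y : ℝ) = y' := by linarith
    exact Prod.ext (by exact_mod_cast e3) (by exact_mod_cast e4)
  rw [← Set.ncard_image_of_injective _ hinj, Nat.card_coe_set_eq]
  congr 1
  ext x
  simp only [Set.mem_inter_iff, SetLike.mem_coe, Set.mem_image, Set.mem_ofPred_eq,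
    Submodule.mem_span_range_iff_exists_fun, Fin.sum_univ_two]
  rw [hb]
  constructor
  · rintro ⟨⟨⟨h1, h2, h3⟩, h4⟩, c, rfl⟩
    have k0 : (c 0 • M 0 + c 1 • M 1) 0 = formU P (c 0) (c 1) := by
      simp [hM, formU]
    have k1 : (c 0 • M 0 + c 1 • M 1) 1 = formV P (c 0) (c 1) := by
      simp [hM, formV]
      ring
    rw [k1] at h1
    rw [k0, k1] at h2 h3 h4
    refine ⟨(c 0, c 1), ⟨⟨h1.trans_le h2, h1, h2, h3⟩, ?_⟩, ?_⟩
    · simp only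
      rw [formU_mul_formV hP] at h4
      exact_mod_cast h4
    · ext i
      fin_cases i
      · exact k0.symm
      · exact k1.symm
  · rintro ⟨⟨x, y⟩, ⟨⟨h0, h1, h2, h3⟩, h4⟩, rfl⟩
    refine ⟨⟨⟨h1, h2, h3⟩, ?_⟩, ![x, y], ?_⟩
    · change formU P x y * formV P x y ≤ N
      rw [formU_mul_formV hP]
      exact_mod_cast h4
    · ext i
      fin_cases i
      · simp [hM, f, formU]
      · simp [hM, f, formV]
        ring

theorem rowForm_pos_of_inCone {P : SL2Z} (hP : 2 < trSL P) {E : ℝ} {x y : ℤ}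
    (h : InCone P E x y) : 0 < rowForm P x y := by
  have h1 := formU_mul_formV hP x y
  have h2 := mul_pos h.1 h.2.1
  rw [h1] at h2
  exact_mod_cast h2

theorem sum_ncard_allVectors {P : SL2Z} (hP : 2 < trSL P) {E : ℝ}
    (hfin : ∀ n, 0 < n → (allVectors P E n).Finite) (N : ℕ) :
    ∑ n ∈ Finset.Icc 1 N, (allVectors P E n).ncard =
      {w : ℤ × ℤ | InCone P E w.1 w.2 ∧ rowForm P w.1 w.2 ≤ N}.ncard := by
  classical
  set T : Set (ℤ × ℤ) := {w : ℤ × ℤ | InCone P E w.1 w.2 ∧ rowForm P w.1 w.2 ≤ N} with hT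
  have hmaps : ∀ w ∈ T, (rowForm P w.1 w.2).toNat ∈ Finset.Icc 1 N := by
    rintro w ⟨h1, h2⟩
    have := rowForm_pos_of_inCone hP h1
    rw [Finset.mem_Icc]
    omega
  have hfib : ∀ n ∈ Finset.Icc 1 N, {w ∈ T | (rowForm P w.1 w.2).toNat = n} =
      allVectors P E n := by
    intro n hn
    rw [Finset.mem_Icc] at hn
    ext w
    simp only [hT, allVectors, Set.mem_ofPred_eq]
    constructor
    · rintro ⟨⟨h1, h2⟩, h3⟩
      have := rowForm_pos_of_inCone hP h1
      exact ⟨h1, by omega⟩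
    · rintro ⟨h1, h2⟩
      exact ⟨⟨h1, by omega⟩, by omega⟩
  have hTfin : T.Finite := by
    refine Set.Finite.subset (Set.Finite.biUnion (Finset.finite_toSet (Finset.Icc 1 N))
      fun n hn => hfin n (Finset.mem_Icc.1 hn).1) fun w hw => ?_
    have h1 := hmaps w hw
    refine Set.mem_biUnion (x := (rowForm P w.1 w.2).toNat) h1 ?_
    rw [← hfib _ h1]
    exact ⟨hw, rfl⟩
  rw [Set.ncard_eq_toFinset_card _ hTfin, Finset.card_eq_sum_card_fiberwise
    (f := fun w : ℤ × ℤ => (rowForm P w.1 w.2).toNat) (t := Finset.Icc 1 N)]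
  · refine Finset.sum_congr rfl fun n hn => ?_
    rw [← hfib n hn, ← Set.ncard_coe_finset]
    congr 1
    ext w
    simp
  · intro w hw
    exact hmaps w (by simpa using hw)

/-! ### The class number formula -/

/-- The indicator function of the nonzero squares. -/
noncomputable def squareFun : ArithmeticFunction ℂ :=
  open Classical in ⟨fun n => if n ≠ 0 ∧ IsSquare n then 1 else 0, by simp⟩

theorem squareFun_apply {n : ℕ} (hn : n ≠ 0) [Decidable (IsSquare n)] :
    squareFun n = if IsSquare n then 1 else 0 := by
  simp [squareFun, hn]

theorem norm_squareFun_le (n : ℕ) : ‖squareFun n‖ ≤ 1 := by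
  simp only [squareFun, ArithmeticFunction.coe_mk]
  split_ifs <;> simp

theorem LSeries_squareFun {s : ℝ} (hs : 1 < s) :
    LSeries squareFun s = riemannZeta (2 * s) := by
  have hinj : Function.Injective (fun m : ℕ => m ^ 2) := Nat.pow_left_injective two_ne_zero
  rw [zeta_eq_tsum_one_div_nat_cpow (by simp; linarith), LSeries, ← hinj.tsum_eq]
  · refine tsum_congr fun m => ?_
    rcases eq_or_ne m 0 with rfl | hm
    · simp [show (s : ℂ) ≠ 0 by exact_mod_cast (by linarith : s ≠ 0)]
    · have hsq : IsSquare (m ^ 2) := ⟨m, sq m⟩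
      rw [LSeries.term_of_ne_zero (pow_ne_zero 2 hm)]
      simp only [squareFun, ArithmeticFunction.coe_mk]
      rw [if_pos ⟨pow_ne_zero 2 hm, hsq⟩, Nat.cast_pow, ← Complex.natCast_cpow_natCast_mul]
      norm_num
  · intro n hn
    rw [Function.mem_support] at hn
    rcases eq_or_ne n 0 with rfl | hn0
    · simp at hn
    · rw [LSeries.term_of_ne_zero hn0] at hn
      simp only [squareFun, ArithmeticFunction.coe_mk] at hn
      by_cases h : IsSquare n
      · obtain ⟨m, rfl⟩ := h
        exact ⟨m, sq m⟩
      · simp [h] at hn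

theorem rootMoebius_mul_zeta (t : ℤ) :
    rootMoebius t * (ArithmeticFunction.zeta : ArithmeticFunction ℂ) = rootFun t := by
  rw [rootMoebius, mul_assoc, ArithmeticFunction.coe_moebius_mul_coe_zeta, mul_one]

/-- If the convolution of the nonzero squares with `rootFun t` has mean value `l`, then
`∑ rootMoebius t n / n = l / ζ(2)`. -/
theorem zeta_two_mul_eq_of_tendsto {t : ℤ} {G : ℂ}
    (hG : Tendsto (fun N : ℕ => ∑ n ∈ Finset.Ioc 0 N, rootMoebius t n / n) atTop (𝓝 G))
    {f : ℕ → ℝ} (hf0 : ∀ n, 0 ≤ f n) {l : ℝ}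
    (hf : Tendsto (fun N : ℕ => (∑ n ∈ Finset.Icc 1 N, f n) / (N : ℝ)) atTop (𝓝 l))
    (hroot : ∀ n, n ≠ 0 → (rootCount t n : ℝ) ≤ f n)
    (hconv : ∀ n, n ≠ 0 → (f n : ℂ) = (squareFun * rootFun t) n) :
    riemannZeta 2 * G = l := by
  -- A nonnegative f with a mean value has an absolutely convergent series for s > 1, and domination
  -- by f passes this to the root count.
  have hsumf : ∀ s : ℝ, 1 < s → LSeriesSummable (fun n => (f n : ℂ)) s := fun s hs => by
    refine LSeriesSummable_of_sum_norm_bigO_and_nonneg ?_ hf0 zero_le_one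
      (by rwa [Complex.ofReal_re])
    exact Asymptotics.isBigO_atTop_natCast_rpow_of_tendsto_div_rpow (by simpa using hf)
  have hsumr : ∀ s : ℝ, 1 < s → LSeriesSummable (rootFun t) s := fun s hs => by
    refine Summable.of_norm_bounded (hsumf s hs).norm fun n => LSeries.norm_term_le s ?_
    rcases eq_or_ne n 0 with rfl | hn
    · simp
    · rw [rootFun_apply, Complex.norm_natCast, Complex.norm_real, Real.norm_of_nonneg (hf0 n)]
      exact hroot n hn
  have hsumg : ∀ s : ℝ, 1 < s → LSeriesSummable (rootMoebius t) s := fun s hs => by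
    refine ArithmeticFunction.LSeriesSummable_mul (hsumr s hs) ?_
    exact ArithmeticFunction.LSeriesSummable_moebius_iff.2 (by simpa)
  have hsums : ∀ s : ℝ, 1 < s → LSeriesSummable squareFun s := fun s hs =>
    LSeriesSummable_of_bounded_of_one_lt_real (fun n _ => norm_squareFun_le n) hs
  have hsumz : ∀ s : ℝ, 1 < s →
      LSeriesSummable (ArithmeticFunction.zeta : ArithmeticFunction ℂ) s := fun s hs =>
    ArithmeticFunction.LSeriesSummable_zeta_iff.2 (by simpa)
  -- The Dirichlet series of f is ζ(2s) ζ(s) times that of ρ_t * μ. Multiplied by s - 1, it tends to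
  -- the mean value l on one side and to ζ(2)G on the other.
  have hprod : ∀ s : ℝ, 1 < s → LSeries (fun n => (f n : ℂ)) s =
      riemannZeta (2 * s) * (LSeries (rootMoebius t) s * riemannZeta s) := fun s hs => by
    rw [LSeries_congr (fun {n} hn => hconv n hn), ArithmeticFunction.LSeries_mul' (hsums s hs)
      (hsumr s hs), LSeries_squareFun hs, ← rootMoebius_mul_zeta,
      ArithmeticFunction.LSeries_mul' (hsumg s hs) (hsumz s hs)]
    congr 2
    exact ArithmeticFunction.LSeries_zeta_eq_riemannZeta (by simpa)
  have h1 := LSeries_tendsto_sub_mul_nhds_one_of_tendsto_sum_div_and_nonneg f hf hf0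
  have hto : Tendsto (fun s : ℝ => (s : ℂ)) (𝓝[>] 1) (𝓝[≠] 1) := by
    refine tendsto_nhdsWithin_iff.2 ⟨?_, ?_⟩
    · exact (Complex.continuous_ofReal.tendsto' 1 1 (by simp)).mono_left nhdsWithin_le_nhds
    · filter_upwards [self_mem_nhdsWithin] with s hs
      have : s ≠ 1 := ne_of_gt hs
      simpa using this
  have h2 := riemannZeta_residue_one.comp hto
  have h3 : Tendsto (fun s : ℝ => riemannZeta (2 * s)) (𝓝[>] 1) (𝓝 (riemannZeta 2)) := by
    have hc : ContinuousAt riemannZeta 2 := (differentiableAt_riemannZeta (by norm_num)).continuousAt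
    refine hc.tendsto.comp ?_
    refine Tendsto.mono_left ?_ nhdsWithin_le_nhds
    exact Continuous.tendsto' (by fun_prop) _ _ (by simp)
  have h4 := tendsto_LSeries_nhdsGT_one hG hsumg
  have h5 := (h3.mul h4).mul h2
  rw [mul_one] at h5
  refine tendsto_nhds_unique (h5.congr' ?_) h1
  filter_upwards [self_mem_nhdsWithin] with s hs
  rw [hprod s hs]
  simp only [Function.comp_apply]
  ring

/-- For t ≥ 3, t² - 4 lies strictly between (t - 1)² and t². -/
theorem not_isSquare_sq_sub_four {t : ℤ} (ht : 2 < t) : ¬ IsSquare (t ^ 2 - 4) := by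
  rintro ⟨m, hm⟩
  rw [← sq, ← sq_abs m] at hm
  have h0 := abs_nonneg m
  have h1 : |m| < t := by nlinarith
  nlinarith

/-- The analytic class number formula for the discriminant `t² - 4`. -/
theorem zeta_two_mul_eq_sum_Lambda {t : ℤ} (ht : 2 < t) {G : ℂ}
    (hG : Tendsto (fun N : ℕ => ∑ n ∈ Finset.Ioc 0 N, rootMoebius t n / n) atTop (𝓝 G)) :
    riemannZeta 2 * G = ∑ C ∈ (finite_setOf_classTr_eq ht).toFinset,
      (Lambda C : ℂ) / (2 * (√((t : ℝ) ^ 2 - 4) : ℂ)) := by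
  classical
  obtain ⟨P, z, hPz⟩ := exists_representatives
  set S := (finite_setOf_classTr_eq ht).toFinset with hS
  have hmem : ∀ C ∈ S, classTr C = t := fun C hC => by simpa [hS] using hC
  have hrep : ∀ C ∈ S, 2 < trSL (P C) ∧ trSL (P C) = t ∧ classOf (P C) = C ∧
      IsGenerator (P C) (z C) := fun C hC => by
    have h := hPz C (by rw [hmem C hC]; exact ht)
    rw [hmem C hC] at h
    exact ⟨h.2.1 ▸ ht, h.2.1, h.1, h.2.2⟩
  have hprim : ∀ C ∈ S, ∀ b, 0 < b → (primVectors (P C) (eps (P C) (z C)) b).Finite :=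
    fun C hC b hb => (ncard_primVectors (hrep C hC).1 (hrep C hC).2.2.2 hb).1
  set f : ℕ → ℝ := fun n => ∑ C ∈ S, ((allVectors (P C) (eps (P C) (z C)) n).ncard : ℝ) with hf
  have hf0 : ∀ n, 0 ≤ f n := fun n => Finset.sum_nonneg fun _ _ => Nat.cast_nonneg _
  have hconv : ∀ n, n ≠ 0 → f n = ∑ x ∈ n.divisorsAntidiagonal,
      (if IsSquare x.1 then 1 else 0) * (rootCount t x.2 : ℝ) := by
    intro n hn
    have h1 : f n = ∑ C ∈ S, ∑ x ∈ n.divisorsAntidiagonal, (if IsSquare x.1 then (1 : ℝ) else 0) *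
        ((primVectors (P C) (eps (P C) (z C)) x.2).ncard : ℝ) := by
      refine Finset.sum_congr rfl fun C hC => ?_
      rw [(ncard_allVectors (hprim C hC) (Nat.pos_of_ne_zero hn)).2]
      push_cast
      rfl
    rw [h1, Finset.sum_comm]
    refine Finset.sum_congr rfl fun x hx => ?_
    have hx2 : 0 < x.2 := Nat.pos_of_ne_zero
      (Nat.ne_zero_of_mem_divisorsAntidiagonal hx).2
    rw [rootCount_eq_sum_ncard ht hPz hx2, Nat.cast_sum, Finset.mul_sum]
  -- The term of the convolution at the square divisor 1.
  have hroot : ∀ n, n ≠ 0 → (rootCount t n : ℝ) ≤ f n := by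
    intro n hn
    rw [hconv n hn]
    have h := Finset.single_le_sum (f := fun x : ℕ × ℕ =>
      (if IsSquare x.1 then 1 else 0) * (rootCount t x.2 : ℝ)) (s := n.divisorsAntidiagonal)
      (fun x _ => by positivity)
      (a := (1, n)) (Nat.mem_divisorsAntidiagonal.2 ⟨one_mul n, hn⟩)
    simpa using h
  have hlim : Tendsto (fun N : ℕ => (∑ n ∈ Finset.Icc 1 N, f n) / (N : ℝ)) atTop
      (𝓝 (∑ C ∈ S, Real.log (eps (P C) (z C)) / √((t : ℝ) ^ 2 - 4))) := by
    have h : Tendsto (fun N : ℕ => ∑ C ∈ S, ({w : ℤ × ℤ | InCone (P C) (eps (P C) (z C)) w.1 w.2 ∧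
        rowForm (P C) w.1 w.2 ≤ N}.ncard : ℝ) / N) atTop
        (𝓝 (∑ C ∈ S, Real.log (eps (P C) (z C)) / √((t : ℝ) ^ 2 - 4))) := by
      refine tendsto_finsetSum _ fun C hC => ?_
      have h := tendsto_ncard_inCone (hrep C hC).1 (hrep C hC).2.2.2.2.1
      rwa [(hrep C hC).2.1] at h
    refine h.congr fun N => ?_
    rw [← Finset.sum_div, Finset.sum_comm]
    congr 1
    refine Finset.sum_congr rfl fun C hC => ?_
    rw [← sum_ncard_allVectors (hrep C hC).1
      (fun n hn => (ncard_allVectors (hprim C hC) hn).1) N]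
    push_cast
    rfl
  rw [zeta_two_mul_eq_of_tendsto hG hf0 hlim hroot fun n hn => ?_, Complex.ofReal_sum]
  · refine Finset.sum_congr rfl fun C hC => ?_
    obtain ⟨h1, -, h3, h4⟩ := hrep C hC
    have h5 := Lambda_classOf h1 h4.1 h4.2.1 h4.2.2
    rw [h3] at h5
    rw [h5]
    push_cast
    rw [mul_div_mul_left _ _ two_ne_zero]
  · rw [hconv n hn, ArithmeticFunction.mul_apply]
    push_cast
    refine Finset.sum_congr rfl fun x hx => ?_
    rw [squareFun_apply (Nat.ne_zero_of_mem_divisorsAntidiagonal hx).1, rootFun_apply]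
    split_ifs <;> simp

/-! ### Summation over traces -/

/-- Poisson summation leaves the finite Fourier transform of a ↦ S(a², 1; q), already evaluated as q
times the Möbius transform of the root count. Evenness of `w` removes the reflection n ↦ -n. -/
theorem tsum_kloosterman_mul_fourier {w : ℝ → ℂ} (hw_smooth : ContDiff ℝ ∞ w)
    (hw_even : ∀ t : ℝ, w (-t) = w t) (hw_supp : HasCompactSupport w) {T : Finset ℤ}
    (hT : ∀ n : ℤ, n ∉ T → w n = 0) {q : ℕ} (hq : q ≠ 0) :
    Summable (fun l : ℤ => kloosterman (l ^ 2) 1 q * 𝓕 w ((l : ℝ) / (q : ℝ))) ∧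
    ∑' l : ℤ, kloosterman (l ^ 2) 1 q * 𝓕 w ((l : ℝ) / (q : ℝ)) =
      q * ∑ n ∈ T, w n * rootMoebius n q := by
  have : NeZero q := ⟨hq⟩
  set f : SchwartzMap ℝ ℂ := hw_supp.toSchwartzMap hw_smooth with hf
  have hfw : ∀ x, f x = w x := fun x => rfl
  have hFw : ∀ x, 𝓕 f x = 𝓕 w x := fun x => by rw [SchwartzMap.fourier_coe]; rfl
  obtain ⟨h1, h2⟩ := tsum_mul_fourier_div f hq (c := fun l => kloosterman (l ^ 2) 1 q)
    (fun k a => kloosterman_sq_add_mul a k 1 q) ⟨q, fun l => norm_kloosterman_le _ _ _⟩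
  simp only [hFw] at h1 h2
  refine ⟨h1, h2.trans ?_⟩
  have h3 : ∀ a : ℕ, ∑' n : ℤ, f (-n) * addChar q (n * a) =
      ∑ n ∈ T, w n * addChar q (n * a) := fun a => by
    rw [tsum_eq_sum (s := T)]
    · exact Finset.sum_congr rfl fun n _ => by rw [hfw, hw_even]
    · intro n hn
      rw [hfw, hw_even, hT n hn, zero_mul]
  simp only [h3, Finset.mul_sum]
  rw [Finset.sum_comm]
  refine Finset.sum_congr rfl fun n _ => ?_
  rw [mul_left_comm, ← sum_kloosterman_mul_addChar_eq n hq, Finset.mul_sum]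
  exact Finset.sum_congr rfl fun a _ => by ring

end PrimeGeodesic

open PrimeGeodesic

theorem theorem1p3 (w : ℝ → ℂ) (hw_smooth : ContDiff ℝ ∞ w) (hw_even : ∀ t : ℝ, w (-t) = w t)
    (hw_supp : HasCompactSupport w) (hw_zero : ∀ t ∈ Set.Icc (-2 : ℝ) 2, w t = 0) :
    Summable (fun C : PrimeGeodesic.HyperbolicClass =>
      (PrimeGeodesic.Lambda C.1 : ℂ) * (w (PrimeGeodesic.classTr C.1) /
        (Real.sqrt ((PrimeGeodesic.classTr C.1 : ℝ) ^ 2 - 4) : ℂ))) ∧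
    (∀ q : ℕ, 1 ≤ q → Summable (fun l : ℤ =>
      PrimeGeodesic.kloosterman (l ^ 2) 1 q * 𝓕 w ((l : ℝ) / (q : ℝ)))) ∧
    Tendsto
      (fun Q : ℕ => riemannZeta 2 * ∑ q ∈ Finset.Icc 1 Q, ((q : ℂ) ^ 2)⁻¹ *
        ∑' l : ℤ, PrimeGeodesic.kloosterman (l ^ 2) 1 q * 𝓕 w ((l : ℝ) / (q : ℝ)))
      atTop
      (𝓝 (∑' C : PrimeGeodesic.HyperbolicClass,
        (PrimeGeodesic.Lambda C.1 : ℂ) * (w (PrimeGeodesic.classTr C.1) /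
          (Real.sqrt ((PrimeGeodesic.classTr C.1 : ℝ) ^ 2 - 4) : ℂ)))) := by
  classical
  obtain ⟨r, hr⟩ := hw_supp.isCompact.isBounded.subset_closedBall 0
  obtain ⟨B, hB⟩ := exists_nat_ge r
  have hwB : ∀ n : ℤ, w n ≠ 0 → 2 < |n| ∧ |n| ≤ B := by
    intro n hn
    constructor
    · by_contra! h
      refine hn (hw_zero n ?_)
      rw [Set.mem_Icc, ← abs_le]
      exact_mod_cast h
    · have h := hr (subset_tsupport w hn)
      rw [mem_closedBall_zero_iff, Real.norm_eq_abs] at h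
      exact_mod_cast h.trans hB
  set U : Finset ℤ := Finset.Ioc 2 (B : ℤ) with hU
  have hU2 : ∀ t ∈ U, 2 < t := fun t ht => (Finset.mem_Ioc.1 ht).1
  have hdisj : Disjoint U (U.image Neg.neg) := by
    rw [Finset.disjoint_left]
    intro t ht ht'
    obtain ⟨s, hs, rfl⟩ := Finset.mem_image.1 ht'
    have := hU2 _ ht
    have := hU2 _ hs
    omega
  have hT : ∀ n : ℤ, n ∉ U ∪ U.image Neg.neg → w n = 0 := by
    intro n hn
    by_contra h
    obtain ⟨h1, h2⟩ := hwB n h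
    refine hn (Finset.mem_union.2 ?_)
    rcases abs_cases n with ⟨h3, -⟩ | ⟨h3, -⟩ <;> rw [h3] at h1 h2
    · exact Or.inl (Finset.mem_Ioc.2 ⟨h1, h2⟩)
    · exact Or.inr (Finset.mem_image.2 ⟨-n, Finset.mem_Ioc.2 ⟨h1, h2⟩, neg_neg n⟩)
  -- Traces t and -t contribute equally. The resulting 2 cancels the 1/2 in the class number
  -- formula.
  have hsum : ∀ q : ℕ, ∑ n ∈ U ∪ U.image Neg.neg, w n * rootMoebius n q =
      ∑ t ∈ U, 2 * w t * rootMoebius t q := by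
    intro q
    rw [Finset.sum_union hdisj, Finset.sum_image neg_injective.injOn, ← Finset.sum_add_distrib]
    refine Finset.sum_congr rfl fun t _ => ?_
    rw [rootMoebius_neg, Int.cast_neg, hw_even]
    ring
  set S : ℤ → Finset (ConjClasses Modular) := fun t =>
    if ht : 2 < t then (finite_setOf_classTr_eq ht).toFinset else ∅ with hS
  have hSmem : ∀ t C, C ∈ S t ↔ 2 < t ∧ classTr C = t := by
    intro t C
    by_cases ht : 2 < t <;> simp [hS, ht]
  set g : ConjClasses Modular → ℂ := fun C =>
    (Lambda C : ℂ) * (w (classTr C) / (Real.sqrt ((classTr C : ℝ) ^ 2 - 4) : ℂ)) with hg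
  set R : Finset HyperbolicClass := (U.biUnion S).subtype (fun C => 2 < classTr C) with hR
  have hzero : ∀ C : HyperbolicClass, C ∉ R → g C.1 = 0 := by
    intro C hC
    have hw0 : w (classTr C.1) = 0 := by
      by_contra h
      obtain ⟨-, h2⟩ := hwB _ h
      refine hC (Finset.mem_subtype.2 (Finset.mem_biUnion.2
        ⟨classTr C.1, Finset.mem_Ioc.2 ⟨C.2, (le_abs_self _).trans h2⟩, ?_⟩))
      exact (hSmem _ _).2 ⟨C.2, rfl⟩
    simp only [hg, hw0, zero_div, mul_zero]
  have htsum : ∑' C : HyperbolicClass, g C.1 = ∑ t ∈ U, ∑ C ∈ S t, g C := by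
    rw [tsum_eq_sum hzero, hR, Finset.sum_subtype_of_mem, Finset.sum_biUnion]
    · intro s _ t _ hst
      rw [Function.onFun, Finset.disjoint_left]
      intro C h1 h2
      exact hst (((hSmem _ _).1 h1).2.symm.trans ((hSmem _ _).1 h2).2)
    · intro C hC
      obtain ⟨t, -, h⟩ := Finset.mem_biUnion.1 hC
      obtain ⟨h1, h2⟩ := (hSmem _ _).1 h
      rwa [h2]
  have hpoisson := fun {q : ℕ} (hq : q ≠ 0) =>
    tsum_kloosterman_mul_fourier hw_smooth hw_even hw_supp hT hq
  refine ⟨summable_of_ne_finset_zero hzero, fun q hq => (hpoisson (by omega)).1, ?_⟩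
  change Tendsto _ atTop (𝓝 (∑' C : HyperbolicClass, g C.1))
  rw [htsum]
  -- One factor q of q⁻² is absorbed. For each Q this is a finite combination over t of partial sums
  -- of Σ_q (ρ_t * μ)(q)/q, so the limit can be taken for each t separately.
  have hpartial : ∀ Q : ℕ, riemannZeta 2 * ∑ q ∈ Finset.Icc 1 Q, ((q : ℂ) ^ 2)⁻¹ *
      ∑' l : ℤ, kloosterman (l ^ 2) 1 q * 𝓕 w ((l : ℝ) / (q : ℝ)) =
      ∑ t ∈ U, 2 * w t * (riemannZeta 2 * ∑ q ∈ Finset.Ioc 0 Q, rootMoebius t q / q) := by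
    intro Q
    have h : ∀ q ∈ Finset.Icc 1 Q, ((q : ℂ) ^ 2)⁻¹ *
        ∑' l : ℤ, kloosterman (l ^ 2) 1 q * 𝓕 w ((l : ℝ) / (q : ℝ)) =
        ∑ t ∈ U, 2 * w t * (rootMoebius t q / q) := by
      intro q hq
      have hq0 : q ≠ 0 := by
        have := (Finset.mem_Icc.1 hq).1
        omega
      have hqc : (q : ℂ) ≠ 0 := Nat.cast_ne_zero.2 hq0
      rw [(hpoisson hq0).2, hsum, ← mul_assoc, Finset.mul_sum]
      refine Finset.sum_congr rfl fun t _ => ?_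
      field_simp
    rw [Finset.sum_congr rfl h, Finset.sum_comm, Finset.mul_sum]
    refine Finset.sum_congr rfl fun t _ => ?_
    rw [← Finset.mul_sum, mul_left_comm]
    rfl
  simp only [hpartial]
  refine tendsto_finsetSum _ fun t ht => ?_
  have ht2 := hU2 t ht
  obtain ⟨G, hG⟩ := exists_tendsto_sum_rootMoebius_div (t := t) (by nlinarith)
    (not_isSquare_sq_sub_four ht2)
  have hlim := (hG.const_mul (riemannZeta 2)).const_mul (2 * w t)
  rw [zeta_two_mul_eq_sum_Lambda ht2 hG, Finset.mul_sum] at hlim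
  have hSt : S t = (finite_setOf_classTr_eq ht2).toFinset := by
    simp only [hS, dif_pos ht2]
  convert hlim using 2
  rw [hSt]
  refine Finset.sum_congr rfl fun C hC => ?_
  have hC' : classTr C = t := by simpa using hC
  simp only [hg, hC']
  field_simp
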